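/- Let $d\in\{2,3\}$, let $\Omega\subset\mathbb R^d$ be a nonempty bounded convex open set, $X=\Omega\times S^{d-1}$, and $\Gamma_\pm=\{(x,\theta)\in\partial\Omega\times S^{d-1}:\pm\theta\cdot\nu(x)>0\}$ with $\nu$ the outward unit normal. Write $$(K\phi)(x,\theta)=\oint_{S^{d-1}} f(\theta,\theta')\phi(x,\theta')\,d\theta',\qquad (A\phi)(x)=\oint_{S^{d-1}}\phi(x,\theta)\,d\theta,\qquad \tilde A\phi=\tfrac1{|S^{d-1}|}A\phi,\qquad (A^*u)(x,\theta)=u(x),$$ where the scattering kernel $f\ge 0$ is measurable and symmetric with $\oint f(\theta,\theta')\,d\theta'=1$ for all $\theta$. Let $c_1,c_2>0$ and $\mathcal D=\{u \text{ measurable on }\Omega: c_1\le u\le c_2 \text{ a.e.}\}$. Assume $\mu_{a,xi},\mu_{s,x},\mu_{a,m},\mu_{s,m},\mu_{a,xf}\in\mathcal D$, let $\eta$ be measurable with $0\le\eta\le1$, and let $0<q_b\in L^2(\Gamma_-,|\theta\cdot\nu|)$. Put $\mu_{a,x}=\mu_{a,xi}+\mu_{a,xf}$. Let $\phi_x,\phi_m\in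 L^2(X)$ be the solutions of $$(\theta\cdot\nabla+\mu_{a,x}+\mu_{s,x}-\mu_{s,x}K)\phi_x=0,\quad \phi_x|_{\Gamma_-}=q_b,$$ $$(\theta\cdot\nabla+\mu_{a,m}+\mu_{s,m}-\mu_{s,m}K)\phi_m=\eta\,\mu_{a,xf}\,\tilde A\phi_x,\quad \phi_m|_{\Gamma_-}=0,$$ and let $$h=H(\mu_{a,xf},\eta)=(\mu_{a,xi}+(1-\eta)\mu_{a,xf})A\phi_x+\mu_{a,m}A\phi_m .$$ For given data $h^*>0$ on $\Omega$ let $\mathcal F(\mu_{a,xf},\eta)=\frac12\|\log H(\mu_{a,xf},\eta)-\log h^*\|_{L^2(\Omega)}^2$. Assume that $\log h-\log h^*$, $\frac1h$ and $\frac1h(\log h-\log h^*)$ belong to $L^2(\Omega)$. Let $\phi_m^*,\phi_x^*\in L^2(X)$ be the solutions of the adjoint equations $$(-\theta\cdot\nabla+\mu_{a,m}+\mu_{s,m}-\mu_{s,m}K)\phi_m^*=A^*\Big(\tfrac1h(\log h-\log h^*)\mu_{a,m}\Big),\quad \phi_m^*|_{\Gamma_+}=0,$$ $$(-\theta\cdot\nabla+\mu_{a,xi}+\mu_{a,xf}+\mu_{s,x}-\mu_{s,x}K)\phi_x^*=A^*\Big(\eta\mu_{a,xf}\tilde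 A\phi_m^*+\tfrac1h(\log h-\log h^*)(\mu_{a,xi}+(1-\eta)\mu_{a,xf})\Big),\quad \phi_x^*|_{\Gamma_+}=0 .$$ Let $h_f$ and $h_\eta$ be feasible directions at $\mu_{a,xf}$ and $\eta$, i.e. for all small $s>0$ one has $\mu_{a,xf}+sh_f\in\mathcal D$ and $0\le\eta+sh_\eta\le1$ a.e. Then $\mathcal F(\mu_{a,xf}+sh_f,\eta+sh_\eta)$ is finite for all small $s>0$, and the directional derivative $$\mathcal F'(\mu_{a,xf},\eta)(h_f,h_\eta)=\lim_{s\downarrow0}\frac{\mathcal F(\mu_{a,xf}+sh_f,\eta+sh_\eta)-\mathcal F(\mu_{a,xf},\eta)}s$$ exists and equals $$\Big\langle \tfrac1h(\log h-\log h^*)(1-\eta)A\phi_x+\eta\,(A\phi_m^*)(\tilde A\phi_x)-A(\phi_x^*\phi_x),\,h_f\Big\rangle+\Big\langle -\tfrac1h(\log h-\log h^*)\mu_{a,xf}A\phi_x+\mu_{a,xf}(A\phi_m^*)(\tilde A\phi_x),\,h_\eta\Big\rangle,$$ where $\langle u,v\rangle=\int_\Omega uv\,dx$ and both integrals converge absolutely.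 -/

import Mathlib

open MeasureTheory Set Filter Topology

noncomputable section

namespace FPAT

/-- The physical space `ℝ^d` with its Euclidean structure. -/
abbrev Space (d : ℕ) : Type := EuclideanSpace ℝ (Fin d)

/-- The angular space `S^{d-1}`. -/
abbrev Dir (d : ℕ) : Type := Metric.sphere (0 : Space d) 1

/-- The surface measure `dθ` on `S^{d-1}`. -/
def sphereMeasure (d : ℕ) : Measure (Dir d) := (volume : Measure (Space d)).toSphere

/-- The measure `dx dθ` on the phase space `X = Ω × S^{d-1}`. -/
def phaseMeasure {d : ℕ} (Ω : Set (Space d)) : Measure (Space d × Dir d) :=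
  ((volume : Measure (Space d)).restrict Ω).prod (sphereMeasure d)

/-- The scattering operator `(K φ)(x, θ) = ∮ f(θ, θ') φ(x, θ') dθ'`. -/
def scatter {d : ℕ} (f : Dir d → Dir d → ℝ) (φ : Space d → Dir d → ℝ) (x : Space d)
    (θ : Dir d) : ℝ :=
  ∫ θ', f θ θ' * φ x θ' ∂(sphereMeasure d)

/-- The operator `(A φ)(x) = ∮ φ(x, θ) dθ`. -/
def collect {d : ℕ} (φ : Space d → Dir d → ℝ) (x : Space d) : ℝ :=
  ∫ θ, φ x θ ∂(sphereMeasure d)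

/-- The operator `(Ã φ)(x) = S_d⁻¹ ∮ φ(x, θ) dθ`, with `S_d` the area of the unit sphere. -/
def average {d : ℕ} (φ : Space d → Dir d → ℝ) (x : Space d) : ℝ :=
  ((sphereMeasure d).real univ)⁻¹ * ∫ θ, φ x θ ∂(sphereMeasure d)

/-- The `L²`-adjoint `A^*` of `A`: it sends `u(x)` to the function `(x, θ) ↦ u(x)`. -/
def collectAdj {d : ℕ} (u : Space d → ℝ) (x : Space d) (_θ : Dir d) : ℝ := u x

/-- The time after which the ray `t ↦ x - t v` that starts at `x ∈ Ω` leaves `Ω`. -/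
def exitTime {d : ℕ} (Ω : Set (Space d)) (x v : Space d) : ℝ :=
  sSup {t : ℝ | 0 ≤ t ∧ x - t • v ∈ Ω}

/-- The boundary point at which the line through `x ∈ Ω` with direction `v` enters `Ω`. -/
def entryPoint {d : ℕ} (Ω : Set (Space d)) (x v : Space d) : Space d :=
  x - exitTime Ω x v • v

/-- The length of the chord of `Ω` through `x` with direction `v` (for `‖v‖ = 1`). -/
def chordLength {d : ℕ} (Ω : Set (Space d)) (x v : Space d) : ℝ :=
  exitTime Ω x v + exitTime Ω x (-v)

/-- The measure `|θ · ν(y)| dS(y) dθ` on the inflow boundary `Γ_-` of a bounded convex open set.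
For fixed `θ` the points of `Ω` are `x = y + t θ` with `(y, θ) ∈ Γ_-` and `0 < t < ℓ(y, θ)`, `ℓ` the
length of the chord, and `dx = |θ · ν(y)| dS(y) dt`. Hence the measure is the image of
`ℓ(x, θ)⁻¹ dx dθ` under the map that sends `(x, θ)` to its inflow boundary point. -/
def inflowMeasure {d : ℕ} (Ω : Set (Space d)) : Measure (Space d × Dir d) :=
  ((phaseMeasure Ω).withDensity
      (fun p => ENNReal.ofReal (chordLength Ω p.1 (p.2 : Space d))⁻¹)).map
    (fun p => (entryPoint Ω p.1 (p.2 : Space d), p.2))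

/-- `dir θ · ∇φ = g` in `X`, and `φ = b` on the part of the boundary through which the lines with
direction `dir θ` enter `Ω`. The derivative is taken along the lines: for almost every phase point
`φ` is the boundary value at the entry point plus the integral of `g` along the line from there.
With `dir θ = θ` the entry points form `Γ_-`, with `dir θ = -θ` they form `Γ_+`. -/
def HasStreaming {d : ℕ} (Ω : Set (Space d)) (dir : Dir d → Space d)
    (φ g b : Space d → Dir d → ℝ) : Prop :=
  ∀ᵐ p ∂(phaseMeasure Ω),
    IntegrableOn (fun r : ℝ => g (p.1 - r • dir p.2) p.2) (Ioo 0 (exitTime Ω p.1 (dir p.2))) ∧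
    φ p.1 p.2 = b (entryPoint Ω p.1 (dir p.2)) p.2 +
      ∫ r in Ioo 0 (exitTime Ω p.1 (dir p.2)), g (p.1 - r • dir p.2) p.2

/-- `φ ∈ L²(X)` solves `(dir θ · ∇ + μa + μs - μs K) φ = q` in `X` with `φ = b` on the boundary
points at which the lines with direction `dir θ` enter `Ω`. -/
def SolvesRTE {d : ℕ} (Ω : Set (Space d)) (f : Dir d → Dir d → ℝ) (dir : Dir d → Space d)
    (μa μs : Space d → ℝ) (q b φ : Space d → Dir d → ℝ) : Prop :=
  MemLp (fun p : Space d × Dir d => φ p.1 p.2) 2 (phaseMeasure Ω) ∧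
  HasStreaming Ω dir φ
    (fun x θ => q x θ - (μa x + μs x) * φ x θ + μs x * scatter f φ x θ) b

/-- The direction of forward transport, `θ · ∇`, with inflow boundary `Γ_-`. -/
def forwardDir {d : ℕ} (θ : Dir d) : Space d := θ

/-- The direction of backward transport, `-θ · ∇`; the lines enter through `Γ_+`. -/
def backwardDir {d : ℕ} (θ : Dir d) : Space d := -(θ : Space d)

/-- The solution of the forward radiative transfer equation (it is unique up to null sets). -/
def rteSolution {d : ℕ} (Ω : Set (Space d)) (f : Dir d → Dir d → ℝ)
    (μa μs : Space d → ℝ) (q b : Space d → Dir d → ℝ) : Space d → Dir d → ℝ :=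
  open Classical in
  if hex : ∃ φ, SolvesRTE Ω f forwardDir μa μs q b φ then hex.choose else 0

/-- The coefficient class `D(Ω)`: measurable functions with `c₁ ≤ u ≤ c₂` a.e. on `Ω`. -/
def InRange {d : ℕ} (Ω : Set (Space d)) (c₁ c₂ : ℝ) (u : Space d → ℝ) : Prop :=
  AEMeasurable u (volume.restrict Ω) ∧ ∀ᵐ x ∂(volume.restrict Ω), c₁ ≤ u x ∧ u x ≤ c₂

/-- `v` is a feasible direction at `u` in the class of functions with values in `[c₁, c₂]`. -/
def FeasibleDir {d : ℕ} (Ω : Set (Space d)) (c₁ c₂ : ℝ) (u v : Space d → ℝ) : Prop :=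
  ∃ δ > 0, ∀ s : ℝ, 0 < s → s < δ → InRange Ω c₁ c₂ (fun x => u x + s * v x)

/-- The known data of the experiment: the domain, the scattering kernel, the optical coefficients
other than the fluorophore absorption `μ_{a,xf}` and the quantum efficiency `η`, and the boundary
source. -/
structure Setup (d : ℕ) where
  /-- the domain -/
  Ω : Set (Space d)
  /-- the scattering kernel `f(θ, θ')` -/
  f : Dir d → Dir d → ℝ
  /-- the intrinsic absorption coefficient `μ_{a,xi}` -/
  μaxi : Space d → ℝ
  /-- the scattering coefficient `μ_{s,x}` at the excitation state -/
  μsx : Space d → ℝ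
  /-- the absorption coefficient `μ_{a,m}` at the emission state -/
  μam : Space d → ℝ
  /-- the scattering coefficient `μ_{s,m}` at the emission state -/
  μsm : Space d → ℝ
  /-- the boundary source `q_b` -/
  qb : Space d → Dir d → ℝ

/-- The standing assumptions on the data. -/
structure Setup.Admissible {d : ℕ} (P : Setup d) (c₁ c₂ : ℝ) : Prop where
  isOpen : IsOpen P.Ω
  convex : Convex ℝ P.Ω
  bounded : Bornology.IsBounded P.Ω
  nonempty : P.Ω.Nonempty
  f_measurable : Measurable (fun p : Dir d × Dir d => P.f p.1 p.2)
  f_nonneg : ∀ θ θ', 0 ≤ P.f θ θ'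
  f_symm : ∀ θ θ', P.f θ θ' = P.f θ' θ
  f_integral : ∀ θ, ∫ θ', P.f θ θ' ∂(sphereMeasure d) = 1
  μaxi_mem : InRange P.Ω c₁ c₂ P.μaxi
  μsx_mem : InRange P.Ω c₁ c₂ P.μsx
  μam_mem : InRange P.Ω c₁ c₂ P.μam
  μsm_mem : InRange P.Ω c₁ c₂ P.μsm
  qb_memLp : MemLp (fun p : Space d × Dir d => P.qb p.1 p.2) 2 (inflowMeasure P.Ω)
  qb_pos : ∀ᵐ p ∂(inflowMeasure P.Ω), 0 < P.qb p.1 p.2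

/-- The excitation density `φ_x`, for the fluorophore absorption `μ = μ_{a,xf}`. -/
def Setup.phiX {d : ℕ} (P : Setup d) (μ : Space d → ℝ) : Space d → Dir d → ℝ :=
  rteSolution P.Ω P.f (fun x => P.μaxi x + μ x) P.μsx (fun _ _ => 0) P.qb

/-- The emission density `φ_m`, for `μ = μ_{a,xf}` and the quantum efficiency `η`. -/
def Setup.phiM {d : ℕ} (P : Setup d) (μ η : Space d → ℝ) : Space d → Dir d → ℝ :=
  rteSolution P.Ω P.f P.μam P.μsm (fun x _ => η x * μ x * average (P.phiX μ) x) (fun _ _ => 0)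

/-- The absorbed energy `h = H(μ_{a,xf}, η)`. -/
def Setup.H {d : ℕ} (P : Setup d) (μ η : Space d → ℝ) (x : Space d) : ℝ :=
  (P.μaxi x + (1 - η x) * μ x) * collect (P.phiX μ) x + P.μam x * collect (P.phiM μ η) x

/-- The log-residual `log h - log h^*`. -/
def Setup.residual {d : ℕ} (P : Setup d) (hstar μ η : Space d → ℝ) (x : Space d) : ℝ :=
  Real.log (P.H μ η x) - Real.log (hstar x)

/-- The log-type misfit `F(μ_{a,xf}, η) = ½ ‖log H(μ_{a,xf}, η) - log h^*‖²` in `L²(Ω)`. -/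
def Setup.misfit {d : ℕ} (P : Setup d) (hstar μ η : Space d → ℝ) : ℝ :=
  1 / 2 * ∫ x in P.Ω, (P.residual hstar μ η x) ^ 2

/-- `φ_m^*` solves the adjoint emission equation
`(-θ · ∇ + μ_{a,m} + μ_{s,m} - μ_{s,m} K) φ_m^* = A^* (h⁻¹ (log h - log h^*) μ_{a,m})`,
with `φ_m^* = 0` on `Γ_+`. -/
def Setup.IsAdjointM {d : ℕ} (P : Setup d) (hstar μ η : Space d → ℝ)
    (φms : Space d → Dir d → ℝ) : Prop :=
  SolvesRTE P.Ω P.f backwardDir P.μam P.μsm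
    (collectAdj fun x => 1 / P.H μ η x * P.residual hstar μ η x * P.μam x)
    (fun _ _ => 0) φms

/-- `φ_x^*` solves the adjoint excitation equation
`(-θ · ∇ + μ_{a,xi} + μ_{a,xf} + μ_{s,x} - μ_{s,x} K) φ_x^*
  = A^* (η μ_{a,xf} Ã φ_m^* + h⁻¹ (log h - log h^*) (μ_{a,xi} + (1 - η) μ_{a,xf}))`,
with `φ_x^* = 0` on `Γ_+`. -/
def Setup.IsAdjointX {d : ℕ} (P : Setup d) (hstar μ η : Space d → ℝ)
    (φms φxs : Space d → Dir d → ℝ) : Prop :=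
  SolvesRTE P.Ω P.f backwardDir (fun x => P.μaxi x + μ x) P.μsx
    (collectAdj fun x => η x * μ x * average φms x +
      1 / P.H μ η x * P.residual hstar μ η x * (P.μaxi x + (1 - η x) * μ x))
    (fun _ _ => 0) φxs

/-- The component of the gradient of the misfit with respect to `μ_{a,xf}`. -/
def Setup.gradMu {d : ℕ} (P : Setup d) (hstar μ η : Space d → ℝ)
    (φms φxs : Space d → Dir d → ℝ) (x : Space d) : ℝ :=
  1 / P.H μ η x * P.residual hstar μ η x * (1 - η x) * collect (P.phiX μ) x
    + collect φms x * average (P.phiX μ) x * η x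
    - collect (fun y θ => φxs y θ * P.phiX μ y θ) x

/-- The component of the gradient of the misfit with respect to `η`. -/
def Setup.gradEta {d : ℕ} (P : Setup d) (hstar μ η : Space d → ℝ)
    (φms : Space d → Dir d → ℝ) (x : Space d) : ℝ :=
  -(1 / P.H μ η x * P.residual hstar μ η x * μ x * collect (P.phiX μ) x)
    + collect φms x * average (P.phiX μ) x * μ x

end FPAT

end

noncomputable section

namespace FPAT

open scoped ENNReal

variable {d : ℕ} {Ω : Set (Space d)}

/-! The obstacle is the logarithm: `h` has no positive lower bound, only `1 / h ∈ L²`. Let `h` be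
the reference energy and `H_s` the energy after a step `s`. Linear perturbation theory gives `H_s -
h = O(s)` in `L²`, which controls `log H_s - log h` from above but not from below.

The lower bound comes from Cauchy-Schwarz. Solutions with nonnegative data arise from these data by
sums and integrals with nonnegative kernels, so a pointwise inequality `u² ≤ u' u''` between data
passes to the solutions and to the energies (`TransportData.sq_sol_le`, `SolvesRTE.sq_le_mul`,
`Setup.Regular.sq_output_le`). If the direction is feasible up to a step `δ` and `ε = s / δ`, then
`μ`, `η`, `1 - η` and the in-scattering coefficient at step `s` are each at least `1 - ε` times
their reference values. Enlarging the reference weights by powers of `(1 - ε)⁻¹` gives a comparison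
model with energy `Ψ`, where `h² ≤ H_s Ψ` and `Ψ - h = O(s)` in `L²`. This is
`Setup.Admissible.exists_comparison`: `|H_s - h| ≤ s G_s` and `h² ≤ H_s (h + s G_s)` with `G_s`
bounded in `L²`.

Put `m = s G_s / h`, which is `O(s)` in `L¹`. Both `H_s / h` and its inverse are at most `1 + m`, so
the error in linearizing the logarithm is at most `2 m min(1, m)`. After division by `s`, the
remainder of the misfit is bounded by the integral of `w min(1, m) G_s` with a fixed `w ∈ L²`, and
it tends to zero (`sq_log_div_le`, `tendsto_log_misfit`).

There remains the linear functional `∫ ρ (H_s - h) / s` with `ρ = (log h - log h*) / h`. The adjoint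
densities at the reference coefficients turn it, exactly, into an integral of the perturbed
excitation density against a fixed function, plus `s` times another such integral
(`Setup.Admissible.integral_mul_quotient`). Since the perturbed density converges in `L²(X)`, the
limit is the asserted gradient pairing.

The transport theory rests on a constant attenuation `M` that dominates the total coefficient. The
remaining gain is then a nonnegative operator of `L²` norm at most `M - c`, and attenuated
integration along lines has norm at most `1 / M`, so the collision iterates increase to a solution
in `L²`. Translation invariance makes integration along `v` adjoint to integration along `-v`. This
yields duality, and uniqueness by testing with a backward solution. -/

instance : IsFiniteMeasure (sphereMeasure d) := by
  unfold sphereMeasure; infer_instance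

/-! ### Lines in a bounded convex open set -/

/-- A bounded convex open set. -/
structure ConvexDomain (Ω : Set (Space d)) : Prop where
  isOpen : IsOpen Ω
  convex : Convex ℝ Ω
  bounded : Bornology.IsBounded Ω

theorem ConvexDomain.sub_smul_mem (hΩ : ConvexDomain Ω) {x w : Space d} {r s : ℝ} (hx : x ∈ Ω)
    (hs : x - s • w ∈ Ω) (hr : 0 ≤ r) (hrs : r ≤ s) : x - r • w ∈ Ω := by
  rcases eq_or_lt_of_le (hr.trans hrs) with h0 | h0
  · have : r = 0 := le_antisymm (h0 ▸ hrs) hr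
    simpa [this] using hx
  · have h := hΩ.convex hx hs (a := 1 - r / s) (b := r / s)
      (by rw [sub_nonneg]; exact (div_le_one h0).2 hrs) (by positivity) (by ring)
    convert h using 1
    rw [smul_sub, smul_smul, div_mul_cancel₀ _ h0.ne', sub_smul, one_smul]
    abel

theorem ConvexDomain.le_diam (hΩ : ConvexDomain Ω) {x w : Space d} {r : ℝ} (hx : x ∈ Ω)
    (hw : ‖w‖ = 1) (hr : 0 ≤ r) (h : x - r • w ∈ Ω) : r ≤ Metric.diam Ω := by
  have := Metric.dist_le_diam_of_mem hΩ.bounded hx h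
  rwa [dist_eq_norm, sub_sub_cancel, norm_smul, hw, mul_one, Real.norm_of_nonneg hr] at this

theorem ConvexDomain.exitTime_bddAbove (hΩ : ConvexDomain Ω) (x : Space d) {w : Space d}
    (hw : ‖w‖ = 1) : BddAbove {t : ℝ | 0 ≤ t ∧ x - t • w ∈ Ω} := by
  obtain ⟨C, hC⟩ := hΩ.bounded.exists_norm_le
  refine ⟨‖x‖ + C, fun t ht => ?_⟩
  have h1 := hC _ ht.2
  have h2 : ‖t • w‖ ≤ ‖x‖ + ‖x - t • w‖ := by
    have := norm_sub_le x (x - t • w)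
    rwa [sub_sub_cancel] at this
  rw [norm_smul, hw, mul_one, Real.norm_of_nonneg ht.1] at h2
  linarith

/-- Convexity excludes gaps before the exit and openness excludes the exit time itself. Integrals up
to the exit time thus become integrals over a half line against the indicator of `Ω`, the form to
which Fubini and translation invariance apply. -/
theorem ConvexDomain.Ioo_exitTime (hΩ : ConvexDomain Ω) {x w : Space d} (hx : x ∈ Ω)
    (hw : ‖w‖ = 1) : Ioo 0 (exitTime Ω x w) = {r | 0 < r ∧ x - r • w ∈ Ω} := by
  have hne : {t : ℝ | 0 ≤ t ∧ x - t • w ∈ Ω}.Nonempty := ⟨0, le_rfl, by simpa using hx⟩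
  ext r
  simp only [mem_Ioo, mem_ofPred_eq]
  refine and_congr_right fun hr => ⟨fun h => ?_, fun h => ?_⟩
  · obtain ⟨t, ht, hrt⟩ := exists_lt_of_lt_csSup hne h
    exact hΩ.sub_smul_mem hx ht.2 hr.le hrt.le
  · have hc : Continuous fun t : ℝ => x - t • w := by fun_prop
    have : ∀ᶠ t in 𝓝 r, x - t • w ∈ Ω := hc.continuousAt.eventually (hΩ.isOpen.mem_nhds h)
    obtain ⟨ε, hε, hball⟩ := Metric.eventually_nhds_iff.1 this
    have hmem : x - (r + ε / 2) • w ∈ Ω := hball (by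
      rw [Real.dist_eq, add_sub_cancel_left, abs_of_pos (by positivity)]; linarith)
    have := le_csSup (hΩ.exitTime_bddAbove x hw) (show r + ε / 2 ∈ _ from ⟨by positivity, hmem⟩)
    unfold exitTime
    linarith

theorem exitTime_nonneg (x w : Space d) : 0 ≤ exitTime Ω x w :=
  Real.sSup_nonneg fun _ h => h.1

theorem ConvexDomain.exitTime_pos (hΩ : ConvexDomain Ω) {x w : Space d} (hx : x ∈ Ω)
    (hw : ‖w‖ = 1) : 0 < exitTime Ω x w := by
  have hc : Continuous fun t : ℝ => x - t • w := by fun_prop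
  have : ∀ᶠ t in 𝓝 (0 : ℝ), x - t • w ∈ Ω :=
    hc.continuousAt.eventually (hΩ.isOpen.mem_nhds (by simpa using hx))
  obtain ⟨ε, hε, hball⟩ := Metric.eventually_nhds_iff.1 this
  have hmem : x - (ε / 2) • w ∈ Ω := hball (by
    rw [Real.dist_eq, sub_zero, abs_of_pos (by positivity)]; linarith)
  have : ε / 2 ∈ Ioo 0 (exitTime Ω x w) := by
    rw [hΩ.Ioo_exitTime hx hw]; exact ⟨by positivity, hmem⟩
  exact this.1.trans this.2

theorem ConvexDomain.exitTime_le_diam (hΩ : ConvexDomain Ω) {x w : Space d} (hx : x ∈ Ω)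
    (hw : ‖w‖ = 1) : exitTime Ω x w ≤ Metric.diam Ω :=
  csSup_le ⟨0, le_rfl, by simpa using hx⟩ fun _ ht => hΩ.le_diam hx hw ht.1 ht.2

theorem ConvexDomain.exitTime_sub (hΩ : ConvexDomain Ω) {x w : Space d} {r : ℝ} (hx : x ∈ Ω)
    (hw : ‖w‖ = 1) (hr : 0 < r) (hxr : x - r • w ∈ Ω) :
    exitTime Ω (x - r • w) w = exitTime Ω x w - r := by
  have key : Ioo 0 (exitTime Ω (x - r • w) w) = Ioo 0 (exitTime Ω x w - r) := by
    rw [hΩ.Ioo_exitTime hxr hw]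
    ext t
    have h := Set.ext_iff.1 (hΩ.Ioo_exitTime hx hw) (r + t)
    simp only [mem_Ioo, mem_ofPred_eq] at h ⊢
    refine and_congr_right fun ht => ?_
    have h' : r + t < exitTime Ω x w ↔ x - (r + t) • w ∈ Ω := by
      have : 0 < r + t := by positivity
      tauto
    rw [sub_sub, ← add_smul, ← h']
    constructor <;> intro <;> linarith
  have h1 := hΩ.exitTime_pos hxr hw
  have h2 : r ∈ Ioo 0 (exitTime Ω x w) := by rw [hΩ.Ioo_exitTime hx hw]; exact ⟨hr, hxr⟩
  have h3 : 0 < exitTime Ω x w - r := sub_pos.2 h2.2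
  have := congrArg sSup key
  rwa [csSup_Ioo h1, csSup_Ioo h3] at this

/-- Transported boundary data are therefore constant along each line, which is what
`raySum_boundary` needs. -/
theorem ConvexDomain.entryPoint_sub (hΩ : ConvexDomain Ω) {x w : Space d} {r : ℝ} (hx : x ∈ Ω)
    (hw : ‖w‖ = 1) (hr : 0 < r) (hxr : x - r • w ∈ Ω) :
    entryPoint Ω (x - r • w) w = entryPoint Ω x w := by
  rw [entryPoint, hΩ.exitTime_sub hx hw hr hxr, entryPoint, sub_sub, ← add_smul]
  congr 2; ring

/-- A continuous choice of a unit vector for every direction. -/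
structure UnitField (v : Dir d → Space d) : Prop where
  continuous : Continuous v
  norm_eq : ∀ θ, ‖v θ‖ = 1

theorem UnitField.neg {v : Dir d → Space d} (hv : UnitField v) : UnitField fun θ => -v θ :=
  ⟨hv.continuous.neg, fun θ => by rw [norm_neg, hv.norm_eq]⟩

theorem unitField_forwardDir : UnitField (forwardDir : Dir d → Space d) :=
  ⟨continuous_subtype_val, fun θ => by simp [forwardDir]⟩

/-- The exit time is lower semicontinuous: its superlevel sets at levels `a ≥ 0` are unions over `t
> a` of open sets. This also holds at base points outside `Ω`, where the supremum may be over the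
empty set and is then zero. -/
theorem ConvexDomain.measurable_exitTime (hΩ : ConvexDomain Ω) {v : Dir d → Space d}
    (hv : UnitField v) : Measurable fun p : Space d × Dir d => exitTime Ω p.1 (v p.2) := by
  refine measurable_of_Ioi fun a => ?_
  rcases lt_or_ge a 0 with ha | ha
  · convert MeasurableSet.univ
    ext p
    simpa using ha.trans_le (exitTime_nonneg _ _)
  · have : (fun p : Space d × Dir d => exitTime Ω p.1 (v p.2)) ⁻¹' Ioi a
        = ⋃ t ∈ Ioi a, {p : Space d × Dir d | p.1 - t • v p.2 ∈ Ω} := by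
      ext p
      simp only [mem_preimage, mem_Ioi, mem_iUnion, mem_ofPred_eq, exists_prop]
      constructor
      · intro h
        have hne : {t : ℝ | 0 ≤ t ∧ p.1 - t • v p.2 ∈ Ω}.Nonempty := by
          by_contra hne
          rw [not_nonempty_iff_eq_empty] at hne
          rw [exitTime, hne, Real.sSup_empty] at h
          linarith
        obtain ⟨t, ht, hat⟩ := exists_lt_of_lt_csSup hne h
        exact ⟨t, hat, ht.2⟩
      · rintro ⟨t, hat, ht⟩
        have hc : Continuous fun t : ℝ => p.1 - t • v p.2 := by fun_prop
        have : ∀ᶠ t in 𝓝 t, p.1 - t • v p.2 ∈ Ω :=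
          hc.continuousAt.eventually (hΩ.isOpen.mem_nhds ht)
        exact hat.trans_le (le_csSup (hΩ.exitTime_bddAbove p.1 (hv.norm_eq p.2))
          ⟨ha.trans hat.le, ht⟩)
    rw [this]
    refine IsOpen.measurableSet (isOpen_biUnion fun t _ => ?_)
    have hvc := hv.continuous
    exact hΩ.isOpen.preimage (by fun_prop)

theorem ConvexDomain.measurable_entryPoint (hΩ : ConvexDomain Ω) {v : Dir d → Space d}
    (hv : UnitField v) :
    Measurable fun p : Space d × Dir d => (entryPoint Ω p.1 (v p.2), p.2) := by
  have h1 := hΩ.measurable_exitTime hv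
  have h2 : Measurable fun p : Space d × Dir d => v p.2 := hv.continuous.measurable.comp measurable_snd
  exact (measurable_fst.sub (h1.smul h2)).prodMk measurable_snd

end FPAT
end

noncomputable section

namespace FPAT

open scoped ENNReal

variable {d : ℕ} {Ω : Set (Space d)} {v : Dir d → Space d}

/-! ### Cauchy-Schwarz for lower Lebesgue integrals -/

/-- Cauchy-Schwarz in a form that can be iterated: hypothesis and conclusion have the same shape `a²
≤ b c`, so the inequality passes through any composition of integrations with nonnegative kernels.
It serves both for norm bounds and for comparing solutions. -/
theorem sq_lintegral_le {α : Type*} [MeasurableSpace α] {ν : Measure α} {a b c : α → ℝ≥0∞}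
    (hb : AEMeasurable b ν) (hc : AEMeasurable c ν) (h : ∀ᵐ x ∂ν, a x ^ 2 ≤ b x * c x) :
    (∫⁻ x, a x ∂ν) ^ 2 ≤ (∫⁻ x, b x ∂ν) * ∫⁻ x, c x ∂ν := by
  have hle : ∫⁻ x, a x ∂ν ≤ ∫⁻ x, ((fun x => b x ^ (1 / 2 : ℝ)) * fun x => c x ^ (1 / 2 : ℝ)) x ∂ν := by
    refine lintegral_mono_ae (h.mono fun x hx => ?_)
    rw [Pi.mul_apply, ← ENNReal.mul_rpow_of_nonneg _ _ (by norm_num)]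
    have := ENNReal.rpow_le_rpow hx (z := 1 / 2) (by norm_num)
    rwa [← ENNReal.rpow_natCast, ← ENNReal.rpow_mul, Nat.cast_two, mul_one_div_cancel two_ne_zero,
      ENNReal.rpow_one] at this
  have h2 := hle.trans (ENNReal.lintegral_mul_le_Lp_mul_Lq ν Real.HolderConjugate.two_two
    (hb.pow_const _) (hc.pow_const _))
  have h3 : ∀ t : ℝ≥0∞, (t ^ (1 / 2 : ℝ)) ^ (2 : ℝ) = t := fun t => by
    rw [← ENNReal.rpow_mul]; norm_num
  simp only [h3] at h2
  calc (∫⁻ x, a x ∂ν) ^ 2 ≤ _ := pow_le_pow_left' h2 2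
    _ = _ := by
      rw [mul_pow]
      congr 1 <;> (rw [← ENNReal.rpow_natCast]; exact_mod_cast h3 _)

theorem sq_add_le_ennreal {a b c a' b' c' : ℝ≥0∞} (h : a ^ 2 ≤ b * c) (h' : a' ^ 2 ≤ b' * c') :
    (a + a') ^ 2 ≤ (b + b') * (c + c') := by
  -- A sum of two terms is an integral for the counting measure on two points.
  have := sq_lintegral_le (ν := Measure.count) (a := fun i : Bool => if i then a else a')
    (b := fun i => if i then b else b') (c := fun i => if i then c else c')
    (measurable_of_finite _).aemeasurable (measurable_of_finite _).aemeasurable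
    (ae_of_all _ (by rintro (_ | _) <;> simpa))
  simpa [lintegral_count, tsum_bool, add_comm] using this

theorem eLpNorm_two_sq {α ε : Type*} [MeasurableSpace α] [ENorm ε] {ν : Measure α} (u : α → ε) :
    eLpNorm u 2 ν ^ 2 = ∫⁻ x, ‖u x‖ₑ ^ 2 ∂ν := by
  have := eLpNorm_nnreal_pow_eq_lintegral (μ := ν) (f := u) (p := 2) two_ne_zero
  simpa only [NNReal.coe_ofNat, ENNReal.rpow_ofNat, ENNReal.coe_ofNat] using this

/-! ### The phase space measure and translations along directions -/

/-- The measure `dx dθ` on all of `ℝ^d × S^{d-1}`. -/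
def fullMeasure (d : ℕ) : Measure (Space d × Dir d) :=
  (volume : Measure (Space d)).prod (sphereMeasure d)

instance : SFinite (fullMeasure d) := by unfold fullMeasure; infer_instance

theorem phaseMeasure_eq (Ω : Set (Space d)) :
    phaseMeasure Ω = (fullMeasure d).restrict (Ω ×ˢ univ) := by
  rw [phaseMeasure, fullMeasure, ← Measure.prod_restrict, Measure.restrict_univ]

theorem ConvexDomain.measurableSet_prod (hΩ : ConvexDomain Ω) :
    MeasurableSet (Ω ×ˢ (univ : Set (Dir d))) :=
  hΩ.isOpen.measurableSet.prod MeasurableSet.univ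

theorem ConvexDomain.ae_mem (hΩ : ConvexDomain Ω) : ∀ᵐ p ∂(phaseMeasure Ω), p.1 ∈ Ω := by
  rw [phaseMeasure_eq]
  exact (ae_restrict_mem hΩ.measurableSet_prod).mono fun p hp => hp.1

theorem ConvexDomain.ae_iff (hΩ : ConvexDomain Ω) {P : Space d × Dir d → Prop} :
    (∀ᵐ p ∂(phaseMeasure Ω), P p) ↔ ∀ᵐ p ∂(fullMeasure d), p.1 ∈ Ω → P p := by
  rw [phaseMeasure_eq, ae_restrict_iff' hΩ.measurableSet_prod]
  simp

theorem ae_phase_of_ae {P : Space d → Prop} (h : ∀ᵐ x ∂(volume.restrict Ω), P x) :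
    ∀ᵐ p ∂(phaseMeasure Ω), P p.1 :=
  Measure.quasiMeasurePreserving_fst.ae h

/-- The translation `((x, θ), r) ↦ ((x - r v(θ), θ), r)`. -/
def shear (v : Dir d → Space d) (z : (Space d × Dir d) × ℝ) : (Space d × Dir d) × ℝ :=
  ((z.1.1 - z.2 • v z.1.2, z.1.2), z.2)

theorem UnitField.measurable_shear (hv : UnitField v) : Measurable (shear v) := by
  have h2 := hv.continuous.measurable
  unfold shear
  fun_prop

/-- For fixed `r` and `θ` the map is a translation in `x`, which preserves Lebesgue measure. -/
theorem UnitField.lintegral_shear (hv : UnitField v) (ρ : Measure ℝ) [SFinite ρ]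
    {F : (Space d × Dir d) × ℝ → ℝ≥0∞} (hF : Measurable F) :
    ∫⁻ z, F (shear v z) ∂((fullMeasure d).prod ρ) = ∫⁻ z, F z ∂((fullMeasure d).prod ρ) := by
  have hF' := hF.comp hv.measurable_shear
  have expand : ∀ G : (Space d × Dir d) × ℝ → ℝ≥0∞, Measurable G →
      ∫⁻ z, G z ∂((fullMeasure d).prod ρ)
        = ∫⁻ r, ∫⁻ θ, ∫⁻ x, G ((x, θ), r) ∂volume ∂sphereMeasure d ∂ρ := by
    intro G hG
    rw [lintegral_prod_symm' _ hG]
    refine lintegral_congr fun r => ?_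
    rw [fullMeasure, lintegral_prod_symm' (fun y => G (y, r)) (hG.comp (by fun_prop))]
  rw [expand _ hF, expand (fun z => F (shear v z)) hF']
  refine lintegral_congr fun r => lintegral_congr fun θ => ?_
  exact lintegral_sub_right_eq_self (fun x => F ((x, θ), r)) (r • v θ)

theorem UnitField.measurePreserving_shear (hv : UnitField v) (ρ : Measure ℝ) [SFinite ρ] :
    MeasurePreserving (shear v) ((fullMeasure d).prod ρ) ((fullMeasure d).prod ρ) := by
  refine ⟨hv.measurable_shear, Measure.ext fun s hs => ?_⟩
  rw [Measure.map_apply hv.measurable_shear hs, ← lintegral_indicator_one hs,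
    ← lintegral_indicator_one (hv.measurable_shear hs)]
  exact hv.lintegral_shear ρ (measurable_one.indicator hs)

/-- A property that holds almost everywhere in phase space holds almost everywhere along almost
every line. -/
theorem ConvexDomain.ae_ae_line (hΩ : ConvexDomain Ω) (hv : UnitField v)
    {P : Space d × Dir d → Prop} (h : ∀ᵐ p ∂(phaseMeasure Ω), P p) (ρ : Measure ℝ) [SFinite ρ] :
    ∀ᵐ p ∂(phaseMeasure Ω), ∀ᵐ r ∂ρ, p.1 - r • v p.2 ∈ Ω → P (p.1 - r • v p.2, p.2) := by
  rw [hΩ.ae_iff] at h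
  have h1 : ∀ᵐ z ∂((fullMeasure d).prod ρ), z.1.1 ∈ Ω → P z.1 :=
    Measure.quasiMeasurePreserving_fst.ae h
  have h2 := Measure.ae_ae_of_ae_prod ((hv.measurePreserving_shear ρ).quasiMeasurePreserving.ae h1)
  rw [phaseMeasure_eq]
  exact ae_restrict_of_ae h2

/-! ### Duality of the integration along lines -/

/-- No line stays in `Ω` longer than the diameter, so the variable interval can be replaced by a
fixed one. This puts the integral on a product space. -/
theorem ConvexDomain.setIntegral_line (hΩ : ConvexDomain Ω) (hv : UnitField v)
    {p : Space d × Dir d} (hp : p.1 ∈ Ω) (g : Space d × Dir d → ℝ) {D : ℝ}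
    (hD : Metric.diam Ω < D) :
    ∫ r in Ioo 0 (exitTime Ω p.1 (v p.2)), g (p.1 - r • v p.2, p.2)
      = ∫ r in Ioo 0 D, (Ω ×ˢ univ).indicator g (p.1 - r • v p.2, p.2) := by
  rw [← integral_indicator measurableSet_Ioo, ← integral_indicator measurableSet_Ioo]
  congr 1
  ext r
  rw [hΩ.Ioo_exitTime hp (hv.norm_eq p.2)]
  by_cases h : p.1 - r • v p.2 ∈ Ω
  · by_cases hr : 0 < r
    · have := (hΩ.le_diam hp (hv.norm_eq p.2) hr.le h).trans_lt hD
      simp [indicator, h, hr, this]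
    · simp [indicator, hr]
  · simp [indicator, h]

theorem ConvexDomain.integrable_shear_mul (hΩ : ConvexDomain Ω) (hv : UnitField v)
    {g h : Space d × Dir d → ℝ} (hg : MemLp g 2 (phaseMeasure Ω))
    (hh : MemLp h 2 (phaseMeasure Ω)) (D : ℝ) :
    Integrable (fun z => (Ω ×ˢ univ).indicator g (shear v z).1 * (Ω ×ˢ univ).indicator h z.1)
      ((fullMeasure d).prod (volume.restrict (Ioo 0 D))) := by
  have ext : ∀ u : Space d × Dir d → ℝ, MemLp u 2 (phaseMeasure Ω) →
      MemLp ((Ω ×ˢ univ).indicator u) 2 (fullMeasure d) := fun u hu => by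
    rwa [memLp_indicator_iff_restrict hΩ.measurableSet_prod, ← phaseMeasure_eq]
  set ρ : Measure ℝ := volume.restrict (Ioo 0 D)
  have hg1 := ext g hg
  have hh1 := ext h hh
  have mp := hv.measurePreserving_shear ρ
  have sq : ∀ u : Space d × Dir d → ℝ, MemLp u 2 (fullMeasure d) →
      Integrable (fun z => u z.1 ^ 2) ((fullMeasure d).prod ρ) := fun u hu => by
    simpa using hu.integrable_sq.mul_prod (integrable_const (1 : ℝ) (μ := ρ))
  have i1 : Integrable (fun z => (Ω ×ˢ univ).indicator g (shear v z).1 ^ 2)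
      ((fullMeasure d).prod ρ) := mp.integrable_comp_of_integrable (sq _ hg1)
  have i2 := sq _ hh1
  refine Integrable.mono' (i1.add i2) ?_ (ae_of_all _ fun z => ?_)
  · exact ((hg1.1.comp_quasiMeasurePreserving
      Measure.quasiMeasurePreserving_fst).comp_quasiMeasurePreserving
      mp.quasiMeasurePreserving).mul
      (hh1.1.comp_quasiMeasurePreserving Measure.quasiMeasurePreserving_fst)
  · rw [Real.norm_eq_abs, abs_mul, Pi.add_apply]
    set a := (Ω ×ˢ univ).indicator g (shear v z).1
    set b := (Ω ×ˢ univ).indicator h z.1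
    nlinarith [sq_nonneg (|a| - |b|), sq_abs a, sq_abs b, abs_nonneg a, abs_nonneg b,
      mul_nonneg (abs_nonneg a) (abs_nonneg b)]

/-- Both sides are the integral over all `(x, θ, r)` of `g(x - r v) h(x)`, each factor cut off
outside `Ω`, before and after the substitution `x ↦ x + r v`. The adjoint of integration along `v`
is integration along `-v`. -/
theorem ConvexDomain.integral_line_mul (hΩ : ConvexDomain Ω) (hv : UnitField v)
    {g h : Space d × Dir d → ℝ} (hg : MemLp g 2 (phaseMeasure Ω))
    (hh : MemLp h 2 (phaseMeasure Ω)) :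
    ∫ p, (∫ r in Ioo 0 (exitTime Ω p.1 (v p.2)), g (p.1 - r • v p.2, p.2)) * h p
        ∂(phaseMeasure Ω)
      = ∫ p, g p * (∫ r in Ioo 0 (exitTime Ω p.1 (-v p.2)), h (p.1 - r • (-v p.2), p.2))
        ∂(phaseMeasure Ω) := by
  obtain ⟨D, hD⟩ := exists_gt (Metric.diam Ω)
  have key : ∀ {w : Dir d → Space d}, UnitField w → ∀ {g h : Space d × Dir d → ℝ},
      MemLp g 2 (phaseMeasure Ω) → MemLp h 2 (phaseMeasure Ω) →
      ∫ p, (∫ r in Ioo 0 (exitTime Ω p.1 (w p.2)), g (p.1 - r • w p.2, p.2)) * h p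
        ∂(phaseMeasure Ω)
      = ∫ z, (Ω ×ˢ univ).indicator g (shear w z).1 * (Ω ×ˢ univ).indicator h z.1
        ∂((fullMeasure d).prod (volume.restrict (Ioo 0 D))) := by
    intro w hw g h hg hh
    rw [integral_prod _ (hΩ.integrable_shear_mul hw hg hh D), phaseMeasure_eq,
      ← integral_indicator hΩ.measurableSet_prod]
    refine integral_congr_ae (ae_of_all _ fun p => ?_)
    by_cases hp : p.1 ∈ Ω
    · have hp' : p ∈ Ω ×ˢ (univ : Set (Dir d)) := ⟨hp, trivial⟩
      simp only [indicator_of_mem hp']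
      rw [hΩ.setIntegral_line hw hp g hD, ← integral_mul_const]
      rfl
    · have hp' : p ∉ Ω ×ˢ (univ : Set (Dir d)) := fun h => hp h.1
      simp [indicator_of_notMem hp']
  rw [key hv hg hh]
  have h2 := key hv.neg hh hg
  rw [show (∫ p, g p * (∫ r in Ioo 0 (exitTime Ω p.1 (-v p.2)), h (p.1 - r • (-v p.2), p.2))
      ∂(phaseMeasure Ω)) = _ from (integral_congr_ae (ae_of_all _ fun p => mul_comm _ _)).trans h2]
  have mp := hv.measurePreserving_shear (volume.restrict (Ioo 0 D))
  have e : ∀ z : (Space d × Dir d) × ℝ, shear (fun θ => -v θ) (shear v z) = z := by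
    rintro ⟨⟨x, θ⟩, r⟩
    simp [shear]
  have hm := (hΩ.integrable_shear_mul hv.neg hh hg D).1
  conv_rhs => rw [← mp.map_eq]
  rw [integral_map mp.measurable.aemeasurable (by rw [mp.map_eq]; exact hm)]
  refine integral_congr_ae (ae_of_all _ fun z => ?_)
  simp only [e]
  exact mul_comm _ _

end FPAT
end

noncomputable section

namespace FPAT

open scoped ENNReal

variable {d : ℕ} {Ω : Set (Space d)} {v : Dir d → Space d}

/-! ### Attenuated integration along lines, with values in `[0, ∞]` -/

/-- The integral of `g` along the part in `Ω` of the half line `x - r v(θ)`, `r > 0`, with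
attenuation `exp (-M r)`. -/
def raySum (Ω : Set (Space d)) (v : Dir d → Space d) (M : ℝ) (g : Space d × Dir d → ℝ≥0∞)
    (p : Space d × Dir d) : ℝ≥0∞ :=
  ∫⁻ r in Ioi (0 : ℝ), ENNReal.ofReal (Real.exp (-(M * r))) *
    (Ω ×ˢ univ).indicator g (p.1 - r • v p.2, p.2)

theorem ConvexDomain.measurable_raySum_integrand (hΩ : ConvexDomain Ω) (hv : UnitField v) (M : ℝ)
    {g : Space d × Dir d → ℝ≥0∞} (hg : Measurable g) :
    Measurable fun z : (Space d × Dir d) × ℝ => ENNReal.ofReal (Real.exp (-(M * z.2))) *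
      (Ω ×ˢ univ).indicator g (z.1.1 - z.2 • v z.1.2, z.1.2) := by
  have h1 : Measurable fun z : (Space d × Dir d) × ℝ =>
      (Ω ×ˢ univ).indicator g (shear v z).1 :=
    (hg.indicator hΩ.measurableSet_prod).comp (measurable_fst.comp hv.measurable_shear)
  refine Measurable.mul (by fun_prop) h1

theorem ConvexDomain.measurable_raySum_line (hΩ : ConvexDomain Ω) (hv : UnitField v) (M : ℝ)
    {g : Space d × Dir d → ℝ≥0∞} (hg : Measurable g) (p : Space d × Dir d) :
    Measurable fun r : ℝ => ENNReal.ofReal (Real.exp (-(M * r))) *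
      (Ω ×ˢ univ).indicator g (p.1 - r • v p.2, p.2) :=
  (hΩ.measurable_raySum_integrand hv M hg).comp measurable_prodMk_left

theorem ConvexDomain.measurable_raySum (hΩ : ConvexDomain Ω) (hv : UnitField v) (M : ℝ)
    {g : Space d × Dir d → ℝ≥0∞} (hg : Measurable g) : Measurable (raySum Ω v M g) :=
  (hΩ.measurable_raySum_integrand hv M hg).lintegral_prod_right'

theorem raySum_mono {M : ℝ} {g g' : Space d × Dir d → ℝ≥0∞} (h : ∀ p, g p ≤ g' p)
    (p : Space d × Dir d) : raySum Ω v M g p ≤ raySum Ω v M g' p :=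
  lintegral_mono fun _ => mul_le_mul_right (indicator_le_indicator (h _)) _

theorem ConvexDomain.raySum_add (hΩ : ConvexDomain Ω) (hv : UnitField v) {M : ℝ}
    {g g' : Space d × Dir d → ℝ≥0∞} (hg : Measurable g) (p : Space d × Dir d) :
    raySum Ω v M (fun p => g p + g' p) p = raySum Ω v M g p + raySum Ω v M g' p := by
  unfold raySum
  rw [← lintegral_add_left (hΩ.measurable_raySum_line hv M hg p)]
  refine lintegral_congr fun r => ?_
  rw [← mul_add]
  congr 1
  by_cases h : (p.1 - r • v p.2, p.2) ∈ Ω ×ˢ (univ : Set (Dir d)) <;> simp [h]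

theorem ConvexDomain.raySum_iSup (hΩ : ConvexDomain Ω) (hv : UnitField v) {M : ℝ}
    {g : ℕ → Space d × Dir d → ℝ≥0∞} (hg : ∀ n, Measurable (g n)) (hm : Monotone g)
    (p : Space d × Dir d) :
    raySum Ω v M (fun p => ⨆ n, g n p) p = ⨆ n, raySum Ω v M (g n) p := by
  unfold raySum
  rw [← lintegral_iSup (fun n => hΩ.measurable_raySum_line hv M (hg n) p)]
  · refine lintegral_congr fun r => ?_
    rw [← ENNReal.mul_iSup]
    congr 1
    by_cases h : (p.1 - r • v p.2, p.2) ∈ Ω ×ˢ (univ : Set (Dir d)) <;> simp [h]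
  · exact fun m n hmn _ => mul_le_mul_right (indicator_le_indicator (hm hmn _)) _

theorem ConvexDomain.raySum_zero_eq (hΩ : ConvexDomain Ω) (hv : UnitField v)
    (g : Space d × Dir d → ℝ≥0∞) {p : Space d × Dir d} (hp : p.1 ∈ Ω) :
    raySum Ω v 0 g p = ∫⁻ r in Ioo 0 (exitTime Ω p.1 (v p.2)), g (p.1 - r • v p.2, p.2) := by
  unfold raySum
  rw [← lintegral_indicator measurableSet_Ioo, ← lintegral_indicator measurableSet_Ioi,
    hΩ.Ioo_exitTime hp (hv.norm_eq p.2)]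
  refine lintegral_congr fun r => ?_
  by_cases h : p.1 - r • v p.2 ∈ Ω <;> by_cases hr : 0 < r <;> simp [indicator, h, hr]

/-- Inside `Ω` the parameter is at most the diameter, so the attenuation is bounded below. This
transfers finiteness of attenuated integrals to plain ones. -/
theorem ConvexDomain.raySum_zero_le (hΩ : ConvexDomain Ω) (hv : UnitField v) {M : ℝ} (hM : 0 < M)
    (g : Space d × Dir d → ℝ≥0∞) {p : Space d × Dir d} (hp : p.1 ∈ Ω) :
    raySum Ω v 0 g p
      ≤ ENNReal.ofReal (Real.exp (M * Metric.diam Ω)) * raySum Ω v M g p := by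
  unfold raySum
  rw [← lintegral_const_mul' _ _ ENNReal.ofReal_ne_top]
  refine setLIntegral_mono' measurableSet_Ioi fun r hr => ?_
  by_cases h : p.1 - r • v p.2 ∈ Ω
  · rw [← mul_assoc, ← ENNReal.ofReal_mul (Real.exp_nonneg _), ← Real.exp_add]
    refine mul_le_mul_left (ENNReal.ofReal_le_ofReal (Real.exp_le_exp.2 ?_)) _
    have := hΩ.le_diam hp (hv.norm_eq p.2) (mem_Ioi.1 hr).le h
    nlinarith
  · simp [indicator, h]

theorem lintegral_exp_neg_mul {M : ℝ} (hM : 0 < M) :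
    ∫⁻ r in Ioi (0 : ℝ), ENNReal.ofReal (Real.exp (-(M * r))) = ENNReal.ofReal M⁻¹ := by
  have hi : IntegrableOn (fun r : ℝ => Real.exp (-M * r)) (Ioi 0) :=
    integrableOn_exp_mul_Ioi (by linarith) 0
  have := ofReal_integral_eq_lintegral_ofReal hi (ae_of_all _ fun r => Real.exp_nonneg _)
  rw [integral_exp_mul_Ioi (by linarith) 0] at this
  simp only [neg_mul, mul_zero, Real.exp_zero] at this
  rw [← this]
  congr 1
  rw [neg_div_neg_eq, one_div]

/-- A particle on a segment of length `u` is either absorbed or survives. Both the boundary identity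
and the resolvent identity below reduce to this one, written without subtraction so that it lives in
`[0, ∞]`. -/
theorem lintegral_exp_Ioo {M u : ℝ} (hM : 0 < M) (hu : 0 < u) :
    ENNReal.ofReal M * (∫⁻ r in Ioo 0 u, ENNReal.ofReal (Real.exp (-(M * (u - r)))))
      + ENNReal.ofReal (Real.exp (-(M * u))) = 1 := by
  have hc : Continuous fun r : ℝ => Real.exp (-(M * (u - r))) := by fun_prop
  have hi : IntegrableOn (fun r : ℝ => Real.exp (-(M * (u - r)))) (Ioo 0 u) :=
    (hc.integrableOn_Icc (a := 0) (b := u)).mono_set Ioo_subset_Icc_self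
  rw [← ofReal_integral_eq_lintegral_ofReal hi (ae_of_all _ fun r => Real.exp_nonneg _),
    ← ENNReal.ofReal_mul hM.le, ← ENNReal.ofReal_add (mul_nonneg hM.le
      (integral_nonneg fun r => Real.exp_nonneg _)) (Real.exp_nonneg _)]
  rw [← integral_Ioc_eq_integral_Ioo, ← intervalIntegral.integral_of_le hu.le]
  have hd : ∀ r ∈ uIcc 0 u, HasDerivAt (fun r : ℝ => M⁻¹ * Real.exp (-(M * (u - r))))
      (Real.exp (-(M * (u - r)))) r := fun r _ => by
    have h1 : HasDerivAt (fun r : ℝ => -(M * (u - r))) M r := by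
      have := ((hasDerivAt_id r).const_sub u).const_mul (-M)
      simpa using this
    have := h1.exp.const_mul M⁻¹
    rwa [mul_left_comm, inv_mul_cancel₀ hM.ne', mul_one] at this
  rw [intervalIntegral.integral_eq_sub_of_hasDerivAt hd (hc.intervalIntegrable _ _)]
  rw [← ENNReal.ofReal_one]
  congr 1
  simp only [sub_self, mul_zero, neg_zero, Real.exp_zero, sub_zero]
  field_simp
  ring

/-- The boundary term `exp (-M τ) β`, for `β` constant along lines. -/
theorem ConvexDomain.raySum_boundary (hΩ : ConvexDomain Ω) (hv : UnitField v) {M : ℝ} (hM : 0 < M)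
    (b : Space d × Dir d → ℝ≥0∞) {p : Space d × Dir d} (hp : p.1 ∈ Ω) :
    ENNReal.ofReal M * raySum Ω v 0 (fun p => ENNReal.ofReal
        (Real.exp (-(M * exitTime Ω p.1 (v p.2)))) * b (entryPoint Ω p.1 (v p.2), p.2)) p
      + ENNReal.ofReal (Real.exp (-(M * exitTime Ω p.1 (v p.2))))
        * b (entryPoint Ω p.1 (v p.2), p.2) = b (entryPoint Ω p.1 (v p.2), p.2) := by
  have hτ := hΩ.exitTime_pos hp (hv.norm_eq p.2)
  rw [hΩ.raySum_zero_eq hv _ hp]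
  have : ∫⁻ r in Ioo 0 (exitTime Ω p.1 (v p.2)), (ENNReal.ofReal
        (Real.exp (-(M * exitTime Ω (p.1 - r • v p.2) (v p.2))))
          * b (entryPoint Ω (p.1 - r • v p.2) (v p.2), p.2))
      = (∫⁻ r in Ioo 0 (exitTime Ω p.1 (v p.2)), ENNReal.ofReal
        (Real.exp (-(M * (exitTime Ω p.1 (v p.2) - r)))))
          * b (entryPoint Ω p.1 (v p.2), p.2) := by
    rw [← lintegral_mul_const _ (by fun_prop)]
    refine setLIntegral_congr_fun measurableSet_Ioo fun r hr => ?_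
    rw [hΩ.Ioo_exitTime hp (hv.norm_eq p.2)] at hr
    rw [hΩ.exitTime_sub hp (hv.norm_eq p.2) hr.1 hr.2,
      hΩ.entryPoint_sub hp (hv.norm_eq p.2) hr.1 hr.2]
  rw [this, ← mul_assoc, ← add_mul, lintegral_exp_Ioo hM hτ, one_mul]

/-- The resolvent identity for attenuated integration along lines. -/
theorem ConvexDomain.raySum_raySum (hΩ : ConvexDomain Ω) (hv : UnitField v) {M : ℝ} (hM : 0 < M)
    {g : Space d × Dir d → ℝ≥0∞} (hg : Measurable g) {p : Space d × Dir d} (hp : p.1 ∈ Ω) :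
    ENNReal.ofReal M * raySum Ω v 0 (raySum Ω v M g) p + raySum Ω v M g p
      = raySum Ω v 0 g p := by
  obtain ⟨x, θ⟩ := p
  simp only at hp
  set w : ℝ → ℝ≥0∞ := fun u => (Ω ×ˢ univ).indicator g (x - u • v θ, θ) with hw
  have hwm : Measurable w := by
    have := hΩ.measurable_raySum_line hv 0 hg (x, θ)
    simpa using this
  have hχ : MeasurableSet {r : ℝ | x - r • v θ ∈ Ω} :=
    (hΩ.isOpen.preimage (by fun_prop : Continuous fun r : ℝ => x - r • v θ)).measurableSet
  set χ : ℝ → ℝ≥0∞ := {r : ℝ | x - r • v θ ∈ Ω}.indicator 1 with hχd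
  have hχm : Measurable χ := measurable_one.indicator hχ
  have inner : ∀ r : ℝ, raySum Ω v M g (x - r • v θ, θ)
      = ∫⁻ u, (Ioi r).indicator (fun u => ENNReal.ofReal (Real.exp (-(M * (u - r)))) * w u) u := by
    intro r
    unfold raySum
    rw [← lintegral_indicator measurableSet_Ioi]
    -- Shifting the variable by `r` parametrizes the ray from the intermediate point by its position
    -- on the original ray.
    rw [← lintegral_sub_right_eq_self _ r]
    refine lintegral_congr fun u => ?_
    by_cases hu : r < u
    · have : x - r • v θ - (u - r) • v θ = x - u • v θ := by module
      rw [indicator_of_mem (mem_Ioi.2 (sub_pos.2 hu)), indicator_of_mem (mem_Ioi.2 hu)]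
      simp only [this, hw]
    · simp [indicator, hu]
  have outer : raySum Ω v 0 (raySum Ω v M g) (x, θ)
      = ∫⁻ r in Ioi (0 : ℝ), ∫⁻ u in Ioi (0 : ℝ), χ r * (Ioi r).indicator
          (fun u => ENNReal.ofReal (Real.exp (-(M * (u - r)))) * w u) u := by
    conv_lhs => unfold raySum
    refine setLIntegral_congr_fun measurableSet_Ioi fun r hr => ?_
    simp only
    have hχt : χ r ≠ ∞ := by
      by_cases h : x - r • v θ ∈ Ω <;> simp [hχd, h]
    rw [lintegral_const_mul' _ _ hχt, ← lintegral_indicator measurableSet_Ioi]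
    have : ∀ u, (Ioi (0 : ℝ)).indicator ((Ioi r).indicator
        (fun u => ENNReal.ofReal (Real.exp (-(M * (u - r)))) * w u)) u = (Ioi r).indicator
        (fun u => ENNReal.ofReal (Real.exp (-(M * (u - r)))) * w u) u := by
      intro u
      rw [indicator_indicator, inter_eq_right.2 (Ioi_subset_Ioi (mem_Ioi.1 hr).le)]
    rw [lintegral_congr this, ← inner]
    by_cases h : x - r • v θ ∈ Ω <;> simp [hχd, h, raySum]
  have hswap : ∫⁻ r in Ioi (0 : ℝ), ∫⁻ u in Ioi (0 : ℝ), χ r * (Ioi r).indicator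
          (fun u => ENNReal.ofReal (Real.exp (-(M * (u - r)))) * w u) u
      = ∫⁻ u in Ioi (0 : ℝ), (∫⁻ r in Ioo 0 u, ENNReal.ofReal (Real.exp (-(M * (u - r))))) * w u := by
    rw [lintegral_lintegral_swap]
    · refine setLIntegral_congr_fun measurableSet_Ioi fun u _ => ?_
      rw [← lintegral_mul_const _ (by fun_prop), ← lintegral_indicator measurableSet_Ioi,
        ← lintegral_indicator measurableSet_Ioo]
      refine lintegral_congr fun r => ?_
      by_cases h : x - u • v θ ∈ Ω
      · by_cases hr : 0 < r
        · by_cases hru : r < u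
          -- By convexity the cut-off at the intermediate point is redundant: it lies between two
          -- points of `Ω`.
          · have : x - r • v θ ∈ Ω := hΩ.sub_smul_mem hp h hr.le hru.le
            simp [indicator, hr, hru, hχd, this]
          · simp [indicator, hr, hru]
        · simp [indicator, hr]
      · simp [indicator, hw, h]
    · have hS : MeasurableSet {z : ℝ × ℝ | z.1 < z.2} := measurableSet_lt measurable_fst measurable_snd
      have : (Function.uncurry fun r u => χ r * (Ioi r).indicator
          (fun u => ENNReal.ofReal (Real.exp (-(M * (u - r)))) * w u) u)
          = fun z : ℝ × ℝ => χ z.1 * {z : ℝ × ℝ | z.1 < z.2}.indicator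
          (fun z => ENNReal.ofReal (Real.exp (-(M * (z.2 - z.1)))) * w z.2) z := by
        ext z
        rfl
      rw [this]
      exact ((hχm.comp measurable_fst).mul (Measurable.indicator (by fun_prop) hS)).aemeasurable
  rw [outer, hswap, ← lintegral_const_mul' _ _ ENNReal.ofReal_ne_top]
  unfold raySum
  rw [← lintegral_add_right _ (hΩ.measurable_raySum_line hv M hg (x, θ))]
  refine setLIntegral_congr_fun measurableSet_Ioi fun u hu => ?_
  have := lintegral_exp_Ioo hM (mem_Ioi.1 hu)
  simp only [zero_mul, neg_zero, Real.exp_zero, ENNReal.ofReal_one, one_mul]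
  rw [← mul_assoc, ← add_mul, this, one_mul]

/-- For each `r` the translation preserves mass, and the attenuation has total mass `1 / M`. With
`sq_raySum_le` this gives the `L²` bound in the manner of Schur's test. -/
theorem ConvexDomain.lintegral_raySum_le (hΩ : ConvexDomain Ω) (hv : UnitField v) {M : ℝ}
    (hM : 0 < M) {g : Space d × Dir d → ℝ≥0∞} (hg : Measurable g) :
    ∫⁻ p, raySum Ω v M g p ∂(phaseMeasure Ω)
      ≤ ENNReal.ofReal M⁻¹ * ∫⁻ p, g p ∂(phaseMeasure Ω) := by
  set ρ : Measure ℝ := volume.restrict (Ioi 0)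
  have hm := hΩ.measurable_raySum_integrand hv M hg
  have hF : Measurable fun z : (Space d × Dir d) × ℝ => ENNReal.ofReal (Real.exp (-(M * z.2))) *
      (Ω ×ˢ univ).indicator g z.1 :=
    Measurable.mul (by fun_prop) ((hg.indicator hΩ.measurableSet_prod).comp measurable_fst)
  calc ∫⁻ p, raySum Ω v M g p ∂(phaseMeasure Ω)
      ≤ ∫⁻ p, raySum Ω v M g p ∂(fullMeasure d) := by
        rw [phaseMeasure_eq]; exact lintegral_mono' Measure.restrict_le_self le_rfl
    _ = ∫⁻ z, ENNReal.ofReal (Real.exp (-(M * z.2))) *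
      (Ω ×ˢ univ).indicator g (z.1.1 - z.2 • v z.1.2, z.1.2) ∂((fullMeasure d).prod ρ) :=
        (lintegral_prod _ hm.aemeasurable).symm
    _ = ∫⁻ z, ENNReal.ofReal (Real.exp (-(M * z.2))) *
      (Ω ×ˢ univ).indicator g z.1 ∂((fullMeasure d).prod ρ) := hv.lintegral_shear ρ hF
    _ = ∫⁻ r, ENNReal.ofReal (Real.exp (-(M * r))) *
        ∫⁻ p, (Ω ×ˢ univ).indicator g p ∂(fullMeasure d) ∂ρ := by
        rw [lintegral_prod_symm' _ hF]
        exact lintegral_congr fun r => lintegral_const_mul' (ENNReal.ofReal (Real.exp (-(M * r)))) _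
          ENNReal.ofReal_ne_top
    _ = _ := by
        rw [lintegral_mul_const _ (by fun_prop), lintegral_exp_neg_mul hM,
          lintegral_indicator hΩ.measurableSet_prod, phaseMeasure_eq]

theorem ConvexDomain.sq_raySum_le (hΩ : ConvexDomain Ω) (hv : UnitField v) {M : ℝ}
    (hM : 0 < M) {g : Space d × Dir d → ℝ≥0∞} (hg : Measurable g) (p : Space d × Dir d) :
    raySum Ω v M g p ^ 2 ≤ ENNReal.ofReal M⁻¹ * raySum Ω v M (fun p => g p ^ 2) p := by
  rw [← lintegral_exp_neg_mul hM]
  refine sq_lintegral_le (by fun_prop)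
    (hΩ.measurable_raySum_line hv M (hg.pow_const 2) p).aemeasurable (ae_of_all _ fun r => ?_)
  by_cases h : p.1 - r • v p.2 ∈ Ω
  · simp only [indicator, h, mem_prod, mem_univ, and_self, if_true]
    rw [mul_pow, sq, mul_assoc]
  · simp [indicator, h]

theorem ConvexDomain.eLpNorm_raySum_le (hΩ : ConvexDomain Ω) (hv : UnitField v) {M : ℝ}
    (hM : 0 < M) {g : Space d × Dir d → ℝ≥0∞} (hg : Measurable g) :
    eLpNorm (raySum Ω v M g) 2 (phaseMeasure Ω)
      ≤ ENNReal.ofReal M⁻¹ * eLpNorm g 2 (phaseMeasure Ω) := by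
  rw [← ENNReal.pow_le_pow_left_iff two_ne_zero, mul_pow, eLpNorm_two_sq, eLpNorm_two_sq]
  simp only [enorm_eq_self]
  calc _ ≤ ∫⁻ p, ENNReal.ofReal M⁻¹ * raySum Ω v M (fun p => g p ^ 2) p ∂(phaseMeasure Ω) :=
        lintegral_mono fun p => hΩ.sq_raySum_le hv hM hg p
    _ ≤ _ := by
        rw [lintegral_const_mul' _ _ ENNReal.ofReal_ne_top, sq, mul_assoc]
        exact mul_le_mul_right (hΩ.lintegral_raySum_le hv hM (hg.pow_const 2)) _

end FPAT
end

noncomputable section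

namespace FPAT

open scoped ENNReal

variable {d : ℕ} {Ω : Set (Space d)} {v : Dir d → Space d} {f : Dir d → Dir d → ℝ}

/-! ### The collision operator, with values in `[0, ∞]` -/

/-- A symmetric probability kernel on the sphere. -/
structure ScatteringKernel (f : Dir d → Dir d → ℝ) : Prop where
  measurable : Measurable fun p : Dir d × Dir d => f p.1 p.2
  nonneg : ∀ θ θ', 0 ≤ f θ θ'
  symm : ∀ θ θ', f θ θ' = f θ' θ
  integral : ∀ θ, ∫ θ', f θ θ' ∂(sphereMeasure d) = 1

theorem ScatteringKernel.lintegral (hf : ScatteringKernel f) (θ : Dir d) :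
    ∫⁻ θ', ENNReal.ofReal (f θ θ') ∂(sphereMeasure d) = 1 := by
  have hi : Integrable (f θ) (sphereMeasure d) := by
    -- A function that is not integrable has integral zero by convention, which contradicts the
    -- value one.
    by_contra h
    have := hf.integral θ
    rw [integral_undef h] at this
    norm_num at this
  rw [← ofReal_integral_eq_lintegral_ofReal hi (ae_of_all _ fun θ' => hf.nonneg θ θ'),
    hf.integral, ENNReal.ofReal_one]

theorem ScatteringKernel.measurable_right (hf : ScatteringKernel f) (θ : Dir d) :
    Measurable (f θ) :=
  hf.measurable.comp measurable_prodMk_left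

/-- The scattering operator on functions with values in `[0, ∞]`. -/
def scatE (f : Dir d → Dir d → ℝ) (u : Space d × Dir d → ℝ≥0∞) (p : Space d × Dir d) : ℝ≥0∞ :=
  ∫⁻ θ', ENNReal.ofReal (f p.2 θ') * u (p.1, θ') ∂(sphereMeasure d)

theorem ScatteringKernel.measurable_scatE_integrand (hf : ScatteringKernel f)
    {u : Space d × Dir d → ℝ≥0∞} (hu : Measurable u) :
    Measurable fun z : (Space d × Dir d) × Dir d =>
      ENNReal.ofReal (f z.1.2 z.2) * u (z.1.1, z.2) := by
  have h1 : Measurable fun z : (Space d × Dir d) × Dir d => f z.1.2 z.2 :=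
    hf.measurable.comp (f := fun z : (Space d × Dir d) × Dir d => (z.1.2, z.2)) (by fun_prop)
  have h2 : Measurable fun z : (Space d × Dir d) × Dir d => u (z.1.1, z.2) :=
    hu.comp (f := fun z : (Space d × Dir d) × Dir d => (z.1.1, z.2)) (by fun_prop)
  exact h1.ennreal_ofReal.mul h2

theorem ScatteringKernel.measurable_scatE_line (hf : ScatteringKernel f)
    {u : Space d × Dir d → ℝ≥0∞} (hu : Measurable u) (p : Space d × Dir d) :
    Measurable fun θ' : Dir d => ENNReal.ofReal (f p.2 θ') * u (p.1, θ') :=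
  (hf.measurable_scatE_integrand hu).comp (measurable_prodMk_left (x := p))

theorem ScatteringKernel.measurable_scatE (hf : ScatteringKernel f)
    {u : Space d × Dir d → ℝ≥0∞} (hu : Measurable u) : Measurable (scatE f u) :=
  (hf.measurable_scatE_integrand hu).lintegral_prod_right'

theorem scatE_mono {u u' : Space d × Dir d → ℝ≥0∞} (h : ∀ p, u p ≤ u' p) (p : Space d × Dir d) :
    scatE f u p ≤ scatE f u' p :=
  lintegral_mono fun _ => mul_le_mul_right (h _) _

theorem ScatteringKernel.scatE_iSup (hf : ScatteringKernel f)
    {u : ℕ → Space d × Dir d → ℝ≥0∞} (hu : ∀ n, Measurable (u n)) (hm : Monotone u)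
    (p : Space d × Dir d) : scatE f (fun p => ⨆ n, u n p) p = ⨆ n, scatE f (u n) p := by
  unfold scatE
  rw [← lintegral_iSup (fun n => hf.measurable_scatE_line (hu n) p)]
  · simp_rw [ENNReal.mul_iSup]
  · exact fun m n hmn _ => mul_le_mul_right (hm hmn _) _

theorem ScatteringKernel.sq_scatE_le (hf : ScatteringKernel f)
    {u : Space d × Dir d → ℝ≥0∞} (hu : Measurable u) (p : Space d × Dir d) :
    scatE f u p ^ 2 ≤ scatE f (fun p => u p ^ 2) p := by
  have := sq_lintegral_le (a := fun θ' => ENNReal.ofReal (f p.2 θ') * u (p.1, θ'))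
    (ν := sphereMeasure d) (hf.measurable_right p.2).ennreal_ofReal.aemeasurable
    (hf.measurable_scatE_line (hu.pow_const 2) p).aemeasurable
    (ae_of_all _ fun θ' => by rw [mul_pow, sq, mul_assoc])
  rwa [hf.lintegral, one_mul] at this

/-- By symmetry the kernel is also a probability density in its first argument, so scattering
conserves the angular mass. -/
theorem ScatteringKernel.lintegral_scatE (hf : ScatteringKernel f)
    {u : Space d × Dir d → ℝ≥0∞} (hu : Measurable u) (x : Space d) :
    ∫⁻ θ, scatE f u (x, θ) ∂(sphereMeasure d) = ∫⁻ θ, u (x, θ) ∂(sphereMeasure d) := by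
  unfold scatE
  rw [lintegral_lintegral_swap]
  · refine lintegral_congr fun θ' => ?_
    simp only
    rw [lintegral_mul_const]
    · simp_rw [hf.symm _ θ']
      rw [hf.lintegral, one_mul]
    · simp_rw [hf.symm _ θ']
      exact (hf.measurable_right θ').ennreal_ofReal
  · exact ((hf.measurable_scatE_integrand hu).comp
      (g := _) (f := fun z : Dir d × Dir d => ((x, z.1), z.2)) (by fun_prop)).aemeasurable

/-- The in-scattering term `k u + m K u`. -/
def gainE (f : Dir d → Dir d → ℝ) (k m : Space d → ℝ≥0∞) (u : Space d × Dir d → ℝ≥0∞)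
    (p : Space d × Dir d) : ℝ≥0∞ := k p.1 * u p + m p.1 * scatE f u p

theorem gainE_mono {k m : Space d → ℝ≥0∞} {u u' : Space d × Dir d → ℝ≥0∞} (h : ∀ p, u p ≤ u' p)
    (p : Space d × Dir d) : gainE f k m u p ≤ gainE f k m u' p :=
  add_le_add (mul_le_mul_right (h p) _) (mul_le_mul_right (scatE_mono h p) _)

theorem ScatteringKernel.measurable_gainE (hf : ScatteringKernel f) {k m : Space d → ℝ≥0∞}
    (hk : Measurable k) (hm : Measurable m) {u : Space d × Dir d → ℝ≥0∞} (hu : Measurable u) :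
    Measurable (gainE f k m u) := by
  have := hf.measurable_scatE hu
  unfold gainE
  fun_prop

theorem ScatteringKernel.gainE_iSup (hf : ScatteringKernel f) {k m : Space d → ℝ≥0∞}
    {u : ℕ → Space d × Dir d → ℝ≥0∞} (hu : ∀ n, Measurable (u n)) (hmo : Monotone u)
    (p : Space d × Dir d) : gainE f k m (fun p => ⨆ n, u n p) p = ⨆ n, gainE f k m (u n) p := by
  unfold gainE
  rw [hf.scatE_iSup hu hmo, ENNReal.mul_iSup, ENNReal.mul_iSup]
  exact ENNReal.iSup_add_iSup_of_monotone (fun i j h => mul_le_mul_right (hmo h p) _)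
    (fun i j h => mul_le_mul_right (scatE_mono (hmo h) p) _)

theorem lintegral_phaseMeasure {u : Space d × Dir d → ℝ≥0∞} (hu : Measurable u) :
    ∫⁻ p, u p ∂(phaseMeasure Ω)
      = ∫⁻ x in Ω, ∫⁻ θ, u (x, θ) ∂(sphereMeasure d) := by
  rw [phaseMeasure, lintegral_prod _ hu.aemeasurable]

/-- Pointwise Cauchy-Schwarz bounds the square of the gain of `u` by `k + m` times the gain of `u²`.
Scattering conserves angular mass, so integrating the latter produces `k + m` again, and each factor
is at most `C`. -/
theorem ScatteringKernel.eLpNorm_gainE_le (hf : ScatteringKernel f) {k m : Space d → ℝ≥0∞}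
    (hk : Measurable k) (hm : Measurable m) {u : Space d × Dir d → ℝ≥0∞} (hu : Measurable u)
    {C : ℝ≥0∞} (hC : ∀ᵐ x ∂(volume.restrict Ω), k x + m x ≤ C) (hCt : C ≠ ∞) :
    eLpNorm (gainE f k m u) 2 (phaseMeasure Ω) ≤ C * eLpNorm u 2 (phaseMeasure Ω) := by
  rw [← ENNReal.pow_le_pow_left_iff two_ne_zero, mul_pow, eLpNorm_two_sq, eLpNorm_two_sq]
  simp only [enorm_eq_self]
  have hu2 := hu.pow_const 2
  calc ∫⁻ p, gainE f k m u p ^ 2 ∂(phaseMeasure Ω)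
      ≤ ∫⁻ p, C * gainE f k m (fun p => u p ^ 2) p ∂(phaseMeasure Ω) := by
        refine lintegral_mono_ae ((ae_phase_of_ae hC).mono fun p hp => ?_)
        refine (sq_add_le_ennreal (b := k p.1) (c := k p.1 * u p ^ 2) (b' := m p.1)
          (c' := m p.1 * scatE f (fun p => u p ^ 2) p) ?_ ?_).trans (mul_le_mul_left hp _)
        · rw [mul_pow, sq, mul_assoc]
        · rw [mul_pow, sq, mul_assoc]
          gcongr
          exact hf.sq_scatE_le hu p
    _ = C * ∫⁻ x in Ω, (k x + m x) * ∫⁻ θ, u (x, θ) ^ 2 ∂(sphereMeasure d) := by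
        rw [lintegral_const_mul' _ _ hCt, lintegral_phaseMeasure (hf.measurable_gainE hk hm hu2)]
        congr 1
        refine lintegral_congr fun x => ?_
        unfold gainE
        have h1 : Measurable fun θ : Dir d => u (x, θ) ^ 2 := hu2.comp measurable_prodMk_left
        have h2 : Measurable fun θ : Dir d => scatE f (fun p => u p ^ 2) (x, θ) :=
          (hf.measurable_scatE hu2).comp measurable_prodMk_left
        simp only
        rw [lintegral_add_left (by fun_prop), lintegral_const_mul _ h1, lintegral_const_mul _ h2,
          hf.lintegral_scatE hu2, add_mul]
    _ ≤ C * ∫⁻ x in Ω, C * ∫⁻ θ, u (x, θ) ^ 2 ∂(sphereMeasure d) := by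
        gcongr 1
        exact lintegral_mono_ae (hC.mono fun x hx => mul_le_mul_left hx _)
    _ = C ^ 2 * ∫⁻ p, u p ^ 2 ∂(phaseMeasure Ω) := by
        rw [lintegral_const_mul' _ _ hCt, lintegral_phaseMeasure hu2, sq, mul_assoc]

/-! ### The minimal nonnegative solution -/

/-- Nonnegative data of a transport problem: the coefficients of the in-scattering term, the
source and the inflow data. -/
structure TransportData (d : ℕ) where
  /-- the coefficient of the unscattered part -/
  k : Space d → ℝ≥0∞
  /-- the scattering coefficient -/
  m : Space d → ℝ≥0∞
  /-- the source -/
  q : Space d × Dir d → ℝ≥0∞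
  /-- the inflow data -/
  b : Space d × Dir d → ℝ≥0∞
  measurable_k : Measurable k
  measurable_m : Measurable m
  measurable_q : Measurable q
  measurable_b : Measurable b

/-- The boundary data, transported along lines into the domain. -/
def TransportData.inflow (D : TransportData d) (Ω : Set (Space d)) (v : Dir d → Space d)
    (p : Space d × Dir d) : ℝ≥0∞ := D.b (entryPoint Ω p.1 (v p.2), p.2)

/-- The boundary data, transported along lines with attenuation `exp (-M τ)`. -/
def TransportData.attenuated (D : TransportData d) (Ω : Set (Space d)) (v : Dir d → Space d)
    (M : ℝ) (p : Space d × Dir d) : ℝ≥0∞ :=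
  ENNReal.ofReal (Real.exp (-(M * exitTime Ω p.1 (v p.2)))) * D.inflow Ω v p

/-- The collision iterates. -/
def TransportData.iter (D : TransportData d) (Ω : Set (Space d)) (v : Dir d → Space d)
    (f : Dir d → Dir d → ℝ) (M : ℝ) : ℕ → Space d × Dir d → ℝ≥0∞
  | 0 => 0
  | n + 1 => fun p => D.attenuated Ω v M p +
      raySum Ω v M (fun p => D.q p + gainE f D.k D.m (D.iter Ω v f M n) p) p

/-- The minimal nonnegative solution, the supremum of the collision iterates. -/
def TransportData.sol (D : TransportData d) (Ω : Set (Space d)) (v : Dir d → Space d)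
    (f : Dir d → Dir d → ℝ) (M : ℝ) (p : Space d × Dir d) : ℝ≥0∞ :=
  ⨆ n, D.iter Ω v f M n p

theorem TransportData.measurable_inflow (D : TransportData d) (hΩ : ConvexDomain Ω)
    (hv : UnitField v) : Measurable (D.inflow Ω v) :=
  D.measurable_b.comp (hΩ.measurable_entryPoint hv)

theorem TransportData.measurable_attenuated (D : TransportData d) (hΩ : ConvexDomain Ω)
    (hv : UnitField v) (M : ℝ) : Measurable (D.attenuated Ω v M) := by
  have h1 := hΩ.measurable_exitTime hv
  have h2 := D.measurable_inflow hΩ hv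
  unfold attenuated
  fun_prop

theorem TransportData.measurable_iter (D : TransportData d) (hΩ : ConvexDomain Ω)
    (hv : UnitField v) (hf : ScatteringKernel f) (M : ℝ) (n : ℕ) :
    Measurable (D.iter Ω v f M n) := by
  induction n with
  | zero => exact measurable_zero
  | succ n ih =>
    exact (D.measurable_attenuated hΩ hv M).add (hΩ.measurable_raySum hv M
      (D.measurable_q.add (hf.measurable_gainE D.measurable_k D.measurable_m ih)))

theorem TransportData.monotone_iter (D : TransportData d) (M : ℝ) :
    Monotone (D.iter Ω v f M) := by
  refine monotone_nat_of_le_succ fun n => ?_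
  induction n with
  | zero => exact fun p => zero_le
  | succ n ih =>
    intro p
    exact add_le_add le_rfl (raySum_mono (fun p => add_le_add le_rfl (gainE_mono ih p)) p)

theorem TransportData.measurable_sol (D : TransportData d) (hΩ : ConvexDomain Ω)
    (hv : UnitField v) (hf : ScatteringKernel f) (M : ℝ) : Measurable (D.sol Ω v f M) :=
  Measurable.iSup fun n => D.measurable_iter hΩ hv hf M n

/-- Monotone convergence passes through the scattering integral and the line integral, so the
supremum of the iterates is a fixed point, whether or not it is finite. -/
theorem TransportData.sol_eq (D : TransportData d) (hΩ : ConvexDomain Ω)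
    (hv : UnitField v) (hf : ScatteringKernel f) (M : ℝ) (p : Space d × Dir d) :
    D.sol Ω v f M p = D.attenuated Ω v M p +
      raySum Ω v M (fun p => D.q p + gainE f D.k D.m (D.sol Ω v f M) p) p := by
  have hm := D.monotone_iter (Ω := Ω) (v := v) (f := f) M
  have hme := D.measurable_iter hΩ hv hf M
  have h1 : (fun p => D.q p + gainE f D.k D.m (D.sol Ω v f M) p)
      = fun p => ⨆ n, (D.q p + gainE f D.k D.m (D.iter Ω v f M n) p) := by
    ext p
    rw [← ENNReal.add_iSup, ← hf.gainE_iSup hme hm]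
    rfl
  rw [h1, hΩ.raySum_iSup hv
    (g := fun n p => D.q p + gainE f D.k D.m (D.iter Ω v f M n) p) (fun n => D.measurable_q.add
    (hf.measurable_gainE D.measurable_k D.measurable_m (hme n)))
    (fun i j h p => add_le_add le_rfl (gainE_mono (hm h) p)), ENNReal.add_iSup]
  change ⨆ n, _ = ⨆ n, D.iter Ω v f M (n + 1) p
  have hmp : Monotone fun n => D.iter Ω v f M n p := fun i j h => hm h p
  exact (hmp.iSup_nat_add 1).symm

/-- One iteration is affine with contraction factor `(M - c) / M`: the gain has norm at most `M - c`
and the attenuated line integration at most `1 / M`. The factor `M / c` is the sum of the geometric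
series, that is, `1 + M⁻¹ (M - c) (M / c) = M / c`. -/
theorem TransportData.eLpNorm_iter_le (D : TransportData d) (hΩ : ConvexDomain Ω)
    (hv : UnitField v) (hf : ScatteringKernel f) {M c : ℝ} (hc : 0 < c) (hcM : c ≤ M)
    (hk : ∀ᵐ x ∂(volume.restrict Ω), D.k x + D.m x ≤ ENNReal.ofReal (M - c)) (n : ℕ) :
    eLpNorm (D.iter Ω v f M n) 2 (phaseMeasure Ω)
      ≤ ENNReal.ofReal (M / c) * (eLpNorm (D.inflow Ω v) 2 (phaseMeasure Ω)
        + ENNReal.ofReal M⁻¹ * eLpNorm D.q 2 (phaseMeasure Ω)) := by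
  have hM : 0 < M := hc.trans_le hcM
  set B := eLpNorm (D.inflow Ω v) 2 (phaseMeasure Ω)
        + ENNReal.ofReal M⁻¹ * eLpNorm D.q 2 (phaseMeasure Ω) with hB
  induction n with
  | zero => simp [TransportData.iter]
  | succ n ih =>
    have hmi := D.measurable_iter hΩ hv hf M n
    have hg := hf.measurable_gainE D.measurable_k D.measurable_m hmi
    have hatt : eLpNorm (D.attenuated Ω v M) 2 (phaseMeasure Ω)
        ≤ eLpNorm (D.inflow Ω v) 2 (phaseMeasure Ω) := by
      rw [← ENNReal.pow_le_pow_left_iff two_ne_zero, eLpNorm_two_sq, eLpNorm_two_sq]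
      refine lintegral_mono fun p => ?_
      simp only [enorm_eq_self, TransportData.attenuated]
      refine pow_le_pow_left' (mul_le_of_le_one_left zero_le ?_) 2
      rw [ENNReal.ofReal_le_one, Real.exp_le_one_iff]
      have := exitTime_nonneg (Ω := Ω) p.1 (v p.2)
      nlinarith
    calc eLpNorm (D.iter Ω v f M (n + 1)) 2 (phaseMeasure Ω)
        ≤ eLpNorm (D.attenuated Ω v M) 2 (phaseMeasure Ω)
          + eLpNorm (raySum Ω v M (fun p => D.q p + gainE f D.k D.m (D.iter Ω v f M n) p)) 2
            (phaseMeasure Ω) :=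
          eLpNorm_add_le (D.measurable_attenuated hΩ hv M).aestronglyMeasurable
            (hΩ.measurable_raySum hv M (D.measurable_q.add hg)).aestronglyMeasurable one_le_two
      _ ≤ eLpNorm (D.inflow Ω v) 2 (phaseMeasure Ω) + ENNReal.ofReal M⁻¹ *
          (eLpNorm D.q 2 (phaseMeasure Ω) + ENNReal.ofReal (M - c) *
            eLpNorm (D.iter Ω v f M n) 2 (phaseMeasure Ω)) := by
          refine add_le_add hatt ((hΩ.eLpNorm_raySum_le hv hM (D.measurable_q.add hg)).trans ?_)
          gcongr
          refine (eLpNorm_add_le D.measurable_q.aestronglyMeasurable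
            hg.aestronglyMeasurable one_le_two).trans ?_
          gcongr
          exact hf.eLpNorm_gainE_le D.measurable_k D.measurable_m hmi hk ENNReal.ofReal_ne_top
      _ ≤ B + ENNReal.ofReal M⁻¹ * (ENNReal.ofReal (M - c) * (ENNReal.ofReal (M / c) * B)) := by
          rw [mul_add, ← add_assoc]
          gcongr
      _ = (1 + ENNReal.ofReal M⁻¹ * ENNReal.ofReal (M - c) * ENNReal.ofReal (M / c)) * B := by
          ring
      _ = ENNReal.ofReal (M / c) * B := by
          have h0 : 0 ≤ M - c := sub_nonneg.2 hcM
          rw [← ENNReal.ofReal_mul (by positivity), ← ENNReal.ofReal_mul (by positivity),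
            ← ENNReal.ofReal_one, ← ENNReal.ofReal_add zero_le_one (by positivity)]
          congr 2
          field_simp
          ring

theorem TransportData.eLpNorm_sol_le (D : TransportData d) (hΩ : ConvexDomain Ω)
    (hv : UnitField v) (hf : ScatteringKernel f) {M c : ℝ} (hc : 0 < c) (hcM : c ≤ M)
    (hk : ∀ᵐ x ∂(volume.restrict Ω), D.k x + D.m x ≤ ENNReal.ofReal (M - c)) :
    eLpNorm (D.sol Ω v f M) 2 (phaseMeasure Ω)
      ≤ ENNReal.ofReal (M / c) * (eLpNorm (D.inflow Ω v) 2 (phaseMeasure Ω)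
        + ENNReal.ofReal M⁻¹ * eLpNorm D.q 2 (phaseMeasure Ω)) := by
  have hm := D.monotone_iter (Ω := Ω) (v := v) (f := f) M
  rw [← ENNReal.pow_le_pow_left_iff two_ne_zero, eLpNorm_two_sq]
  have : ∀ p, ‖D.sol Ω v f M p‖ₑ ^ 2 = ⨆ n, (D.iter Ω v f M n p) ^ 2 := by
    intro p
    rw [enorm_eq_self]
    have h1 : Tendsto (fun n => D.iter Ω v f M n p) atTop (𝓝 (D.sol Ω v f M p)) :=
      tendsto_atTop_iSup fun i j h => hm h p
    have h2 : Tendsto (fun n => D.iter Ω v f M n p ^ 2) atTop (𝓝 (⨆ n, D.iter Ω v f M n p ^ 2)) :=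
      tendsto_atTop_iSup fun i j h => pow_le_pow_left' (hm h p) 2
    exact tendsto_nhds_unique (((ENNReal.continuous_pow 2).tendsto _).comp h1) h2
  rw [lintegral_congr this, lintegral_iSup
    (fun n => (D.measurable_iter hΩ hv hf M n).pow_const 2)
    (fun i j h p => pow_le_pow_left' (hm h p) 2)]
  refine iSup_le fun n => ?_
  have := pow_le_pow_left' (D.eLpNorm_iter_le hΩ hv hf hc hcM hk n) 2
  rw [eLpNorm_two_sq] at this
  simpa only [enorm_eq_self] using this

/-- Cauchy-Schwarz for transport problems: the minimal solutions inherit the inequality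
`u ^ 2 ≤ u' u''` from the data. -/
theorem TransportData.sq_sol_le (hΩ : ConvexDomain Ω) (hv : UnitField v)
    (hf : ScatteringKernel f) {M : ℝ} {D D' D'' : TransportData d}
    (hk : ∀ᵐ x ∂(volume.restrict Ω), D.k x ^ 2 ≤ D'.k x * D''.k x)
    (hm : ∀ᵐ x ∂(volume.restrict Ω), D.m x ^ 2 ≤ D'.m x * D''.m x)
    (hq : ∀ᵐ p ∂(phaseMeasure Ω), D.q p ^ 2 ≤ D'.q p * D''.q p)
    (hb : ∀ᵐ p ∂(phaseMeasure Ω), D.inflow Ω v p ^ 2 ≤ D'.inflow Ω v p * D''.inflow Ω v p) :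
    ∀ᵐ p ∂(phaseMeasure Ω), D.sol Ω v f M p ^ 2 ≤ D'.sol Ω v f M p * D''.sol Ω v f M p := by
  have key : ∀ n, ∀ᵐ p ∂(phaseMeasure Ω),
      D.iter Ω v f M n p ^ 2 ≤ D'.iter Ω v f M n p * D''.iter Ω v f M n p := by
    intro n
    induction n with
    | zero => simp [TransportData.iter]
    | succ n ih =>
      have hsc : ∀ᵐ p ∂(phaseMeasure Ω), scatE f (D.iter Ω v f M n) p ^ 2
          ≤ scatE f (D'.iter Ω v f M n) p * scatE f (D''.iter Ω v f M n) p := by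
        -- The inequality between the iterates holds almost everywhere on almost every angular
        -- fibre, which suffices for the scattering integral. For the line integral `ae_ae_line`
        -- plays the same role.
        refine (ae_phase_of_ae (Measure.ae_ae_of_ae_prod ih)).mono fun p hp => ?_
        refine sq_lintegral_le
          (hf.measurable_scatE_line (D'.measurable_iter hΩ hv hf M n) p).aemeasurable
          (hf.measurable_scatE_line (D''.measurable_iter hΩ hv hf M n) p).aemeasurable
          (hp.mono fun θ' hθ' => ?_)
        rw [mul_pow, sq (ENNReal.ofReal _), mul_mul_mul_comm]
        exact mul_le_mul_right hθ' _
      have hg : ∀ᵐ p ∂(phaseMeasure Ω),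
          (D.q p + gainE f D.k D.m (D.iter Ω v f M n) p) ^ 2
          ≤ (D'.q p + gainE f D'.k D'.m (D'.iter Ω v f M n) p)
            * (D''.q p + gainE f D''.k D''.m (D''.iter Ω v f M n) p) := by
        filter_upwards [hsc, ih, hq, ae_phase_of_ae hk, ae_phase_of_ae hm] with p h1 h2 h3 h4 h5
        refine sq_add_le_ennreal h3 (sq_add_le_ennreal ?_ ?_)
        · rw [mul_pow, mul_mul_mul_comm]
          exact mul_le_mul' h4 h2
        · rw [mul_pow, mul_mul_mul_comm]
          exact mul_le_mul' h5 h1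
      filter_upwards [hΩ.ae_ae_line hv hg (volume.restrict (Ioi 0)), hb] with p hp hbp
      refine sq_add_le_ennreal ?_ (sq_lintegral_le
        (hΩ.measurable_raySum_line hv M (D'.measurable_q.add (hf.measurable_gainE
          D'.measurable_k D'.measurable_m (D'.measurable_iter hΩ hv hf M n))) p).aemeasurable
        (hΩ.measurable_raySum_line hv M (D''.measurable_q.add (hf.measurable_gainE
          D''.measurable_k D''.measurable_m (D''.measurable_iter hΩ hv hf M n))) p).aemeasurable
        (hp.mono fun r hr => ?_))
      · unfold TransportData.attenuated
        rw [mul_pow, sq (ENNReal.ofReal _), mul_mul_mul_comm]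
        exact mul_le_mul_right hbp _
      · rw [mul_pow, sq (ENNReal.ofReal _), mul_mul_mul_comm]
        refine mul_le_mul_right ?_ _
        by_cases h : p.1 - r • v p.2 ∈ Ω
        · simpa [indicator, h] using hr h
        · simp [indicator, h]
  refine (ae_all_iff.2 key).mono fun p hp => ?_
  have h1 : Tendsto (fun n => D.iter Ω v f M n p) atTop (𝓝 (D.sol Ω v f M p)) :=
    tendsto_atTop_iSup fun i j h => D.monotone_iter M h p
  refine le_of_tendsto' (((ENNReal.continuous_pow 2).tendsto _).comp h1) fun n => ?_
  exact (hp n).trans (mul_le_mul' (le_iSup (fun n => D'.iter Ω v f M n p) n)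
    (le_iSup (fun n => D''.iter Ω v f M n p) n))

end FPAT
end

noncomputable section

namespace FPAT

open scoped ENNReal

variable {d : ℕ} {Ω : Set (Space d)} {v : Dir d → Space d} {f : Dir d → Dir d → ℝ}

/-! ### Square integrable functions on phase space -/

/-- `φ ∈ L²(X)`. -/
abbrev PhaseL2 (Ω : Set (Space d)) (φ : Space d → Dir d → ℝ) : Prop :=
  MemLp (fun p : Space d × Dir d => φ p.1 p.2) 2 (phaseMeasure Ω)

/-- The norm of `L²(X)`, with values in `[0, ∞]`. -/
abbrev phaseNorm (Ω : Set (Space d)) (φ : Space d → Dir d → ℝ) : ℝ≥0∞ :=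
  eLpNorm (fun p : Space d × Dir d => φ p.1 p.2) 2 (phaseMeasure Ω)

theorem aestronglyMeasurable_phase {a : Space d → ℝ}
    (ha : AEMeasurable a (volume.restrict Ω)) :
    AEStronglyMeasurable (fun p : Space d × Dir d => a p.1) (phaseMeasure Ω) :=
  (ha.comp_quasiMeasurePreserving Measure.quasiMeasurePreserving_fst).aestronglyMeasurable

theorem phaseNorm_mul_le {a : Space d → ℝ} {C : ℝ}
    (hC : ∀ᵐ x ∂(volume.restrict Ω), |a x| ≤ C) (φ : Space d → Dir d → ℝ) :
    phaseNorm Ω (fun x θ => a x * φ x θ) ≤ ENNReal.ofReal C * phaseNorm Ω φ := by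
  refine eLpNorm_le_mul_eLpNorm_of_ae_le_mul ((ae_phase_of_ae hC).mono fun p hp => ?_) 2
  rw [norm_mul]
  exact mul_le_mul_of_nonneg_right hp (norm_nonneg _)

theorem PhaseL2.coeff_mul {a : Space d → ℝ} {C : ℝ} {φ : Space d → Dir d → ℝ}
    (hφ : PhaseL2 Ω φ) (ha : AEMeasurable a (volume.restrict Ω))
    (hC : ∀ᵐ x ∂(volume.restrict Ω), |a x| ≤ C) : PhaseL2 Ω (fun x θ => a x * φ x θ) :=
  ⟨(aestronglyMeasurable_phase ha).mul hφ.1,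
    (phaseNorm_mul_le hC φ).trans_lt (ENNReal.mul_lt_top ENNReal.ofReal_lt_top hφ.2)⟩

theorem ScatteringKernel.eLpNorm_scatE_le (hf : ScatteringKernel f)
    {u : Space d × Dir d → ℝ≥0∞} (hu : Measurable u) :
    eLpNorm (scatE f u) 2 (phaseMeasure Ω) ≤ eLpNorm u 2 (phaseMeasure Ω) := by
  have := hf.eLpNorm_gainE_le (Ω := Ω) (k := 0) (m := 1) measurable_zero measurable_one hu (C := 1)
    (ae_of_all _ fun x => by simp) ENNReal.one_ne_top
  have h : gainE f 0 1 u = scatE f u := by ext p; simp [gainE]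
  rwa [h, one_mul] at this

theorem ae_lt_top_of_eLpNorm {α : Type*} [MeasurableSpace α] {ν : Measure α} {u : α → ℝ≥0∞}
    (hu : Measurable u) (h : eLpNorm u 2 ν < ∞) : ∀ᵐ x ∂ν, u x < ∞ := by
  have h1 : ∫⁻ x, u x ^ 2 ∂ν < ∞ := by
    have := ENNReal.pow_lt_top h (n := 2)
    rwa [eLpNorm_two_sq] at this
  refine (ae_lt_top (hu.pow_const 2) h1.ne).mono fun x hx => ?_
  by_contra hc
  rw [not_lt_top_iff] at hc
  simp [hc] at hx

theorem ScatteringKernel.ae_integrable (hf : ScatteringKernel f) {φ : Space d → Dir d → ℝ}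
    (hφ : PhaseL2 Ω φ) : ∀ᵐ p ∂(phaseMeasure Ω),
      Integrable (fun θ' => f p.2 θ' * φ p.1 θ') (sphereMeasure d) := by
  set φ' := hφ.1.mk _
  have hφ' : StronglyMeasurable φ' := hφ.1.stronglyMeasurable_mk
  have heq := ae_phase_of_ae (Measure.ae_ae_of_ae_prod hφ.1.ae_eq_mk)
  have hu : Measurable fun p => ‖φ' p‖ₑ := hφ'.measurable.enorm
  have hN : eLpNorm (scatE f fun p => ‖φ' p‖ₑ) 2 (phaseMeasure Ω) < ∞ := by
    refine (hf.eLpNorm_scatE_le hu).trans_lt ?_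
    rw [eLpNorm_enorm, ← eLpNorm_congr_ae hφ.1.ae_eq_mk]
    exact hφ.2
  filter_upwards [ae_lt_top_of_eLpNorm (hf.measurable_scatE hu) hN, heq] with p hp hpe
  have h1 : Integrable (fun θ' => f p.2 θ' * φ' (p.1, θ')) (sphereMeasure d) := by
    refine ⟨((hf.measurable_right p.2).mul (hφ'.measurable.comp
      measurable_prodMk_left)).aestronglyMeasurable, ?_⟩
    rw [HasFiniteIntegral]
    convert hp using 1
    refine lintegral_congr fun θ' => ?_
    rw [enorm_mul, Real.enorm_of_nonneg (hf.nonneg _ _)]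
  exact h1.congr (hpe.mono fun θ' h => by simp only [h]; rfl)

theorem ScatteringKernel.scatter_memLp (hf : ScatteringKernel f) {φ : Space d → Dir d → ℝ}
    (hφ : PhaseL2 Ω φ) : PhaseL2 Ω (scatter f φ) := by
  set φ' := hφ.1.mk _
  have hφ' : StronglyMeasurable φ' := hφ.1.stronglyMeasurable_mk
  have heq := ae_phase_of_ae (Measure.ae_ae_of_ae_prod hφ.1.ae_eq_mk)
  have hu : Measurable fun p => ‖φ' p‖ₑ := hφ'.measurable.enorm
  have hN : eLpNorm (scatE f fun p => ‖φ' p‖ₑ) 2 (phaseMeasure Ω) < ∞ := by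
    refine (hf.eLpNorm_scatE_le hu).trans_lt ?_
    rw [eLpNorm_enorm, ← eLpNorm_congr_ae hφ.1.ae_eq_mk]
    exact hφ.2
  have hsm : StronglyMeasurable fun p : Space d × Dir d =>
      ∫ θ', f p.2 θ' * φ' (p.1, θ') ∂(sphereMeasure d) := by
    have h1 : Measurable fun z : (Space d × Dir d) × Dir d => f z.1.2 z.2 :=
      hf.measurable.comp (f := fun z : (Space d × Dir d) × Dir d => (z.1.2, z.2)) (by fun_prop)
    have h2 : Measurable fun z : (Space d × Dir d) × Dir d => φ' (z.1.1, z.2) :=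
      hφ'.measurable.comp (f := fun z : (Space d × Dir d) × Dir d => (z.1.1, z.2)) (by fun_prop)
    exact (h1.mul h2).stronglyMeasurable.integral_prod_right'
  have hae : (fun p : Space d × Dir d => ∫ θ', f p.2 θ' * φ' (p.1, θ') ∂(sphereMeasure d))
      =ᵐ[phaseMeasure Ω] fun p => scatter f φ p.1 p.2 := by
    filter_upwards [heq] with p hp
    exact integral_congr_ae (hp.mono fun θ' h => by simp only [h]; rfl)
  refine MemLp.ae_eq hae ⟨hsm.aestronglyMeasurable, ?_⟩
  refine lt_of_le_of_lt (eLpNorm_mono_enorm fun p => ?_) hN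
  rw [enorm_eq_self]
  refine (enorm_integral_le_lintegral_enorm _).trans_eq (lintegral_congr fun θ' => ?_)
  rw [enorm_mul, Real.enorm_of_nonneg (hf.nonneg _ _)]

theorem ScatteringKernel.scatter_toReal (hf : ScatteringKernel f) {u : Space d × Dir d → ℝ≥0∞}
    (hu : Measurable u) (p : Space d × Dir d) (hp : ∀ᵐ θ' ∂(sphereMeasure d), u (p.1, θ') < ∞) :
    scatter f (fun x θ => (u (x, θ)).toReal) p.1 p.2 = (scatE f u p).toReal := by
  unfold scatter scatE
  rw [← integral_toReal (hf.measurable_scatE_line hu p).aemeasurable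
    (hp.mono fun θ' h => ENNReal.mul_lt_top ENNReal.ofReal_lt_top h)]
  simp_rw [ENNReal.toReal_mul, ENNReal.toReal_ofReal (hf.nonneg _ _)]

/-- The product is dominated by `f (a² + b²)`. Each half is integrable because the kernel has mass
one in either variable. -/
theorem ScatteringKernel.integrable_mul_mul (hf : ScatteringKernel f) {a b : Dir d → ℝ}
    (ha : MemLp a 2 (sphereMeasure d)) (hb : MemLp b 2 (sphereMeasure d)) :
    Integrable (fun z : Dir d × Dir d => a z.1 * (f z.1 z.2 * b z.2))
      ((sphereMeasure d).prod (sphereMeasure d)) := by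
  have key : ∀ {a : Dir d → ℝ}, MemLp a 2 (sphereMeasure d) →
      Integrable (fun z : Dir d × Dir d => f z.1 z.2 * a z.1 ^ 2)
        ((sphereMeasure d).prod (sphereMeasure d)) := by
    intro a ha
    have hm : AEStronglyMeasurable (fun z : Dir d × Dir d => f z.1 z.2 * a z.1 ^ 2)
        ((sphereMeasure d).prod (sphereMeasure d)) :=
      hf.measurable.aestronglyMeasurable.mul ((ha.1.comp_quasiMeasurePreserving
        Measure.quasiMeasurePreserving_fst).pow 2)
    refine ⟨hm, ?_⟩
    rw [HasFiniteIntegral, lintegral_prod _ hm.enorm]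
    have : ∀ θ, ∫⁻ θ', ‖f θ θ' * a θ ^ 2‖ₑ ∂(sphereMeasure d) = ‖a θ ^ 2‖ₑ := fun θ => by
      simp_rw [enorm_mul]
      rw [lintegral_mul_const' _ _ (by simp)]
      simp_rw [Real.enorm_of_nonneg (hf.nonneg _ _)]
      rw [hf.lintegral, one_mul]
    simp_rw [this]
    exact ha.integrable_sq.2
  have i1 := key ha
  have i2 := (key hb).swap
  refine Integrable.mono' (i1.add i2) ?_ (ae_of_all _ fun z => ?_)
  · exact (ha.1.comp_quasiMeasurePreserving Measure.quasiMeasurePreserving_fst).mul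
      (hf.measurable.aestronglyMeasurable.mul
        (hb.1.comp_quasiMeasurePreserving Measure.quasiMeasurePreserving_snd))
  · simp only [Pi.add_apply, Function.comp, Prod.fst_swap, Prod.snd_swap, Real.norm_eq_abs]
    rw [hf.symm z.2 z.1, ← mul_add, mul_left_comm, abs_mul, abs_of_nonneg (hf.nonneg _ _)]
    refine mul_le_mul_of_nonneg_left ?_ (hf.nonneg _ _)
    rw [abs_mul]
    nlinarith [sq_nonneg (|a z.1| - |b z.2|), sq_abs (a z.1), sq_abs (b z.2),
      mul_nonneg (abs_nonneg (a z.1)) (abs_nonneg (b z.2))]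

theorem ScatteringKernel.integral_mul_scatter (hf : ScatteringKernel f) {a b : Dir d → ℝ}
    (ha : MemLp a 2 (sphereMeasure d)) (hb : MemLp b 2 (sphereMeasure d)) :
    ∫ θ, a θ * ∫ θ', f θ θ' * b θ' ∂(sphereMeasure d) ∂(sphereMeasure d)
      = ∫ θ, (∫ θ', f θ θ' * a θ' ∂(sphereMeasure d)) * b θ ∂(sphereMeasure d) := by
  simp_rw [← integral_const_mul, ← integral_mul_const]
  rw [integral_integral_swap (hf.integrable_mul_mul ha hb)]
  refine integral_congr_ae (ae_of_all _ fun θ => integral_congr_ae (ae_of_all _ fun θ' => ?_))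
  simp only [hf.symm θ' θ]
  ring

theorem PhaseL2.ae_memLp {φ : Space d → Dir d → ℝ} (hφ : PhaseL2 Ω φ) :
    ∀ᵐ x ∂(volume.restrict Ω), MemLp (φ x) 2 (sphereMeasure d) := by
  have h1 := hφ.integrable_sq
  rw [phaseMeasure] at h1
  filter_upwards [h1.prod_right_ae, hφ.1.prodMk_left] with x hx hm
  exact (memLp_two_iff_integrable_sq hm).2 hx

theorem PhaseL2.integrable_mul {φ ψ : Space d → Dir d → ℝ} (hφ : PhaseL2 Ω φ)
    (hψ : PhaseL2 Ω ψ) :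
    Integrable (fun p : Space d × Dir d => φ p.1 p.2 * ψ p.1 p.2) (phaseMeasure Ω) :=
  MemLp.integrable_mul hφ hψ

theorem integral_phaseMeasure {g : Space d × Dir d → ℝ} (hg : Integrable g (phaseMeasure Ω)) :
    ∫ p, g p ∂(phaseMeasure Ω) = ∫ x in Ω, ∫ θ, g (x, θ) ∂(sphereMeasure d) := by
  rw [phaseMeasure] at hg ⊢
  exact integral_prod _ hg

/-- The operator `m(x) K` is symmetric. -/
theorem ScatteringKernel.integral_mul_coeff_scatter (hf : ScatteringKernel f)
    {m : Space d → ℝ} {C : ℝ} {φ ψ : Space d → Dir d → ℝ}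
    (hφ : PhaseL2 Ω φ) (hψ : PhaseL2 Ω ψ) (hm : AEMeasurable m (volume.restrict Ω))
    (hC : ∀ᵐ x ∂(volume.restrict Ω), |m x| ≤ C) :
    ∫ p, φ p.1 p.2 * (m p.1 * scatter f ψ p.1 p.2) ∂(phaseMeasure Ω)
      = ∫ p, (m p.1 * scatter f φ p.1 p.2) * ψ p.1 p.2 ∂(phaseMeasure Ω) := by
  rw [integral_phaseMeasure (hφ.integrable_mul ((hf.scatter_memLp hψ).coeff_mul hm hC)),
    integral_phaseMeasure (((hf.scatter_memLp hφ).coeff_mul hm hC).integrable_mul hψ)]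
  refine integral_congr_ae ?_
  filter_upwards [hφ.ae_memLp, hψ.ae_memLp] with x h1 h2
  have := hf.integral_mul_scatter h1 h2
  simp only [mul_left_comm (φ x _), mul_assoc, integral_const_mul]
  unfold scatter
  rw [this]

end FPAT
end

noncomputable section

namespace FPAT

open scoped ENNReal

variable {d : ℕ} {Ω : Set (Space d)} {v : Dir d → Space d} {f : Dir d → Dir d → ℝ}
  {μa μs : Space d → ℝ} {M c : ℝ}

/-! ### The radiative transfer equation -/

/-- Absorption and scattering coefficients with `c ≤ μa`, `0 ≤ μs`, `μa + μs ≤ M`. -/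
structure Coefficients (Ω : Set (Space d)) (c M : ℝ) (μa μs : Space d → ℝ) : Prop where
  aemeasurable_a : AEMeasurable μa (volume.restrict Ω)
  aemeasurable_s : AEMeasurable μs (volume.restrict Ω)
  bounds : ∀ᵐ x ∂(volume.restrict Ω), c ≤ μa x ∧ 0 ≤ μs x ∧ μa x + μs x ≤ M

theorem Coefficients.abs_add_le (h : Coefficients Ω c M μa μs) (hc : 0 < c) :
    ∀ᵐ x ∂(volume.restrict Ω), |μa x + μs x| ≤ M :=
  h.bounds.mono fun x hx => by rw [abs_of_nonneg (by linarith)]; exact hx.2.2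

theorem Coefficients.abs_s_le (h : Coefficients Ω c M μa μs) (hc : 0 < c) :
    ∀ᵐ x ∂(volume.restrict Ω), |μs x| ≤ M :=
  h.bounds.mono fun x hx => by rw [abs_of_nonneg hx.2.1]; linarith

/-- The derivative along lines of a solution of the radiative transfer equation. -/
theorem Coefficients.rate_memLp (h : Coefficients Ω c M μa μs) (hc : 0 < c)
    (hf : ScatteringKernel f) {q φ : Space d → Dir d → ℝ} (hq : PhaseL2 Ω q)
    (hφ : PhaseL2 Ω φ) :
    PhaseL2 Ω (fun x θ => q x θ - (μa x + μs x) * φ x θ + μs x * scatter f φ x θ) :=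
  (hq.sub (hφ.coeff_mul (h.aemeasurable_a.add h.aemeasurable_s) (h.abs_add_le hc))).add
    ((hf.scatter_memLp hφ).coeff_mul h.aemeasurable_s (h.abs_s_le hc))

theorem ConvexDomain.ae_line (hΩ : ConvexDomain Ω) (hv : UnitField v)
    {P : Space d × Dir d → Prop} (h : ∀ᵐ p ∂(phaseMeasure Ω), P p) :
    ∀ᵐ p ∂(phaseMeasure Ω), ∀ᵐ r ∂(volume.restrict (Ioo 0 (exitTime Ω p.1 (v p.2)))),
      P (p.1 - r • v p.2, p.2) := by
  filter_upwards [hΩ.ae_ae_line hv h volume, hΩ.ae_mem] with p hp hpΩ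
  rw [ae_restrict_iff' measurableSet_Ioo]
  refine hp.mono fun r hr hmem => hr ?_
  rw [hΩ.Ioo_exitTime hpΩ (hv.norm_eq p.2)] at hmem
  exact hmem.2

/-- A null set of phase space meets almost every line in a null set, so the rate may be changed
almost everywhere. Boundary data are compared only at the entry points of almost all lines. -/
theorem HasStreaming.congr (hΩ : ConvexDomain Ω) (hv : UnitField v)
    {φ φ' g g' b b' : Space d → Dir d → ℝ} (h : HasStreaming Ω v φ g b)
    (hφ : ∀ᵐ p ∂(phaseMeasure Ω), φ p.1 p.2 = φ' p.1 p.2)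
    (hg : ∀ᵐ p ∂(phaseMeasure Ω), g p.1 p.2 = g' p.1 p.2)
    (hb : ∀ᵐ p ∂(phaseMeasure Ω),
      b (entryPoint Ω p.1 (v p.2)) p.2 = b' (entryPoint Ω p.1 (v p.2)) p.2) :
    HasStreaming Ω v φ' g' b' := by
  filter_upwards [h, hφ, hb, hΩ.ae_line hv hg] with p hp h1 h2 h3
  exact ⟨hp.1.congr h3, by rw [← h1, ← h2, hp.2, integral_congr_ae h3]⟩

theorem HasStreaming.sub {φ φ' g g' b b' : Space d → Dir d → ℝ} (h : HasStreaming Ω v φ g b)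
    (h' : HasStreaming Ω v φ' g' b') :
    HasStreaming Ω v (fun x θ => φ x θ - φ' x θ) (fun x θ => g x θ - g' x θ)
      (fun x θ => b x θ - b' x θ) := by
  filter_upwards [h, h'] with p hp hp'
  refine ⟨hp.1.sub hp'.1, ?_⟩
  rw [integral_sub hp.1 hp'.1, hp.2, hp'.2]
  ring

theorem SolvesRTE.congr (hΩ : ConvexDomain Ω) (hv : UnitField v)
    {μa' μs' : Space d → ℝ} {q q' b b' φ : Space d → Dir d → ℝ}
    (h : SolvesRTE Ω f v μa μs q b φ)
    (hg : ∀ᵐ p ∂(phaseMeasure Ω),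
      q p.1 p.2 - (μa p.1 + μs p.1) * φ p.1 p.2 + μs p.1 * scatter f φ p.1 p.2
        = q' p.1 p.2 - (μa' p.1 + μs' p.1) * φ p.1 p.2 + μs' p.1 * scatter f φ p.1 p.2)
    (hb : ∀ᵐ p ∂(phaseMeasure Ω),
      b (entryPoint Ω p.1 (v p.2)) p.2 = b' (entryPoint Ω p.1 (v p.2)) p.2) :
    SolvesRTE Ω f v μa' μs' q' b' φ :=
  ⟨h.1, h.2.congr hΩ hv (ae_of_all _ fun _ => rfl) hg hb⟩

theorem SolvesRTE.sub (hΩ : ConvexDomain Ω) (hv : UnitField v) (hf : ScatteringKernel f)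
    {q q' b b' φ φ' : Space d → Dir d → ℝ} (h : SolvesRTE Ω f v μa μs q b φ)
    (h' : SolvesRTE Ω f v μa μs q' b' φ') :
    SolvesRTE Ω f v μa μs (fun x θ => q x θ - q' x θ) (fun x θ => b x θ - b' x θ)
      (fun x θ => φ x θ - φ' x θ) := by
  refine ⟨h.1.sub h'.1, (h.2.sub h'.2).congr hΩ hv (ae_of_all _ fun _ => rfl) ?_
    (ae_of_all _ fun _ => rfl)⟩
  filter_upwards [hf.ae_integrable h.1, hf.ae_integrable h'.1] with p h1 h2
  have : scatter f (fun x θ => φ x θ - φ' x θ) p.1 p.2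
      = scatter f φ p.1 p.2 - scatter f φ' p.1 p.2 := by
    unfold scatter
    rw [← integral_sub h1 h2]
    simp_rw [mul_sub]
  rw [this]
  ring

theorem integral_sub_add {α : Type*} [MeasurableSpace α] {ν : Measure α} {a b e : α → ℝ}
    (ha : Integrable a ν) (hb : Integrable b ν) (he : Integrable e ν) :
    ∫ x, (a x - b x + e x) ∂ν = ∫ x, a x ∂ν - ∫ x, b x ∂ν + ∫ x, e x ∂ν := by
  rw [← integral_sub ha hb]
  exact integral_add (ha.sub hb) he

/-- Duality between the forward and the backward equation with vanishing inflow data. -/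
theorem SolvesRTE.integral_mul (hΩ : ConvexDomain Ω) (hv : UnitField v) (hf : ScatteringKernel f)
    (hco : Coefficients Ω c M μa μs) (hc : 0 < c) {q p φ ψ : Space d → Dir d → ℝ}
    (hq : PhaseL2 Ω q) (hp : PhaseL2 Ω p)
    (h : SolvesRTE Ω f v μa μs q (fun _ _ => 0) φ)
    (h' : SolvesRTE Ω f (fun θ => -v θ) μa μs p (fun _ _ => 0) ψ) :
    ∫ z, φ z.1 z.2 * p z.1 z.2 ∂(phaseMeasure Ω)
      = ∫ z, q z.1 z.2 * ψ z.1 z.2 ∂(phaseMeasure Ω) := by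
  have hg := hco.rate_memLp hc hf hq h.1
  have hg' := hco.rate_memLp hc hf hp h'.1
  -- With vanishing inflow, each density is the line integral of its rate. Adjointness then says
  -- that `φ` against the rate of `ψ` equals the rate of `φ` against `ψ`; the absorption terms agree
  -- and the scattering terms agree by symmetry of the kernel, which leaves the sources.
  have key := hΩ.integral_line_mul hv hg hg'
  have e1 : ∀ᵐ z ∂(phaseMeasure Ω), _ := h.2.mono fun z hz => hz.2
  have e2 : ∀ᵐ z ∂(phaseMeasure Ω), _ := h'.2.mono fun z hz => hz.2
  simp only [zero_add] at e1 e2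
  have k1 := key.symm.trans (integral_congr_ae (e1.mono fun z hz => by simp only [← hz]; rfl))
  have k2 := (integral_congr_ae (e2.mono fun z hz => by simp only [← hz]; rfl)).symm.trans k1
  clear key k1
  have hφ : PhaseL2 Ω φ := h.1
  have hψ : PhaseL2 Ω ψ := h'.1
  have hs := hf.integral_mul_coeff_scatter hφ hψ hco.aemeasurable_s (hco.abs_s_le hc)
  have hσ : AEMeasurable (fun x => μa x + μs x) (volume.restrict Ω) :=
    hco.aemeasurable_a.add hco.aemeasurable_s
  have i1 := hφ.integrable_mul hp
  have i2 := hφ.integrable_mul (hψ.coeff_mul hσ (hco.abs_add_le hc))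
  have i3 := hφ.integrable_mul ((hf.scatter_memLp hψ).coeff_mul hco.aemeasurable_s
    (hco.abs_s_le hc))
  have j1 := hq.integrable_mul hψ
  have j3 := ((hf.scatter_memLp hφ).coeff_mul hco.aemeasurable_s
    (hco.abs_s_le hc)).integrable_mul hψ
  have l : ∫ z, φ z.1 z.2 * (p z.1 z.2 - (μa z.1 + μs z.1) * ψ z.1 z.2
        + μs z.1 * scatter f ψ z.1 z.2) ∂(phaseMeasure Ω)
      = ∫ z, φ z.1 z.2 * p z.1 z.2 ∂(phaseMeasure Ω)
        - ∫ z, φ z.1 z.2 * ((μa z.1 + μs z.1) * ψ z.1 z.2) ∂(phaseMeasure Ω)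
        + ∫ z, φ z.1 z.2 * (μs z.1 * scatter f ψ z.1 z.2) ∂(phaseMeasure Ω) := by
    rw [← integral_sub_add i1 i2 i3]
    refine integral_congr_ae (ae_of_all _ fun z => ?_)
    ring
  have r : ∫ z, (q z.1 z.2 - (μa z.1 + μs z.1) * φ z.1 z.2
        + μs z.1 * scatter f φ z.1 z.2) * ψ z.1 z.2 ∂(phaseMeasure Ω)
      = ∫ z, q z.1 z.2 * ψ z.1 z.2 ∂(phaseMeasure Ω)
        - ∫ z, φ z.1 z.2 * ((μa z.1 + μs z.1) * ψ z.1 z.2) ∂(phaseMeasure Ω)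
        + ∫ z, (μs z.1 * scatter f φ z.1 z.2) * ψ z.1 z.2 ∂(phaseMeasure Ω) := by
    rw [← integral_sub_add j1 i2 j3]
    refine integral_congr_ae (ae_of_all _ fun z => ?_)
    ring
  have k3 := k2.symm
  rw [l, r, hs] at k3
  linarith

end FPAT
end

noncomputable section

namespace FPAT

open scoped ENNReal

variable {d : ℕ} {Ω : Set (Space d)} {v : Dir d → Space d} {f : Dir d → Dir d → ℝ}
  {μa μs : Space d → ℝ} {M c : ℝ}

/-! ### Existence, uniqueness and bounds -/

/-- The data `D` agree almost everywhere with the given nonnegative real data. -/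
structure TransportData.Represents (D : TransportData d) (Ω : Set (Space d))
    (v : Dir d → Space d) (M : ℝ) (μa μs : Space d → ℝ) (q b : Space d → Dir d → ℝ) : Prop where
  k_eq : ∀ᵐ x ∂(volume.restrict Ω), D.k x = ENNReal.ofReal (M - μa x - μs x)
  m_eq : ∀ᵐ x ∂(volume.restrict Ω), D.m x = ENNReal.ofReal (μs x)
  q_eq : ∀ᵐ p ∂(phaseMeasure Ω), D.q p = ENNReal.ofReal (q p.1 p.2) ∧ 0 ≤ q p.1 p.2
  b_eq : ∀ᵐ p ∂(phaseMeasure Ω),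
    D.inflow Ω v p = ENNReal.ofReal (b (entryPoint Ω p.1 (v p.2)) p.2) ∧
      0 ≤ b (entryPoint Ω p.1 (v p.2)) p.2

/-- The fixed point equation carries the attenuation `exp (-M r)`. Adding `M` times the plain line
integral of the solution removes it, by the boundary identity for the inflow term and the resolvent
identity for the source. The term with `M` stays on the left because differences are not available
in `[0, ∞]`. -/
theorem TransportData.sol_add_raySum (D : TransportData d) (hΩ : ConvexDomain Ω)
    (hv : UnitField v) (hf : ScatteringKernel f) (hM : 0 < M) {p : Space d × Dir d}
    (hp : p.1 ∈ Ω) :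
    ENNReal.ofReal M * raySum Ω v 0 (D.sol Ω v f M) p + D.sol Ω v f M p
      = D.inflow Ω v p
        + raySum Ω v 0 (fun p => D.q p + gainE f D.k D.m (D.sol Ω v f M) p) p := by
  set g := fun p => D.q p + gainE f D.k D.m (D.sol Ω v f M) p with hg
  have hgm : Measurable g := D.measurable_q.add
    (hf.measurable_gainE D.measurable_k D.measurable_m (D.measurable_sol hΩ hv hf M))
  have hsol : D.sol Ω v f M = fun p => D.attenuated Ω v M p + raySum Ω v M g p :=
    funext fun p => D.sol_eq hΩ hv hf M p
  rw [hsol, hΩ.raySum_add hv (D.measurable_attenuated hΩ hv M), mul_add, add_add_add_comm,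
    hΩ.raySum_raySum hv hM hgm hp]
  congr 1
  exact hΩ.raySum_boundary hv hM D.b hp

theorem TransportData.Represents.solvesRTE {D : TransportData d} {q b : Space d → Dir d → ℝ}
    (hD : D.Represents Ω v M μa μs q b) (hΩ : ConvexDomain Ω)
    (hv : UnitField v) (hf : ScatteringKernel f) (hM : 0 < M) (hco : Coefficients Ω c M μa μs)
    (hN : eLpNorm (D.sol Ω v f M) 2 (phaseMeasure Ω) < ∞) :
    SolvesRTE Ω f v μa μs q b (fun x θ => (D.sol Ω v f M (x, θ)).toReal) := by
  set u := D.sol Ω v f M with hu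
  have hum : Measurable u := D.measurable_sol hΩ hv hf M
  have hfin := ae_lt_top_of_eLpNorm hum hN
  have hKfin := ae_lt_top_of_eLpNorm (hf.measurable_scatE hum)
    ((hf.eLpNorm_scatE_le hum).trans_lt hN)
  set g := fun p => D.q p + gainE f D.k D.m u p with hg
  have hgm : Measurable g := D.measurable_q.add
    (hf.measurable_gainE D.measurable_k D.measurable_m hum)
  refine ⟨⟨hum.ennreal_toReal.aestronglyMeasurable, lt_of_le_of_lt
    (eLpNorm_mono_enorm fun p => ?_) hN⟩, ?_⟩
  · rw [Real.enorm_of_nonneg ENNReal.toReal_nonneg, enorm_eq_self]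
    exact ENNReal.ofReal_toReal_le
  have main : HasStreaming Ω v (fun x θ => (u (x, θ)).toReal)
      (fun x θ => (g (x, θ)).toReal - M * (u (x, θ)).toReal) b := by
    filter_upwards [hfin, hΩ.ae_mem, hD.b_eq] with p hup hp hbp
    have hsol := D.sol_eq hΩ hv hf M p
    -- Where the solution is finite, so is the attenuated integral of its source. Boundedness of the
    -- domain makes the plain integral of the source finite, and the identity then does the same for
    -- the solution; only now may one pass to real numbers.
    have hMg : raySum Ω v M g p < ∞ := lt_of_le_of_lt (le_add_self.trans_eq hsol.symm) hup
    have h0g : raySum Ω v 0 g p < ∞ := (hΩ.raySum_zero_le hv hM g hp).trans_lt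
      (ENNReal.mul_lt_top ENNReal.ofReal_lt_top hMg)
    have hid := D.sol_add_raySum hΩ hv hf hM hp
    rw [← hu, ← hg] at hid
    have hfinR : D.inflow Ω v p + raySum Ω v 0 g p < ∞ :=
      ENNReal.add_lt_top.2 ⟨by rw [hbp.1]; exact ENNReal.ofReal_lt_top, h0g⟩
    have h0u : raySum Ω v 0 u p < ∞ := by
      have h1 : ENNReal.ofReal M * raySum Ω v 0 u p < ∞ :=
        lt_of_le_of_lt (le_self_add.trans_eq hid) hfinR
      by_contra hcon
      rw [not_lt_top_iff] at hcon
      rw [hcon, ENNReal.mul_top (by simpa using hM)] at h1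
      exact lt_irrefl _ h1
    have hidR := congrArg ENNReal.toReal hid
    rw [ENNReal.toReal_add (ENNReal.mul_ne_top ENNReal.ofReal_ne_top h0u.ne) hup.ne,
      ENNReal.toReal_add (by rw [hbp.1]; exact ENNReal.ofReal_ne_top) h0g.ne, hbp.1,
      ENNReal.toReal_ofReal hbp.2, ENNReal.toReal_mul, ENNReal.toReal_ofReal hM.le] at hidR
    rw [hΩ.raySum_zero_eq hv _ hp] at h0g h0u
    rw [hΩ.raySum_zero_eq hv _ hp, hΩ.raySum_zero_eq hv _ hp] at hidR
    have lm : Measurable fun r : ℝ => (p.1 - r • v p.2, p.2) := by fun_prop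
    have lg := (hgm.comp lm).aemeasurable
      (μ := volume.restrict (Ioo 0 (exitTime Ω p.1 (v p.2))))
    have lu := (hum.comp lm).aemeasurable
      (μ := volume.restrict (Ioo 0 (exitTime Ω p.1 (v p.2))))
    have ig := integrable_toReal_of_lintegral_ne_top lg h0g.ne
    have iu := integrable_toReal_of_lintegral_ne_top lu h0u.ne
    have eg := integral_toReal lg (ae_lt_top' lg h0g.ne)
    have eu := integral_toReal lu (ae_lt_top' lu h0u.ne)
    simp only [Function.comp_apply] at ig iu eg eu
    refine ⟨ig.sub (iu.const_mul M), ?_⟩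
    rw [integral_sub ig (iu.const_mul M), integral_const_mul, eg, eu]
    linarith
  refine main.congr hΩ hv (ae_of_all _ fun _ => rfl) ?_ (ae_of_all _ fun _ => rfl)
  filter_upwards [hfin, hKfin, hD.q_eq, ae_phase_of_ae hD.k_eq, ae_phase_of_ae hD.m_eq,
    ae_phase_of_ae hco.bounds, ae_phase_of_ae (Measure.ae_ae_of_ae_prod hfin)]
    with p h1 h2 h3 h4 h5 h6 h7
  rw [hf.scatter_toReal hum p h7]
  simp only [hg, gainE]
  rw [h3.1, h4, h5, ENNReal.toReal_add ENNReal.ofReal_ne_top (ENNReal.add_ne_top.2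
    ⟨ENNReal.mul_ne_top ENNReal.ofReal_ne_top h1.ne,
      ENNReal.mul_ne_top ENNReal.ofReal_ne_top h2.ne⟩),
    ENNReal.toReal_add (ENNReal.mul_ne_top ENNReal.ofReal_ne_top h1.ne)
      (ENNReal.mul_ne_top ENNReal.ofReal_ne_top h2.ne), ENNReal.toReal_mul, ENNReal.toReal_mul,
    ENNReal.toReal_ofReal h3.2, ENNReal.toReal_ofReal (by linarith), ENNReal.toReal_ofReal h6.2.1]
  ring

theorem TransportData.Represents.eLpNorm_sol_le {D : TransportData d} {q b : Space d → Dir d → ℝ}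
    (hD : D.Represents Ω v M μa μs q b) (hΩ : ConvexDomain Ω)
    (hv : UnitField v) (hf : ScatteringKernel f) (hc : 0 < c) (hcM : c ≤ M)
    (hco : Coefficients Ω c M μa μs) :
    eLpNorm (D.sol Ω v f M) 2 (phaseMeasure Ω)
      ≤ ENNReal.ofReal (M / c) * (eLpNorm (D.inflow Ω v) 2 (phaseMeasure Ω)
        + ENNReal.ofReal M⁻¹ * eLpNorm D.q 2 (phaseMeasure Ω)) := by
  refine D.eLpNorm_sol_le hΩ hv hf hc hcM ?_
  filter_upwards [hD.k_eq, hD.m_eq, hco.bounds] with x h1 h2 h3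
  rw [h1, h2, ← ENNReal.ofReal_add (by linarith) h3.2.1]
  exact ENNReal.ofReal_le_ofReal (by linarith)

/-- Boundary data that are nonnegative, and square integrable when transported along lines. -/
def NonnegInflow (Ω : Set (Space d)) (v : Dir d → Space d) (b : Space d → Dir d → ℝ) : Prop :=
  ∃ b' : Space d × Dir d → ℝ≥0∞, Measurable b' ∧
    (∀ᵐ p ∂(phaseMeasure Ω), b' (entryPoint Ω p.1 (v p.2), p.2)
      = ENNReal.ofReal (b (entryPoint Ω p.1 (v p.2)) p.2) ∧
      0 ≤ b (entryPoint Ω p.1 (v p.2)) p.2) ∧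
    eLpNorm (fun p : Space d × Dir d => b' (entryPoint Ω p.1 (v p.2), p.2)) 2 (phaseMeasure Ω) < ∞

theorem nonnegInflow_zero : NonnegInflow Ω v (fun _ _ => 0) :=
  ⟨0, measurable_zero, by simp, by simp⟩

theorem exists_represents (hco : Coefficients Ω c M μa μs) {q b : Space d → Dir d → ℝ}
    (hq : PhaseL2 Ω q) (hq0 : ∀ᵐ p ∂(phaseMeasure Ω), 0 ≤ q p.1 p.2)
    {b' : Space d × Dir d → ℝ≥0∞} (hbm : Measurable b')
    (hb : ∀ᵐ p ∂(phaseMeasure Ω), b' (entryPoint Ω p.1 (v p.2), p.2)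
      = ENNReal.ofReal (b (entryPoint Ω p.1 (v p.2)) p.2) ∧
      0 ≤ b (entryPoint Ω p.1 (v p.2)) p.2) :
    ∃ D : TransportData d, D.b = b' ∧ eLpNorm D.q 2 (phaseMeasure Ω) = phaseNorm Ω q ∧
      D.Represents Ω v M μa μs q b := by
  have ha := hco.aemeasurable_a
  have hs := hco.aemeasurable_s
  have hq' := hq.1.aemeasurable
  have hqe : ∀ᵐ p ∂(phaseMeasure Ω), ENNReal.ofReal (hq'.mk _ p) = ENNReal.ofReal (q p.1 p.2) :=
    hq'.ae_eq_mk.mono fun p hp => by rw [← hp]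
  refine ⟨⟨fun x => ENNReal.ofReal (M - ha.mk _ x - hs.mk _ x), fun x => ENNReal.ofReal (hs.mk _ x),
    fun p => ENNReal.ofReal (hq'.mk _ p), b',
    ((measurable_const.sub ha.measurable_mk).sub hs.measurable_mk).ennreal_ofReal,
    hs.measurable_mk.ennreal_ofReal, hq'.measurable_mk.ennreal_ofReal, hbm⟩, rfl, ?_, ?_, ?_, ?_, hb⟩
  · rw [eLpNorm_congr_ae hqe]
    refine eLpNorm_congr_enorm_ae (hq0.mono fun p hp => ?_)
    rw [Real.enorm_of_nonneg hp, enorm_eq_self]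
  · filter_upwards [ha.ae_eq_mk, hs.ae_eq_mk] with x h1 h2
    simp only [← h1, ← h2]
  · filter_upwards [hs.ae_eq_mk] with x h2
    simp only [← h2]
  · filter_upwards [hqe, hq0] with p h1 h2
    exact ⟨h1, h2⟩

/-- Existence for nonnegative data. -/
theorem exists_solvesRTE_of_nonneg (hΩ : ConvexDomain Ω) (hv : UnitField v)
    (hf : ScatteringKernel f) (hc : 0 < c) (hcM : c ≤ M) (hco : Coefficients Ω c M μa μs)
    {q b : Space d → Dir d → ℝ} (hq : PhaseL2 Ω q)
    (hq0 : ∀ᵐ p ∂(phaseMeasure Ω), 0 ≤ q p.1 p.2) (hb : NonnegInflow Ω v b) :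
    ∃ D : TransportData d, D.Represents Ω v M μa μs q b ∧
      eLpNorm (D.sol Ω v f M) 2 (phaseMeasure Ω) < ∞ ∧
      SolvesRTE Ω f v μa μs q b (fun x θ => (D.sol Ω v f M (x, θ)).toReal) := by
  obtain ⟨b', hbm, hbe, hbN⟩ := hb
  obtain ⟨D, hDb, hDq, hD⟩ := exists_represents hco hq hq0 hbm hbe
  have hN : eLpNorm (D.sol Ω v f M) 2 (phaseMeasure Ω) < ∞ := by
    refine (hD.eLpNorm_sol_le hΩ hv hf hc hcM hco).trans_lt
      (ENNReal.mul_lt_top ENNReal.ofReal_lt_top (ENNReal.add_lt_top.2 ⟨?_,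
        ENNReal.mul_lt_top ENNReal.ofReal_lt_top (hDq ▸ hq.2)⟩))
    unfold TransportData.inflow
    rwa [hDb]
  exact ⟨D, hD, hN, hD.solvesRTE hΩ hv hf (hc.trans_le hcM) hco hN⟩

theorem exists_solvesRTE_of_nonneg_source (hΩ : ConvexDomain Ω) (hv : UnitField v)
    (hf : ScatteringKernel f) (hc : 0 < c) (hcM : c ≤ M) (hco : Coefficients Ω c M μa μs)
    {q : Space d → Dir d → ℝ} (hq : PhaseL2 Ω q)
    (hq0 : ∀ᵐ p ∂(phaseMeasure Ω), 0 ≤ q p.1 p.2) :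
    ∃ φ, SolvesRTE Ω f v μa μs q (fun _ _ => 0) φ ∧
      phaseNorm Ω φ ≤ ENNReal.ofReal c⁻¹ * phaseNorm Ω q := by
  have hM := hc.trans_le hcM
  obtain ⟨D, hDb, hDq, hD⟩ := exists_represents (v := v) (b := fun _ _ => 0) hco hq hq0
    measurable_zero (by simp)
  have hle := hD.eLpNorm_sol_le hΩ hv hf hc hcM hco
  have hin : D.inflow Ω v = 0 := by
    ext p
    simp [TransportData.inflow, hDb]
  rw [hin, eLpNorm_zero, zero_add, hDq, ← mul_assoc, ← ENNReal.ofReal_mul (by positivity),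
    show M / c * M⁻¹ = c⁻¹ by field_simp] at hle
  have hN := hle.trans_lt (ENNReal.mul_lt_top ENNReal.ofReal_lt_top hq.2)
  refine ⟨_, hD.solvesRTE hΩ hv hf hM hco hN, le_trans (eLpNorm_mono_enorm fun p => ?_) hle⟩
  rw [Real.enorm_of_nonneg ENNReal.toReal_nonneg, enorm_eq_self]
  exact ENNReal.ofReal_toReal_le

/-- Existence for an arbitrary source, with a bound. -/
theorem exists_solvesRTE_source (hΩ : ConvexDomain Ω) (hv : UnitField v)
    (hf : ScatteringKernel f) (hc : 0 < c) (hcM : c ≤ M) (hco : Coefficients Ω c M μa μs)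
    {q : Space d → Dir d → ℝ} (hq : PhaseL2 Ω q) :
    ∃ φ, SolvesRTE Ω f v μa μs q (fun _ _ => 0) φ ∧
      phaseNorm Ω φ ≤ ENNReal.ofReal (2 / c) * phaseNorm Ω q := by
  have part : ∀ s : ℝ, (s = 1 ∨ s = -1) → PhaseL2 Ω (fun x θ => max (s * q x θ) 0) ∧
      phaseNorm Ω (fun x θ => max (s * q x θ) 0) ≤ phaseNorm Ω q := by
    intro s hs
    have hm : AEStronglyMeasurable (fun p : Space d × Dir d => max (s * q p.1 p.2) 0)
        (phaseMeasure Ω) :=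
      ((hq.1.aemeasurable.const_mul s).max aemeasurable_const).aestronglyMeasurable
    have hle : phaseNorm Ω (fun x θ => max (s * q x θ) 0) ≤ phaseNorm Ω q := by
      refine eLpNorm_mono fun p => ?_
      rw [Real.norm_eq_abs, Real.norm_eq_abs, abs_of_nonneg (le_max_right _ _)]
      refine max_le ?_ (abs_nonneg _)
      rcases hs with rfl | rfl
      · rw [one_mul]; exact le_abs_self _
      · rw [neg_one_mul]; exact neg_le_abs _
    exact ⟨⟨hm, hle.trans_lt hq.2⟩, hle⟩
  obtain ⟨p1, n1⟩ := part 1 (Or.inl rfl)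
  obtain ⟨p2, n2⟩ := part (-1) (Or.inr rfl)
  obtain ⟨φ1, h1, b1⟩ := exists_solvesRTE_of_nonneg_source hΩ hv hf hc hcM hco p1
    (ae_of_all _ fun _ => le_max_right _ _)
  obtain ⟨φ2, h2, b2⟩ := exists_solvesRTE_of_nonneg_source hΩ hv hf hc hcM hco p2
    (ae_of_all _ fun _ => le_max_right _ _)
  refine ⟨_, (h1.sub hΩ hv hf h2).congr hΩ hv (ae_of_all _ fun p => ?_)
    (ae_of_all _ fun _ => sub_self _), ?_⟩
  · have : max (1 * q p.1 p.2) 0 - max (-1 * q p.1 p.2) 0 = q p.1 p.2 := by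
      rw [one_mul, neg_one_mul]
      exact posPart_sub_negPart (q p.1 p.2)
    simp only [this]
  · refine (eLpNorm_sub_le h1.1.1 h2.1.1 one_le_two).trans ?_
    calc _ ≤ ENNReal.ofReal c⁻¹ * phaseNorm Ω q + ENNReal.ofReal c⁻¹ * phaseNorm Ω q :=
          add_le_add (b1.trans (mul_le_mul_right n1 _)) (b2.trans (mul_le_mul_right n2 _))
      _ = _ := by
          rw [← add_mul, ← ENNReal.ofReal_add (by positivity) (by positivity)]
          congr 2
          ring

/-- Uniqueness. -/
theorem SolvesRTE.ae_eq (hΩ : ConvexDomain Ω) (hv : UnitField v) (hf : ScatteringKernel f)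
    (hc : 0 < c) (hcM : c ≤ M) (hco : Coefficients Ω c M μa μs) {q b φ φ' : Space d → Dir d → ℝ}
    (h : SolvesRTE Ω f v μa μs q b φ) (h' : SolvesRTE Ω f v μa μs q b φ') :
    ∀ᵐ p ∂(phaseMeasure Ω), φ p.1 p.2 = φ' p.1 p.2 := by
  have hw : SolvesRTE Ω f v μa μs (fun _ _ => 0) (fun _ _ => 0) (fun x θ => φ x θ - φ' x θ) :=
    (h.sub hΩ hv hf h').congr hΩ hv (ae_of_all _ fun p => by simp)
      (ae_of_all _ fun _ => sub_self _)
  have hwL : PhaseL2 Ω (fun x θ => φ x θ - φ' x θ) := hw.1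
  -- The backward problem is solved with the difference itself as source. Since the difference has
  -- zero source and zero inflow, duality gives that the integral of its square vanishes.
  obtain ⟨ψ, hψ, -⟩ := exists_solvesRTE_source hΩ hv.neg hf hc hcM hco hwL
  have key := SolvesRTE.integral_mul hΩ hv hf hco hc (q := fun _ _ => 0) MemLp.zero' hwL hw hψ
  simp only [zero_mul, integral_zero] at key
  rw [integral_eq_zero_iff_of_nonneg (fun p => mul_self_nonneg _) (hwL.integrable_mul hwL)] at key
  exact key.mono fun p hp => sub_eq_zero.1 (mul_self_eq_zero.1 hp)

/-- Uniqueness transfers the bound of the constructed solution to every solution. The factor two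
comes from treating the positive and negative parts of the source separately. -/
theorem SolvesRTE.phaseNorm_le (hΩ : ConvexDomain Ω) (hv : UnitField v) (hf : ScatteringKernel f)
    (hc : 0 < c) (hcM : c ≤ M) (hco : Coefficients Ω c M μa μs) {q φ : Space d → Dir d → ℝ}
    (hq : PhaseL2 Ω q) (h : SolvesRTE Ω f v μa μs q (fun _ _ => 0) φ) :
    phaseNorm Ω φ ≤ ENNReal.ofReal (2 / c) * phaseNorm Ω q := by
  obtain ⟨ψ, hψ, hb⟩ := exists_solvesRTE_source hΩ hv hf hc hcM hco hq
  rwa [phaseNorm, eLpNorm_congr_ae (h.ae_eq hΩ hv hf hc hcM hco hψ)]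

/-- A solution with nonnegative data is the minimal nonnegative solution. -/
theorem SolvesRTE.exists_ae_eq_sol (hΩ : ConvexDomain Ω) (hv : UnitField v)
    (hf : ScatteringKernel f) (hc : 0 < c) (hcM : c ≤ M) (hco : Coefficients Ω c M μa μs)
    {q b φ : Space d → Dir d → ℝ} (hq : PhaseL2 Ω q)
    (hq0 : ∀ᵐ p ∂(phaseMeasure Ω), 0 ≤ q p.1 p.2) (hb : NonnegInflow Ω v b)
    (h : SolvesRTE Ω f v μa μs q b φ) :
    ∃ D : TransportData d, D.Represents Ω v M μa μs q b ∧
      ∀ᵐ p ∂(phaseMeasure Ω), 0 ≤ φ p.1 p.2 ∧ ENNReal.ofReal (φ p.1 p.2) = D.sol Ω v f M p := by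
  obtain ⟨D, hD, hN, hs⟩ := exists_solvesRTE_of_nonneg hΩ hv hf hc hcM hco hq hq0 hb
  refine ⟨D, hD, ?_⟩
  filter_upwards [h.ae_eq hΩ hv hf hc hcM hco hs,
    ae_lt_top_of_eLpNorm (D.measurable_sol hΩ hv hf M) hN] with p h1 h2
  rw [h1]
  exact ⟨ENNReal.toReal_nonneg, ENNReal.ofReal_toReal h2.ne⟩

theorem SolvesRTE.nonneg (hΩ : ConvexDomain Ω) (hv : UnitField v)
    (hf : ScatteringKernel f) (hc : 0 < c) (hcM : c ≤ M) (hco : Coefficients Ω c M μa μs)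
    {q b φ : Space d → Dir d → ℝ} (hq : PhaseL2 Ω q)
    (hq0 : ∀ᵐ p ∂(phaseMeasure Ω), 0 ≤ q p.1 p.2) (hb : NonnegInflow Ω v b)
    (h : SolvesRTE Ω f v μa μs q b φ) : ∀ᵐ p ∂(phaseMeasure Ω), 0 ≤ φ p.1 p.2 := by
  obtain ⟨D, -, hD⟩ := h.exists_ae_eq_sol hΩ hv hf hc hcM hco hq hq0 hb
  exact hD.mono fun p hp => hp.1

/-- The minimal solution dominates its uncollided part, the inflow data times an exponential, which
is positive wherever the inflow data are. -/
theorem SolvesRTE.pos (hΩ : ConvexDomain Ω) (hv : UnitField v)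
    (hf : ScatteringKernel f) (hc : 0 < c) (hcM : c ≤ M) (hco : Coefficients Ω c M μa μs)
    {q b φ : Space d → Dir d → ℝ} (hq : PhaseL2 Ω q)
    (hq0 : ∀ᵐ p ∂(phaseMeasure Ω), 0 ≤ q p.1 p.2) (hb : NonnegInflow Ω v b)
    (h : SolvesRTE Ω f v μa μs q b φ)
    (hbpos : ∀ᵐ p ∂(phaseMeasure Ω), 0 < b (entryPoint Ω p.1 (v p.2)) p.2) :
    ∀ᵐ p ∂(phaseMeasure Ω), 0 < φ p.1 p.2 := by
  obtain ⟨D, hDr, hD⟩ := h.exists_ae_eq_sol hΩ hv hf hc hcM hco hq hq0 hb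
  filter_upwards [hD, hbpos, hDr.b_eq] with p hp hbp hbe
  rw [← ENNReal.ofReal_pos, hp.2, D.sol_eq hΩ hv hf M p]
  refine add_pos_of_pos_of_nonneg ?_ zero_le
  unfold TransportData.attenuated
  rw [hbe.1]
  exact ENNReal.mul_pos (by simpa using Real.exp_pos _) (by simpa using hbp)

/-- Cauchy-Schwarz for solutions of the radiative transfer equation with nonnegative data. -/
theorem SolvesRTE.sq_le_mul (hΩ : ConvexDomain Ω) (hv : UnitField v)
    (hf : ScatteringKernel f) (hc : 0 < c) (hcM : c ≤ M)
    {μa' μa'' : Space d → ℝ}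
    (hco : Coefficients Ω c M μa μs) (hco' : Coefficients Ω c M μa' μs)
    (hco'' : Coefficients Ω c M μa'' μs)
    {q b φ q' φ' q'' φ'' : Space d → Dir d → ℝ} (hb : NonnegInflow Ω v b)
    (hq : PhaseL2 Ω q) (hq0 : ∀ᵐ p ∂(phaseMeasure Ω), 0 ≤ q p.1 p.2)
    (hq' : PhaseL2 Ω q') (hq0' : ∀ᵐ p ∂(phaseMeasure Ω), 0 ≤ q' p.1 p.2)
    (hq'' : PhaseL2 Ω q'') (hq0'' : ∀ᵐ p ∂(phaseMeasure Ω), 0 ≤ q'' p.1 p.2)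
    (h : SolvesRTE Ω f v μa μs q b φ) (h' : SolvesRTE Ω f v μa' μs q' b φ')
    (h'' : SolvesRTE Ω f v μa'' μs q'' b φ'')
    (hk : ∀ᵐ x ∂(volume.restrict Ω), (M - μa x - μs x) ^ 2
      ≤ (M - μa' x - μs x) * (M - μa'' x - μs x))
    (hqq : ∀ᵐ p ∂(phaseMeasure Ω), q p.1 p.2 ^ 2 ≤ q' p.1 p.2 * q'' p.1 p.2) :
    ∀ᵐ p ∂(phaseMeasure Ω), φ p.1 p.2 ^ 2 ≤ φ' p.1 p.2 * φ'' p.1 p.2 := by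
  obtain ⟨D, hDr, hD⟩ := h.exists_ae_eq_sol hΩ hv hf hc hcM hco hq hq0 hb
  obtain ⟨D', hDr', hD'⟩ := h'.exists_ae_eq_sol hΩ hv hf hc hcM hco' hq' hq0' hb
  obtain ⟨D'', hDr'', hD''⟩ := h''.exists_ae_eq_sol hΩ hv hf hc hcM hco'' hq'' hq0'' hb
  have key := TransportData.sq_sol_le hΩ hv hf (M := M) (D := D) (D' := D') (D'' := D'') ?_ ?_ ?_ ?_
  · filter_upwards [key, hD, hD', hD''] with p h1 h2 h3 h4
    rw [← h2.2, ← h3.2, ← h4.2, ← ENNReal.ofReal_pow h2.1, ← ENNReal.ofReal_mul h3.1] at h1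
    exact (ENNReal.ofReal_le_ofReal_iff (mul_nonneg h3.1 h4.1)).1 h1
  · filter_upwards [hDr.k_eq, hDr'.k_eq, hDr''.k_eq, hk, hco.bounds, hco'.bounds]
      with x h1 h2 h3 h4 h5 h6
    rw [h1, h2, h3, ← ENNReal.ofReal_pow (by linarith), ← ENNReal.ofReal_mul (by linarith)]
    exact ENNReal.ofReal_le_ofReal h4
  · filter_upwards [hDr.m_eq, hDr'.m_eq, hDr''.m_eq] with x h1 h2 h3
    rw [h1, h2, h3, sq]
  · filter_upwards [hDr.q_eq, hDr'.q_eq, hDr''.q_eq, hqq] with p h1 h2 h3 h4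
    rw [h1.1, h2.1, h3.1, ← ENNReal.ofReal_pow h1.2, ← ENNReal.ofReal_mul h2.2]
    exact ENNReal.ofReal_le_ofReal h4
  · filter_upwards [hDr.b_eq, hDr'.b_eq, hDr''.b_eq] with p h1 h2 h3
    rw [h1.1, h2.1, h3.1, sq]

end FPAT
end

noncomputable section

namespace FPAT

open scoped ENNReal

/-! ### The derivative of a logarithmic misfit -/

section LogMisfit

variable {α : Type*} [MeasurableSpace α] {ν : Measure α}

theorem lintegral_enorm_mul_le {a b : α → ℝ} (ha : AEStronglyMeasurable a ν)
    (hb : AEStronglyMeasurable b ν) :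
    ∫⁻ x, ‖a x * b x‖ₑ ∂ν ≤ eLpNorm a 2 ν * eLpNorm b 2 ν := by
  rw [← ENNReal.pow_le_pow_left_iff two_ne_zero, mul_pow, eLpNorm_two_sq, eLpNorm_two_sq]
  refine sq_lintegral_le (ha.enorm.pow_const 2) (hb.enorm.pow_const 2) (ae_of_all _ fun x => ?_)
  rw [enorm_mul, mul_pow]

theorem enorm_integral_mul_le {a b : α → ℝ} (ha : AEStronglyMeasurable a ν)
    (hb : AEStronglyMeasurable b ν) :
    ‖∫ x, a x * b x ∂ν‖ₑ ≤ eLpNorm a 2 ν * eLpNorm b 2 ν :=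
  (enorm_integral_le_lintegral_enorm _).trans (lintegral_enorm_mul_le ha hb)

/-- Dominated convergence along an arbitrary filter, from convergence of `m` in `L¹` alone. Split
`g` at a height `K`: the excess over `K` has small integral and meets a factor at most one, while
the rest contributes at most `K` times the integral of `m`. -/
theorem tendsto_lintegral_mul_min {ι : Type*} {l : Filter ι} {g : α → ℝ≥0∞}
    (hg : AEMeasurable g ν) (hgi : ∫⁻ x, g x ∂ν ≠ ∞) {m : ι → α → ℝ≥0∞}
    (hm : Tendsto (fun i => ∫⁻ x, m i x ∂ν) l (𝓝 0)) :
    Tendsto (fun i => ∫⁻ x, g x * min 1 (m i x) ∂ν) l (𝓝 0) := by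
  have h1 : Tendsto (fun K : ℕ => ∫⁻ x, (g x - K) ∂ν) atTop (𝓝 0) := by
    have := tendsto_lintegral_of_dominated_convergence' (μ := ν) (F := fun (K : ℕ) x => g x - K)
      (f := fun _ => 0) g (fun K => hg.sub_const _) (fun K => ae_of_all _ fun x => tsub_le_self)
      hgi ((ae_lt_top' hg hgi).mono fun x hx => ?_)
    · simpa using this
    · obtain ⟨N, hN⟩ := ENNReal.exists_nat_gt hx.ne
      refine tendsto_const_nhds.congr' ?_
      filter_upwards [eventually_ge_atTop N] with K hK
      exact (tsub_eq_zero_of_le (hN.le.trans (by exact_mod_cast hK))).symm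
  rw [ENNReal.tendsto_nhds_zero] at h1 ⊢
  intro ε hε
  have hε2 : 0 < ε / 2 := ENNReal.half_pos hε.ne'
  obtain ⟨K, hK⟩ := (h1 _ hε2).exists
  have h2 : Tendsto (fun i => (K : ℝ≥0∞) * ∫⁻ x, m i x ∂ν) l (𝓝 0) := by
    have := ENNReal.Tendsto.const_mul (a := (K : ℝ≥0∞)) hm (Or.inr (ENNReal.natCast_ne_top K))
    simpa using this
  rw [ENNReal.tendsto_nhds_zero] at h2
  filter_upwards [h2 _ hε2] with i hi
  calc ∫⁻ x, g x * min 1 (m i x) ∂ν ≤ ∫⁻ x, ((g x - K) + K * m i x) ∂ν := by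
        refine lintegral_mono fun x => ?_
        calc g x * min 1 (m i x) ≤ ((g x - K) + K) * min 1 (m i x) :=
              mul_le_mul_left le_tsub_add _
          _ = (g x - K) * min 1 (m i x) + K * min 1 (m i x) := add_mul _ _ _
          _ ≤ _ := add_le_add (mul_le_of_le_one_right' (min_le_left _ _))
              (mul_le_mul_right (min_le_right _ _) _)
    _ = ∫⁻ x, (g x - K) ∂ν + K * ∫⁻ x, m i x ∂ν := by
        rw [lintegral_add_left' (hg.sub_const _), lintegral_const_mul' _ _ (ENNReal.natCast_ne_top K)]
    _ ≤ ε / 2 + ε / 2 := add_le_add hK hi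
    _ = ε := ENNReal.add_halves ε

/-- The two hypotheses bound both `t = H / h` and `t⁻¹` by `1 + m`, hence `|log t| ≤ log (1 + m)`.
For `m ≤ 1` the bounds are quadratic Taylor estimates; for `m ≥ 1` only linear growth in `m` is
claimed. The combination `m min(1, m)` keeps both, since `m` is merely small in `L¹`. -/
theorem sq_log_div_le {h H m : ℝ} (hh : 0 < h) (hH : 0 < H) (hm : 0 ≤ m)
    (h1 : |H - h| ≤ m * h) (h2 : h ^ 2 ≤ H * (h + m * h)) :
    (Real.log H - Real.log h) ^ 2 ≤ 4 * (m * min 1 m) ∧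
      |Real.log H - Real.log h - (H - h) / h| ≤ 2 * (m * min 1 m) := by
  have hy : (H - h) / h = H / h - 1 := by rw [sub_div, div_self hh.ne']
  set t := H / h with ht
  have htp : 0 < t := div_pos hH hh
  have hHt : H = t * h := by rw [ht, div_mul_cancel₀ _ hh.ne']
  have hL : Real.log H - Real.log h = Real.log t := (Real.log_div hH.ne' hh.ne').symm
  rw [hL, hy]
  have h1' : |t - 1| ≤ m := by
    rw [hHt, show t * h - h = (t - 1) * h by ring, abs_mul, abs_of_pos hh] at h1
    exact le_of_mul_le_mul_right h1 hh
  have h2' : 1 ≤ t * (1 + m) := by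
    rw [hHt] at h2
    have : 1 * h ^ 2 ≤ (t * (1 + m)) * h ^ 2 := by linarith
    exact le_of_mul_le_mul_right this (by positivity)
  have hup : Real.log t ≤ t - 1 := Real.log_le_sub_one_of_pos htp
  have hlo : 1 - t⁻¹ ≤ Real.log t := Real.one_sub_inv_le_log_of_pos htp
  have hti : t⁻¹ ≤ 1 + m := by rw [inv_le_iff_one_le_mul₀' htp]; exact h2'
  have habs : |Real.log t| ≤ Real.log (1 + m) := by
    rw [abs_le]
    refine ⟨?_, Real.log_le_log htp (by linarith [(abs_le.1 h1').2])⟩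
    rw [neg_le, ← Real.log_inv]
    exact Real.log_le_log (inv_pos.2 htp) hti
  have hlm : Real.log (1 + m) ≤ m := by
    have := Real.log_le_sub_one_of_pos (show 0 < 1 + m by linarith)
    linarith
  have hl0 : 0 ≤ Real.log (1 + m) := Real.log_nonneg (by linarith)
  -- With `w = √(1 + m)` one has `log (1 + m) = 2 log w ≤ 2 (w - 1)`, and `(w - 1)² ≤ w² - 1 = m`.
  have hsq : Real.log (1 + m) ^ 2 ≤ 4 * m := by
    have hs := Real.sq_sqrt (show 0 ≤ 1 + m by linarith)
    set w := Real.sqrt (1 + m) with hw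
    have hw1 : 1 ≤ w := Real.one_le_sqrt.2 (by linarith)
    have : Real.log (1 + m) ≤ 2 * (w - 1) := by
      rw [← hs, Real.log_pow]
      have := Real.log_le_sub_one_of_pos (show 0 < w by linarith)
      push_cast
      linarith
    nlinarith
  have hLsq : Real.log t ^ 2 ≤ Real.log (1 + m) ^ 2 := by
    rw [← sq_abs (Real.log t)]
    exact pow_le_pow_left₀ (abs_nonneg _) habs 2
  rcases le_total m 1 with hm1 | hm1
  · rw [min_eq_right hm1]
    refine ⟨by nlinarith, ?_⟩
    rw [abs_le]
    have hkey : t - 1 - (1 - t⁻¹) = (t - 1) ^ 2 * t⁻¹ := by field_simp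
    have hsq1 : (t - 1) ^ 2 ≤ m ^ 2 := by
      rw [← sq_abs]; exact pow_le_pow_left₀ (abs_nonneg _) h1' 2
    have hb : (t - 1) ^ 2 * t⁻¹ ≤ m ^ 2 * 2 :=
      mul_le_mul hsq1 (hti.trans (by linarith)) (inv_pos.2 htp).le (sq_nonneg _)
    constructor <;> nlinarith
  · rw [min_eq_left hm1, mul_one]
    refine ⟨hLsq.trans hsq, ?_⟩
    calc |Real.log t - (t - 1)| ≤ |Real.log t| + |t - 1| := abs_sub _ _
      _ ≤ 2 * m := by linarith

variable {h r : α → ℝ} {H G : ℝ → α → ℝ} {C : ℝ} {δ : ℝ}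

/-- First order expansion of `½ ∫ (r + log H_s - log h) ^ 2` as `s ↓ 0`, if
`|H_s - h| ≤ s G_s` and `h ^ 2 ≤ H_s (h + s G_s)` with `G_s` bounded in `L²`. -/
theorem tendsto_log_misfit (hpos : ∀ᵐ x ∂ν, 0 < h x) (hr : MemLp r 2 ν)
    (hinv : MemLp (fun x => 1 / h x) 2 ν) (hsrc : MemLp (fun x => 1 / h x * r x) 2 ν) (hδ : 0 < δ)
    (hHm : ∀ s, 0 < s → s < δ → AEStronglyMeasurable (H s) ν)
    (hHpos : ∀ s, 0 < s → s < δ → ∀ᵐ x ∂ν, 0 < H s x)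
    (hG : ∀ s, 0 < s → s < δ → AEStronglyMeasurable (G s) ν)
    (hGC : ∀ s, 0 < s → s < δ → eLpNorm (G s) 2 ν ≤ ENNReal.ofReal C)
    (hHG : ∀ s, 0 < s → s < δ → ∀ᵐ x ∂ν, |H s x - h x| ≤ s * G s x)
    (hHsq : ∀ s, 0 < s → s < δ → ∀ᵐ x ∂ν, h x ^ 2 ≤ H s x * (h x + s * G s x)) :
    (∀ᶠ s in 𝓝[>] (0 : ℝ), MemLp (fun x => r x + (Real.log (H s x) - Real.log (h x))) 2 ν) ∧
    Tendsto (fun s => (1 / 2 * ∫ x, (r x + (Real.log (H s x) - Real.log (h x))) ^ 2 ∂ν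
        - 1 / 2 * ∫ x, r x ^ 2 ∂ν) / s - ∫ x, 1 / h x * r x * ((H s x - h x) / s) ∂ν)
      (𝓝[>] 0) (𝓝 0) := by
  have hev : ∀ᶠ s in 𝓝[>] (0 : ℝ), 0 < s ∧ s < δ := by
    filter_upwards [Ioo_mem_nhdsGT hδ] with s hs using hs
  have hhm : AEMeasurable h ν := by
    refine hinv.1.aemeasurable.inv.congr (ae_of_all _ fun x => ?_)
    simp
  -- The two summands belong to the two remainder terms: the linearization error of the logarithm
  -- multiplied by `r`, and half the square of the increment. Each is bounded by `m min(1, m)`, and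
  -- dividing by `s` turns the first factor `m` into `G / h`.
  set w : α → ℝ := fun x => 2 * |1 / h x * r x| + 2 * (1 / h x) with hw
  have hwL : MemLp w 2 ν := (hsrc.abs.const_mul 2).add (hinv.const_mul 2)
  set m : ℝ → α → ℝ := fun s x => s * (1 / h x * G s x) with hm
  have hGL : ∀ s, 0 < s → s < δ → MemLp (G s) 2 ν := fun s h0 h1 =>
    ⟨hG s h0 h1, (hGC s h0 h1).trans_lt ENNReal.ofReal_lt_top⟩
  have hmi : ∀ s, 0 < s → s < δ → Integrable (m s) ν := fun s h0 h1 =>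
    (MemLp.integrable_mul hinv (hGL s h0 h1)).const_mul s
  have hpt : ∀ s, 0 < s → s < δ → ∀ᵐ x ∂ν, 0 ≤ m s x ∧
      (Real.log (H s x) - Real.log (h x)) ^ 2 ≤ 4 * (m s x * min 1 (m s x)) ∧
      |Real.log (H s x) - Real.log (h x) - (H s x - h x) / h x| ≤ 2 * (m s x * min 1 (m s x)) := by
    intro s h0 h1
    filter_upwards [hpos, hHpos s h0 h1, hHG s h0 h1, hHsq s h0 h1] with x a1 a2 a3 a4
    have e : m s x * h x = s * G s x := by
      simp only [hm]; field_simp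
    have a0 : 0 ≤ m s x := by
      have : 0 ≤ m s x * h x := by rw [e]; exact (abs_nonneg _).trans a3
      exact nonneg_of_mul_nonneg_left this a1
    exact ⟨a0, sq_log_div_le a1 a2 a0 (by rw [e]; exact a3) (by rw [e]; exact a4)⟩
  have hLm : ∀ s, 0 < s → s < δ →
      AEStronglyMeasurable (fun x => Real.log (H s x) - Real.log (h x)) ν := fun s h0 h1 =>
    (((hHm s h0 h1).aemeasurable.log).sub hhm.log).aestronglyMeasurable
  have hL : ∀ s, 0 < s → s < δ →
      MemLp (fun x => Real.log (H s x) - Real.log (h x)) 2 ν := by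
    intro s h0 h1
    rw [memLp_two_iff_integrable_sq (hLm s h0 h1)]
    refine ((hmi s h0 h1).const_mul 4).mono' ((hLm s h0 h1).pow 2) ?_
    filter_upwards [hpt s h0 h1] with x hx
    rw [Real.norm_of_nonneg (sq_nonneg _)]
    refine hx.2.1.trans ?_
    have := mul_le_of_le_one_right hx.1 (min_le_left 1 (m s x))
    linarith
  refine ⟨hev.mono fun s hs => hr.add (hL s hs.1 hs.2), ?_⟩
  -- the remainder
  have hrem : ∀ s, 0 < s → s < δ →
      ‖(1 / 2 * ∫ x, (r x + (Real.log (H s x) - Real.log (h x))) ^ 2 ∂ν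
        - 1 / 2 * ∫ x, r x ^ 2 ∂ν) / s - ∫ x, 1 / h x * r x * ((H s x - h x) / s) ∂ν‖ₑ
      ≤ eLpNorm (fun x => w x * min 1 (m s x)) 2 ν * ENNReal.ofReal C := by
    intro s h0 h1
    have i1 : Integrable (fun x => (r x + (Real.log (H s x) - Real.log (h x))) ^ 2) ν :=
      (hr.add (hL s h0 h1)).integrable_sq
    have i2 : Integrable (fun x => r x ^ 2) ν := hr.integrable_sq
    have hQ : MemLp (fun x => (H s x - h x) / s) 2 ν := by
      refine (hGL s h0 h1).mono (((hHm s h0 h1).sub hhm.aestronglyMeasurable).div₀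
        aestronglyMeasurable_const) ((hHG s h0 h1).mono fun x hx => ?_)
      rw [Real.norm_eq_abs, Real.norm_eq_abs, abs_div, abs_of_pos h0, div_le_iff₀ h0, mul_comm]
      exact hx.trans (mul_le_mul_of_nonneg_left (le_abs_self _) h0.le)
    have i3 : Integrable (fun x => 1 / h x * r x * ((H s x - h x) / s)) ν :=
      MemLp.integrable_mul hsrc hQ
    have e : (1 / 2 * ∫ x, (r x + (Real.log (H s x) - Real.log (h x))) ^ 2 ∂ν
        - 1 / 2 * ∫ x, r x ^ 2 ∂ν) / s - ∫ x, 1 / h x * r x * ((H s x - h x) / s) ∂ν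
        = ∫ x, ((1 / 2 * (r x + (Real.log (H s x) - Real.log (h x))) ^ 2 - 1 / 2 * r x ^ 2) / s
          - 1 / h x * r x * ((H s x - h x) / s)) ∂ν := by
      have i12 : Integrable (fun x => (1 / 2 * (r x + (Real.log (H s x) - Real.log (h x))) ^ 2
          - 1 / 2 * r x ^ 2) / s) ν := ((i1.const_mul _).sub (i2.const_mul _)).div_const s
      rw [integral_sub i12 i3, integral_div, integral_sub (i1.const_mul _) (i2.const_mul _),
        integral_const_mul, integral_const_mul]
    rw [e]
    refine (enorm_integral_le_lintegral_enorm _).trans ?_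
    have hmm : AEStronglyMeasurable (fun x => w x * min 1 (m s x)) ν :=
      hwL.1.mul ((aemeasurable_const.min (hmi s h0 h1).1.aemeasurable).aestronglyMeasurable)
    refine le_trans (lintegral_mono_ae ?_) ((lintegral_enorm_mul_le hmm (hG s h0 h1)).trans
      (mul_le_mul_right (hGC s h0 h1) _))
    filter_upwards [hpt s h0 h1, hpos] with x hx hhx
    rw [enorm_le_iff_norm_le, Real.norm_eq_abs, Real.norm_eq_abs]
    refine le_trans ?_ (le_abs_self _)
    set L := Real.log (H s x) - Real.log (h x)
    set μ := m s x * min 1 (m s x) with hμ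
    have e1 : (1 / 2 * (r x + L) ^ 2 - 1 / 2 * r x ^ 2) / s - 1 / h x * r x * ((H s x - h x) / s)
        = (r x * (L - (H s x - h x) / h x) + L ^ 2 / 2) / s := by
      field_simp; ring
    have e2 : w x * min 1 (m s x) * G s x = (|r x| * (2 * μ) + 2 * μ) / s := by
      simp only [hw, hμ]
      rw [abs_mul, abs_of_pos (show 0 < 1 / h x by positivity)]
      have : m s x = s * (1 / h x * G s x) := rfl
      generalize min 1 (m s x) = k
      rw [this]
      field_simp
    rw [e1, e2, abs_div, abs_of_pos h0]
    refine div_le_div_of_nonneg_right ?_ h0.le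
    refine (abs_add_le _ _).trans (add_le_add ?_ ?_)
    · rw [abs_mul]
      exact mul_le_mul_of_nonneg_left hx.2.2 (abs_nonneg _)
    · rw [abs_of_nonneg (by positivity)]
      linarith [hx.2.1]
  have hmt : Tendsto (fun s => ∫⁻ x, ‖m s x‖ₑ ∂ν) (𝓝[>] 0) (𝓝 0) := by
    have hb : Tendsto (fun s : ℝ => ENNReal.ofReal s * (eLpNorm (fun x => 1 / h x) 2 ν
        * ENNReal.ofReal C)) (𝓝[>] 0) (𝓝 0) := by
      have h1 : Tendsto (fun s : ℝ => ENNReal.ofReal s) (𝓝[>] 0) (𝓝 0) := by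
        have := (ENNReal.continuous_ofReal.tendsto 0).mono_left (nhdsWithin_le_nhds (s := Ioi 0))
        simpa using this
      have := ENNReal.Tendsto.mul_const h1 (b := eLpNorm (fun x => 1 / h x) 2 ν
        * ENNReal.ofReal C) (Or.inr (ENNReal.mul_ne_top hinv.2.ne ENNReal.ofReal_ne_top))
      simpa using this
    refine tendsto_of_tendsto_of_tendsto_of_le_of_le' tendsto_const_nhds hb
      (Eventually.of_forall fun _ => zero_le) (hev.mono fun s hs => ?_)
    simp only [hm]
    simp_rw [enorm_mul s]
    rw [lintegral_const_mul' _ _ (by simp), Real.enorm_of_nonneg hs.1.le]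
    refine mul_le_mul_right ?_ _
    exact (lintegral_enorm_mul_le hinv.1 (hG s hs.1 hs.2)).trans
      (mul_le_mul_right (hGC s hs.1 hs.2) _)
  have hwi : ∫⁻ x, ‖w x‖ₑ ^ 2 ∂ν ≠ ∞ := by
    rw [← eLpNorm_two_sq]; exact (ENNReal.pow_lt_top hwL.2).ne
  have hlim := tendsto_lintegral_mul_min (hwL.1.enorm.pow_const 2) hwi hmt
  have hlim2 : Tendsto (fun s => eLpNorm (fun x => w x * min 1 (m s x)) 2 ν) (𝓝[>] 0) (𝓝 0) := by
    have hle : ∀ᶠ s in 𝓝[>] (0 : ℝ), eLpNorm (fun x => w x * min 1 (m s x)) 2 ν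
        ≤ (∫⁻ x, ‖w x‖ₑ ^ 2 * min 1 ‖m s x‖ₑ ∂ν) ^ (1 / 2 : ℝ) := by
      filter_upwards [hev] with s hs
      have : eLpNorm (fun x => w x * min 1 (m s x)) 2 ν ^ 2
          ≤ ∫⁻ x, ‖w x‖ₑ ^ 2 * min 1 ‖m s x‖ₑ ∂ν := by
        rw [eLpNorm_two_sq]
        refine lintegral_mono_ae ((hpt s hs.1 hs.2).mono fun x hx => ?_)
        rw [enorm_mul, mul_pow]
        refine mul_le_mul_right ?_ _
        have h0 : 0 ≤ min 1 (m s x) := le_min zero_le_one hx.1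
        have h1 : ‖min 1 (m s x)‖ₑ = min 1 ‖m s x‖ₑ := by
          rw [Real.enorm_of_nonneg h0, Real.enorm_of_nonneg hx.1, ENNReal.ofReal_min,
            ENNReal.ofReal_one]
        rw [h1, sq]
        exact mul_le_of_le_one_left' (min_le_left _ _)
      have h2 := ENNReal.rpow_le_rpow this (z := 1 / 2) (by norm_num)
      rwa [← ENNReal.rpow_natCast, ← ENNReal.rpow_mul, Nat.cast_two, mul_one_div_cancel two_ne_zero,
        ENNReal.rpow_one] at h2
    have h0 : Tendsto (fun s => (∫⁻ x, ‖w x‖ₑ ^ 2 * min 1 ‖m s x‖ₑ ∂ν) ^ (1 / 2 : ℝ))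
        (𝓝[>] 0) (𝓝 0) := by
      have := hlim.ennrpow_const (1 / 2)
      rwa [ENNReal.zero_rpow_of_pos (by norm_num)] at this
    exact tendsto_of_tendsto_of_tendsto_of_le_of_le' tendsto_const_nhds h0
      (Eventually.of_forall fun _ => zero_le) hle
  rw [tendsto_zero_iff_enorm_tendsto_zero]
  have h3 := ENNReal.Tendsto.mul_const hlim2 (b := ENNReal.ofReal C) (Or.inr ENNReal.ofReal_ne_top)
  rw [zero_mul] at h3
  exact tendsto_of_tendsto_of_tendsto_of_le_of_le' tendsto_const_nhds h3
    (Eventually.of_forall fun _ => zero_le) (hev.mono fun s hs => hrem s hs.1 hs.2)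

end LogMisfit

end FPAT
end

noncomputable section

namespace FPAT

open scoped ENNReal

variable {d : ℕ} {Ω : Set (Space d)} {v : Dir d → Space d} {f : Dir d → Dir d → ℝ}
  {μa μs : Space d → ℝ} {M c : ℝ}

/-! ### Angular averages of square integrable functions -/

theorem PhaseL2.ae_integrable {φ : Space d → Dir d → ℝ} (hφ : PhaseL2 Ω φ) :
    ∀ᵐ x ∂(volume.restrict Ω), Integrable (φ x) (sphereMeasure d) :=
  hφ.ae_memLp.mono fun _ hx => hx.integrable one_le_two

/-- The square root of the area of the unit sphere. -/
def sphereRoot (d : ℕ) : ℝ≥0∞ := sphereMeasure d univ ^ (1 / 2 : ℝ)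

theorem sphereRoot_sq : sphereRoot d ^ 2 = sphereMeasure d univ := by
  rw [sphereRoot, ← ENNReal.rpow_natCast, ← ENNReal.rpow_mul]
  norm_num

theorem sphereRoot_ne_top : sphereRoot d ≠ ∞ :=
  ENNReal.rpow_ne_top_of_nonneg (by norm_num) (measure_ne_top _ _)

theorem eLpNorm_collect_le {φ : Space d → Dir d → ℝ} (hφ : PhaseL2 Ω φ) :
    eLpNorm (collect φ) 2 (volume.restrict Ω) ≤ sphereRoot d * phaseNorm Ω φ := by
  rw [← ENNReal.pow_le_pow_left_iff two_ne_zero, mul_pow, sphereRoot_sq, eLpNorm_two_sq,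
    eLpNorm_two_sq, phaseMeasure, lintegral_prod _ (hφ.1.enorm.pow_const 2),
    ← lintegral_const_mul' _ _ (measure_ne_top _ _)]
  refine lintegral_mono_ae (hφ.ae_memLp.mono fun x hx => ?_)
  refine (pow_le_pow_left' (enorm_integral_le_lintegral_enorm _) 2).trans ?_
  have := sq_lintegral_le (ν := sphereMeasure d) (a := fun θ => ‖φ x θ‖ₑ) (b := fun _ => 1)
    (c := fun θ => ‖φ x θ‖ₑ ^ 2) aemeasurable_const (hx.1.enorm.pow_const 2)
    (ae_of_all _ fun θ => by rw [one_mul])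
  simpa using this

theorem PhaseL2.collect_memLp {φ : Space d → Dir d → ℝ} (hφ : PhaseL2 Ω φ) :
    MemLp (collect φ) 2 (volume.restrict Ω) :=
  ⟨AEStronglyMeasurable.integral_prod_right' hφ.1, (eLpNorm_collect_le hφ).trans_lt
    (ENNReal.mul_lt_top (lt_top_iff_ne_top.2 sphereRoot_ne_top) hφ.2)⟩

theorem phaseNorm_lift_le {a : Space d → ℝ} (ha : MemLp a 2 (volume.restrict Ω)) :
    phaseNorm Ω (fun x _ => a x) ≤ sphereRoot d * eLpNorm a 2 (volume.restrict Ω) := by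
  rw [← ENNReal.pow_le_pow_left_iff two_ne_zero, mul_pow, sphereRoot_sq, eLpNorm_two_sq,
    eLpNorm_two_sq, phaseMeasure, lintegral_prod _
    ((aestronglyMeasurable_phase ha.1.aemeasurable).enorm.pow_const 2),
    ← lintegral_const_mul' _ _ (measure_ne_top _ _)]
  refine lintegral_mono fun x => ?_
  simp [mul_comm]

theorem phaseL2_lift {a : Space d → ℝ} (ha : MemLp a 2 (volume.restrict Ω)) :
    PhaseL2 Ω (fun x _ => a x) :=
  ⟨aestronglyMeasurable_phase ha.1.aemeasurable, (phaseNorm_lift_le ha).trans_lt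
    (ENNReal.mul_lt_top (lt_top_iff_ne_top.2 sphereRoot_ne_top) ha.2)⟩

theorem average_eq (φ : Space d → Dir d → ℝ) (x : Space d) :
    average φ x = ((sphereMeasure d).real univ)⁻¹ * collect φ x := rfl

theorem PhaseL2.average_memLp {φ : Space d → Dir d → ℝ} (hφ : PhaseL2 Ω φ) :
    MemLp (average φ) 2 (volume.restrict Ω) :=
  hφ.collect_memLp.const_mul _

/-- A bound for the operator `A^* Ã` on `L²(X)`. -/
def averageBound (d : ℕ) : ℝ≥0∞ :=
  sphereRoot d * (‖((sphereMeasure d).real univ)⁻¹‖ₑ * sphereRoot d)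

theorem averageBound_ne_top : averageBound d ≠ ∞ :=
  ENNReal.mul_ne_top sphereRoot_ne_top (ENNReal.mul_ne_top enorm_ne_top sphereRoot_ne_top)

theorem phaseNorm_average_le {φ : Space d → Dir d → ℝ} (hφ : PhaseL2 Ω φ) :
    phaseNorm Ω (fun x _ => average φ x) ≤ averageBound d * phaseNorm Ω φ := by
  refine (phaseNorm_lift_le hφ.average_memLp).trans ?_
  rw [averageBound, mul_assoc, mul_assoc]
  refine mul_le_mul_right ?_ _
  exact (eLpNorm_const_smul_le (c := ((sphereMeasure d).real univ)⁻¹) (f := collect φ)).trans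
    (mul_le_mul_right (eLpNorm_collect_le hφ) _)

theorem collect_sub {φ ψ : Space d → Dir d → ℝ} (hφ : PhaseL2 Ω φ) (hψ : PhaseL2 Ω ψ) :
    ∀ᵐ x ∂(volume.restrict Ω),
      collect (fun x θ => φ x θ - ψ x θ) x = collect φ x - collect ψ x := by
  filter_upwards [hφ.ae_integrable, hψ.ae_integrable] with x h1 h2
  exact integral_sub h1 h2

theorem average_sub {φ ψ : Space d → Dir d → ℝ} (hφ : PhaseL2 Ω φ) (hψ : PhaseL2 Ω ψ) :
    ∀ᵐ x ∂(volume.restrict Ω),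
      average (fun x θ => φ x θ - ψ x θ) x = average φ x - average ψ x :=
  (collect_sub hφ hψ).mono fun x hx => by rw [average_eq, hx, mul_sub]; rfl

theorem integral_mul_collect {a : Space d → ℝ} {φ : Space d → Dir d → ℝ}
    (h : Integrable (fun p : Space d × Dir d => a p.1 * φ p.1 p.2) (phaseMeasure Ω)) :
    ∫ p, a p.1 * φ p.1 p.2 ∂(phaseMeasure Ω) = ∫ x in Ω, a x * collect φ x := by
  rw [integral_phaseMeasure h]
  simp_rw [integral_const_mul]
  rfl

theorem memLp_coeff_mul {a u : Space d → ℝ} {C : ℝ} (hu : MemLp u 2 (volume.restrict Ω))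
    (ha : AEMeasurable a (volume.restrict Ω)) (hC : ∀ᵐ x ∂(volume.restrict Ω), |a x| ≤ C) :
    MemLp (fun x => a x * u x) 2 (volume.restrict Ω) :=
  hu.of_le_mul (c := C) (ha.aestronglyMeasurable.mul hu.1) (hC.mono fun x hx => by
    rw [norm_mul]; exact mul_le_mul_of_nonneg_right hx (norm_nonneg _))

theorem eLpNorm_coeff_mul_le {a u : Space d → ℝ} {C : ℝ}
    (hC : ∀ᵐ x ∂(volume.restrict Ω), |a x| ≤ C) :
    eLpNorm (fun x => a x * u x) 2 (volume.restrict Ω)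
      ≤ ENNReal.ofReal C * eLpNorm u 2 (volume.restrict Ω) := by
  refine eLpNorm_le_mul_eLpNorm_of_ae_le_mul (hC.mono fun x hx => ?_) 2
  rw [norm_mul]
  exact mul_le_mul_of_nonneg_right hx (norm_nonneg _)

/-! ### The boundary source -/

theorem ConvexDomain.measurable_inv_chordLength (hΩ : ConvexDomain Ω) :
    Measurable fun p : Space d × Dir d =>
      ENNReal.ofReal (chordLength Ω p.1 (p.2 : Space d))⁻¹ := by
  have h1 := hΩ.measurable_exitTime (unitField_forwardDir (d := d))
  have h2 := hΩ.measurable_exitTime (unitField_forwardDir (d := d)).neg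
  simp only [forwardDir] at h1 h2
  have h3 : Measurable fun p : Space d × Dir d => chordLength Ω p.1 (p.2 : Space d) := h1.add h2
  exact (measurable_inv.comp h3).ennreal_ofReal

theorem ConvexDomain.chordLength_mem (hΩ : ConvexDomain Ω) {x : Space d} (hx : x ∈ Ω)
    (θ : Dir d) : 0 < chordLength Ω x θ ∧ chordLength Ω x θ ≤ 2 * Metric.diam Ω := by
  have hn : ‖(θ : Space d)‖ = 1 := unitField_forwardDir.norm_eq θ
  have hn' : ‖-(θ : Space d)‖ = 1 := by rw [norm_neg, hn]
  have a1 := hΩ.exitTime_pos hx hn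
  have a2 := hΩ.exitTime_pos hx hn'
  have b1 := hΩ.exitTime_le_diam hx hn
  have b2 := hΩ.exitTime_le_diam hx hn'
  unfold chordLength
  constructor <;> linarith

/-- The density, the inverse chord length, is positive on `Ω`, so the inflow measure has no more
null sets than the image of the phase measure. -/
theorem ConvexDomain.ae_entry_of_ae_inflow (hΩ : ConvexDomain Ω) {P : Space d × Dir d → Prop}
    (h : ∀ᵐ p ∂(inflowMeasure Ω), P p) :
    ∀ᵐ p ∂(phaseMeasure Ω), P (entryPoint Ω p.1 (forwardDir p.2), p.2) := by
  have hE : Measurable fun p : Space d × Dir d => (entryPoint Ω p.1 (p.2 : Space d), p.2) :=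
    hΩ.measurable_entryPoint unitField_forwardDir
  have h1 := ae_of_ae_map hE.aemeasurable h
  rw [ae_withDensity_iff hΩ.measurable_inv_chordLength] at h1
  filter_upwards [h1, hΩ.ae_mem] with p hp hpΩ
  refine hp ?_
  simpa using (hΩ.chordLength_mem hpΩ p.2).1

/-- Chords have length at most twice the diameter by the crude bound above, so the phase measure is
at most that constant times the weighted measure defining the inflow norm. -/
theorem ConvexDomain.nonnegInflow (hΩ : ConvexDomain Ω) {b : Space d → Dir d → ℝ}
    (hb : MemLp (fun p : Space d × Dir d => b p.1 p.2) 2 (inflowMeasure Ω))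
    (hpos : ∀ᵐ p ∂(inflowMeasure Ω), 0 < b p.1 p.2) : NonnegInflow Ω forwardDir b := by
  have hE : Measurable fun p : Space d × Dir d => (entryPoint Ω p.1 (p.2 : Space d), p.2) :=
    hΩ.measurable_entryPoint unitField_forwardDir
  have hm := hb.1.aemeasurable
  set b' : Space d × Dir d → ℝ≥0∞ := fun p => ENNReal.ofReal (hm.mk _ p) with hb'
  have hb'm : Measurable b' := hm.measurable_mk.ennreal_ofReal
  have hae := hΩ.ae_entry_of_ae_inflow (hm.ae_eq_mk.and hpos)
  refine ⟨b', hb'm, hae.mono fun p hp => ⟨?_, hp.2.le⟩, ?_⟩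
  · simp only [hb']
    rw [← hp.1]
  · have hN : ∫⁻ p, b' p ^ 2 ∂(inflowMeasure Ω) < ∞ := by
      have h1 := ENNReal.pow_lt_top hb.2 (n := 2)
      rw [eLpNorm_two_sq] at h1
      refine lt_of_le_of_lt (lintegral_mono_ae ?_) h1
      filter_upwards [hm.ae_eq_mk, hpos] with p h2 h3
      simp only [hb']
      rw [← h2, Real.enorm_of_nonneg h3.le]
    have hw := hΩ.measurable_inv_chordLength
    have hbE : Measurable fun p : Space d × Dir d =>
        b' (entryPoint Ω p.1 (p.2 : Space d), p.2) ^ 2 := (hb'm.comp hE).pow_const 2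
    rw [inflowMeasure, lintegral_map (hb'm.pow_const 2) hE,
      lintegral_withDensity_eq_lintegral_mul _ hw hbE] at hN
    have h : ∫⁻ p, b' (entryPoint Ω p.1 (p.2 : Space d), p.2) ^ 2 ∂(phaseMeasure Ω) < ∞ := by
      refine lt_of_le_of_lt (lintegral_mono_ae (g := fun p : Space d × Dir d => ENNReal.ofReal (2 * Metric.diam Ω) *
        ((fun p : Space d × Dir d => ENNReal.ofReal (chordLength Ω p.1 (p.2 : Space d))⁻¹) *
          fun p : Space d × Dir d => b' (entryPoint Ω p.1 (p.2 : Space d), p.2) ^ 2) p) ?_) ?_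
      · filter_upwards [hΩ.ae_mem] with p hp
        obtain ⟨h1, h2⟩ := hΩ.chordLength_mem hp p.2
        rw [Pi.mul_apply, ← mul_assoc, ← ENNReal.ofReal_mul (by linarith)]
        refine le_mul_of_one_le_left' ?_
        rw [ENNReal.one_le_ofReal, ← div_eq_mul_inv]
        exact (one_le_div h1).2 h2
      · rw [lintegral_const_mul' _ _ ENNReal.ofReal_ne_top]
        exact ENNReal.mul_lt_top ENNReal.ofReal_lt_top hN
    have h2 := eLpNorm_two_sq (ν := phaseMeasure Ω)
      fun p : Space d × Dir d => b' (entryPoint Ω p.1 (forwardDir p.2), p.2)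
    simp only [enorm_eq_self] at h2
    by_contra hcon
    rw [not_lt_top_iff] at hcon
    rw [hcon] at h2
    rw [← show _ = ∫⁻ p, b' (entryPoint Ω p.1 (p.2 : Space d), p.2) ^ 2 ∂(phaseMeasure Ω) from h2]
      at h
    simp at h

end FPAT
end

noncomputable section

namespace FPAT

open scoped ENNReal

variable {d : ℕ}

/-! ### Perturbation of the forward model -/

theorem SolvesRTE.change_absorption {Ω : Set (Space d)} {v : Dir d → Space d}
    {f : Dir d → Dir d → ℝ} (hΩ : ConvexDomain Ω) (hv : UnitField v)
    {α α₀ μs : Space d → ℝ} {q b φ : Space d → Dir d → ℝ} (h : SolvesRTE Ω f v α μs q b φ) :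
    SolvesRTE Ω f v α₀ μs (fun x θ => q x θ - (α x - α₀ x) * φ x θ) b φ :=
  h.congr hΩ hv (ae_of_all _ fun _ => by ring) (ae_of_all _ fun _ => rfl)

/-- Subtraction of two solutions with the same boundary data and different absorption. -/
theorem SolvesRTE.sub_absorption {Ω : Set (Space d)} {v : Dir d → Space d}
    {f : Dir d → Dir d → ℝ} (hΩ : ConvexDomain Ω) (hv : UnitField v) (hf : ScatteringKernel f)
    {α α₀ μs : Space d → ℝ} {b φ φ₀ : Space d → Dir d → ℝ}
    (h : SolvesRTE Ω f v α μs (fun _ _ => 0) b φ)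
    (h₀ : SolvesRTE Ω f v α₀ μs (fun _ _ => 0) b φ₀) :
    SolvesRTE Ω f v α₀ μs (fun x θ => (α₀ x - α x) * φ x θ) (fun _ _ => 0)
      (fun x θ => φ x θ - φ₀ x θ) :=
  ((h.change_absorption hΩ hv (α₀ := α₀)).sub hΩ hv hf h₀).congr hΩ hv
    (ae_of_all _ fun _ => by ring) (ae_of_all _ fun _ => sub_self _)

/-- Excitation and emission densities for the total absorption `α` and the emission weight `β`. -/
structure Setup.IsModel (P : Setup d) (α β : Space d → ℝ) (φ ψ : Space d → Dir d → ℝ) :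
    Prop where
  excitation : SolvesRTE P.Ω P.f forwardDir α P.μsx (fun _ _ => 0) P.qb φ
  emission : SolvesRTE P.Ω P.f forwardDir P.μam P.μsm (fun x _ => β x * average φ x)
    (fun _ _ => 0) ψ

/-- The absorbed energy for the densities `φ`, `ψ` and the weight `a` of the excitation density. -/
def Setup.output (P : Setup d) (a : Space d → ℝ) (φ ψ : Space d → Dir d → ℝ) (x : Space d) : ℝ :=
  a x * collect φ x + P.μam x * collect ψ x

/-- The analytic assumptions on the known data that are used below. -/
structure Setup.Regular (P : Setup d) (c M : ℝ) : Prop where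
  domain : ConvexDomain P.Ω
  kernel : ScatteringKernel P.f
  c_pos : 0 < c
  c_le : c ≤ M
  emission : Coefficients P.Ω c M P.μam P.μsm
  inflow : NonnegInflow P.Ω forwardDir P.qb
  inflow_pos : ∀ᵐ p ∂(phaseMeasure P.Ω), 0 < P.qb (entryPoint P.Ω p.1 (forwardDir p.2)) p.2

/-- The Lipschitz constant of the absorbed energy, for coefficients bounded by `B`. -/
def perturbationBound (d : ℕ) (c B : ℝ) : ℝ≥0∞ :=
  sphereRoot d * (ENNReal.ofReal B * ENNReal.ofReal (2 / c) + 1 + ENNReal.ofReal B *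
    (ENNReal.ofReal (2 / c) * (ENNReal.ofReal B * averageBound d * ENNReal.ofReal (2 / c)
      + averageBound d)))

theorem perturbationBound_ne_top (c B : ℝ) : perturbationBound d c B ≠ ∞ := by
  unfold perturbationBound
  have h1 := sphereRoot_ne_top (d := d)
  have h2 := averageBound_ne_top (d := d)
  finiteness

variable {P : Setup d} {c M B κ : ℝ} {α β a α₀ β₀ a₀ : Space d → ℝ}
  {φ ψ φ₀ ψ₀ : Space d → Dir d → ℝ}

theorem Setup.Regular.phaseNorm_sub_le (hP : P.Regular c M)
    (hα : Coefficients P.Ω c M α P.μsx) (hα₀ : Coefficients P.Ω c M α₀ P.μsx)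
    (hm : P.IsModel α β φ ψ) (hm₀ : P.IsModel α₀ β₀ φ₀ ψ₀)
    (hακ : ∀ᵐ x ∂(volume.restrict P.Ω), |α x - α₀ x| ≤ κ) :
    phaseNorm P.Ω (fun x θ => φ x θ - φ₀ x θ)
      ≤ ENNReal.ofReal κ * (ENNReal.ofReal (2 / c) * phaseNorm P.Ω φ₀) := by
  -- The roles are exchanged on purpose: the equation with the perturbed absorption has a source
  -- containing the reference density. The bound then involves only `φ₀` and is uniform in the
  -- perturbation.
  have hs := hm₀.excitation.sub_absorption hP.domain unitField_forwardDir hP.kernel hm.excitation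
  have hq : PhaseL2 P.Ω (fun x θ => (α x - α₀ x) * φ₀ x θ) :=
    PhaseL2.coeff_mul hm₀.excitation.1 (hα.aemeasurable_a.sub hα₀.aemeasurable_a) hακ
  have hle := hs.phaseNorm_le hP.domain unitField_forwardDir hP.kernel hP.c_pos hP.c_le hα hq
  have hsymm : phaseNorm P.Ω (fun x θ => φ x θ - φ₀ x θ)
      = phaseNorm P.Ω (fun x θ => φ₀ x θ - φ x θ) :=
    eLpNorm_sub_comm (fun p : Space d × Dir d => φ p.1 p.2) (fun p => φ₀ p.1 p.2) 2 _
  rw [hsymm]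
  refine hle.trans ?_
  rw [mul_left_comm]
  exact mul_le_mul_right (phaseNorm_mul_le hακ φ₀) _

theorem Setup.Regular.source_memLp {β : Space d → ℝ} {φ : Space d → Dir d → ℝ}
    (hφ : PhaseL2 P.Ω φ) (hβ : AEMeasurable β (volume.restrict P.Ω))
    (hβB : ∀ᵐ x ∂(volume.restrict P.Ω), |β x| ≤ B) :
    PhaseL2 P.Ω (fun x _ => β x * average φ x) :=
  phaseL2_lift (memLp_coeff_mul hφ.average_memLp hβ hβB)

theorem Setup.Regular.output_memLp (hP : P.Regular c M) (hm : P.IsModel α β φ ψ)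
    (ha : AEMeasurable a (volume.restrict P.Ω))
    (haB : ∀ᵐ x ∂(volume.restrict P.Ω), |a x| ≤ B)
    (hmB : ∀ᵐ x ∂(volume.restrict P.Ω), |P.μam x| ≤ B) :
    MemLp (P.output a φ ψ) 2 (volume.restrict P.Ω) :=
  (memLp_coeff_mul (PhaseL2.collect_memLp hm.excitation.1) ha haB).add
    (memLp_coeff_mul (PhaseL2.collect_memLp hm.emission.1) hP.emission.aemeasurable_a hmB)

/-- Every product is split into the new coefficient times the change of density plus the change of
coefficient times the reference density. The emission source is treated in the same way, and the
excitation bound is fed through it. -/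
theorem Setup.Regular.eLpNorm_output_sub_le (hP : P.Regular c M)
    (hα : Coefficients P.Ω c M α P.μsx) (hα₀ : Coefficients P.Ω c M α₀ P.μsx)
    (hm : P.IsModel α β φ ψ) (hm₀ : P.IsModel α₀ β₀ φ₀ ψ₀)
    (ha : AEMeasurable a (volume.restrict P.Ω)) (ha₀ : AEMeasurable a₀ (volume.restrict P.Ω))
    (hβ : AEMeasurable β (volume.restrict P.Ω)) (hβ₀ : AEMeasurable β₀ (volume.restrict P.Ω))
    (haB : ∀ᵐ x ∂(volume.restrict P.Ω), |a x| ≤ B)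
    (hβB : ∀ᵐ x ∂(volume.restrict P.Ω), |β x| ≤ B)
    (hmB : ∀ᵐ x ∂(volume.restrict P.Ω), |P.μam x| ≤ B)
    (hακ : ∀ᵐ x ∂(volume.restrict P.Ω), |α x - α₀ x| ≤ κ)
    (haκ : ∀ᵐ x ∂(volume.restrict P.Ω), |a x - a₀ x| ≤ κ)
    (hβκ : ∀ᵐ x ∂(volume.restrict P.Ω), |β x - β₀ x| ≤ κ) :
    eLpNorm (fun x => P.output a φ ψ x - P.output a₀ φ₀ ψ₀ x) 2 (volume.restrict P.Ω)
      ≤ ENNReal.ofReal κ * (perturbationBound d c B * phaseNorm P.Ω φ₀) := by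
  have hφ : PhaseL2 P.Ω φ := hm.excitation.1
  have hφ₀ : PhaseL2 P.Ω φ₀ := hm₀.excitation.1
  have hψ : PhaseL2 P.Ω ψ := hm.emission.1
  have hψ₀ : PhaseL2 P.Ω ψ₀ := hm₀.emission.1
  have hδ : PhaseL2 P.Ω (fun x θ => φ x θ - φ₀ x θ) := hφ.sub hφ₀
  have hε : PhaseL2 P.Ω (fun x θ => ψ x θ - ψ₀ x θ) := hψ.sub hψ₀
  have n1 := hP.phaseNorm_sub_le hα hα₀ hm hm₀ hακ
  set N := phaseNorm P.Ω φ₀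
  set k := ENNReal.ofReal (2 / c)
  have hq1 : PhaseL2 P.Ω (fun x _ => β x * average (fun x θ => φ x θ - φ₀ x θ) x) :=
    Setup.Regular.source_memLp hδ hβ hβB
  have hq2 : PhaseL2 P.Ω (fun x _ => (β x - β₀ x) * average φ₀ x) :=
    Setup.Regular.source_memLp hφ₀ (hβ.sub hβ₀) hβκ
  have hq : PhaseL2 P.Ω (fun x θ => β x * average (fun x θ => φ x θ - φ₀ x θ) x
      + (β x - β₀ x) * average φ₀ x) := hq1.add hq2
  have hs : SolvesRTE P.Ω P.f forwardDir P.μam P.μsm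
      (fun x θ => β x * average (fun x θ => φ x θ - φ₀ x θ) x + (β x - β₀ x) * average φ₀ x)
      (fun _ _ => 0) (fun x θ => ψ x θ - ψ₀ x θ) := by
    refine (hm.emission.sub hP.domain unitField_forwardDir hP.kernel hm₀.emission).congr
      hP.domain unitField_forwardDir ?_ (ae_of_all _ fun _ => sub_self _)
    filter_upwards [ae_phase_of_ae (average_sub hφ hφ₀)] with p hp
    rw [hp]
    ring
  have n2 := hs.phaseNorm_le hP.domain unitField_forwardDir hP.kernel hP.c_pos hP.c_le
    hP.emission hq
  have n3 : phaseNorm P.Ω (fun x θ => ψ x θ - ψ₀ x θ) ≤ ENNReal.ofReal κ *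
      (k * (ENNReal.ofReal B * averageBound d * k + averageBound d) * N) := by
    calc _ ≤ k * (phaseNorm P.Ω (fun x _ => β x * average (fun x θ => φ x θ - φ₀ x θ) x)
          + phaseNorm P.Ω (fun x _ => (β x - β₀ x) * average φ₀ x)) :=
          n2.trans (mul_le_mul_right (eLpNorm_add_le hq1.1 hq2.1 one_le_two) _)
      _ ≤ k * (ENNReal.ofReal B * (averageBound d * (ENNReal.ofReal κ * (k * N)))
          + ENNReal.ofReal κ * (averageBound d * N)) := by
          gcongr
          · exact (phaseNorm_mul_le hβB fun x _ => average (fun x θ => φ x θ - φ₀ x θ) x).trans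
              (mul_le_mul_right ((phaseNorm_average_le hδ).trans (mul_le_mul_right n1 _)) _)
          · exact (phaseNorm_mul_le hβκ fun x _ => average φ₀ x).trans
              (mul_le_mul_right (phaseNorm_average_le hφ₀) _)
      _ = _ := by ring
  have e : (fun x => P.output a φ ψ x - P.output a₀ φ₀ ψ₀ x) =ᵐ[volume.restrict P.Ω]
      fun x => a x * collect (fun x θ => φ x θ - φ₀ x θ) x + (a x - a₀ x) * collect φ₀ x
        + P.μam x * collect (fun x θ => ψ x θ - ψ₀ x θ) x := by
    filter_upwards [collect_sub hφ hφ₀, collect_sub hψ hψ₀] with x h1 h2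
    rw [h1, h2]
    unfold Setup.output
    ring
  have m1 := memLp_coeff_mul hδ.collect_memLp ha haB
  have m2 := memLp_coeff_mul hφ₀.collect_memLp (ha.sub ha₀) haκ
  have m3 := memLp_coeff_mul hε.collect_memLp hP.emission.aemeasurable_a hmB
  rw [eLpNorm_congr_ae e]
  calc _ ≤ eLpNorm (fun x => a x * collect (fun x θ => φ x θ - φ₀ x θ) x) 2
          (volume.restrict P.Ω)
        + eLpNorm (fun x => (a x - a₀ x) * collect φ₀ x) 2 (volume.restrict P.Ω)
        + eLpNorm (fun x => P.μam x * collect (fun x θ => ψ x θ - ψ₀ x θ) x) 2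
          (volume.restrict P.Ω) :=
        (eLpNorm_add_le (m1.1.add m2.1) m3.1 one_le_two).trans
          (add_le_add (eLpNorm_add_le m1.1 m2.1 one_le_two) le_rfl)
    _ ≤ ENNReal.ofReal B * (sphereRoot d * (ENNReal.ofReal κ * (k * N)))
        + ENNReal.ofReal κ * (sphereRoot d * N)
        + ENNReal.ofReal B * (sphereRoot d * (ENNReal.ofReal κ *
          (k * (ENNReal.ofReal B * averageBound d * k + averageBound d) * N))) := by
        gcongr
        · exact (eLpNorm_coeff_mul_le haB).trans (mul_le_mul_right
            ((eLpNorm_collect_le hδ).trans (mul_le_mul_right n1 _)) _)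
        · exact (eLpNorm_coeff_mul_le haκ).trans (mul_le_mul_right (eLpNorm_collect_le hφ₀) _)
        · exact (eLpNorm_coeff_mul_le hmB).trans (mul_le_mul_right
            ((eLpNorm_collect_le hε).trans (mul_le_mul_right n3 _)) _)
    _ = _ := by
        unfold perturbationBound
        ring

/-! ### Existence, positivity and Cauchy-Schwarz for the forward model -/

theorem Setup.Regular.nonneg_source {β : Space d → ℝ} {φ : Space d → Dir d → ℝ}
    (hβ : ∀ᵐ x ∂(volume.restrict P.Ω), 0 ≤ β x)
    (hφ : ∀ᵐ p ∂(phaseMeasure P.Ω), 0 ≤ φ p.1 p.2) :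
    ∀ᵐ p ∂(phaseMeasure P.Ω), 0 ≤ β p.1 * average φ p.1 := by
  filter_upwards [ae_phase_of_ae (Measure.ae_ae_of_ae_prod hφ), ae_phase_of_ae hβ] with p h1 h2
  exact mul_nonneg h2 (mul_nonneg (inv_nonneg.2 measureReal_nonneg) (integral_nonneg_of_ae h1))

theorem Setup.Regular.excitation_pos (hP : P.Regular c M)
    (hα : Coefficients P.Ω c M α P.μsx)
    (h : SolvesRTE P.Ω P.f forwardDir α P.μsx (fun _ _ => 0) P.qb φ) :
    ∀ᵐ p ∂(phaseMeasure P.Ω), 0 < φ p.1 p.2 :=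
  h.pos hP.domain unitField_forwardDir hP.kernel hP.c_pos hP.c_le hα MemLp.zero'
    (ae_of_all _ fun _ => le_rfl) hP.inflow hP.inflow_pos

theorem Setup.Regular.emission_nonneg (hP : P.Regular c M)
    (hα : Coefficients P.Ω c M α P.μsx) (hm : P.IsModel α β φ ψ)
    (hβ : AEMeasurable β (volume.restrict P.Ω))
    (hβB : ∀ᵐ x ∂(volume.restrict P.Ω), |β x| ≤ B)
    (hβ0 : ∀ᵐ x ∂(volume.restrict P.Ω), 0 ≤ β x) :
    ∀ᵐ p ∂(phaseMeasure P.Ω), 0 ≤ ψ p.1 p.2 :=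
  hm.emission.nonneg hP.domain unitField_forwardDir hP.kernel hP.c_pos hP.c_le hP.emission
    (Setup.Regular.source_memLp hm.excitation.1 hβ hβB)
    (Setup.Regular.nonneg_source hβ0 ((hP.excitation_pos hα hm.excitation).mono fun _ => le_of_lt))
    nonnegInflow_zero

theorem Setup.Regular.exists_excitation (hP : P.Regular c M)
    (hα : Coefficients P.Ω c M α P.μsx) :
    ∃ φ, SolvesRTE P.Ω P.f forwardDir α P.μsx (fun _ _ => 0) P.qb φ := by
  obtain ⟨D, -, -, h⟩ := exists_solvesRTE_of_nonneg hP.domain unitField_forwardDir hP.kernel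
    hP.c_pos hP.c_le hα (q := fun _ _ => 0) MemLp.zero' (ae_of_all _ fun _ => le_rfl) hP.inflow
  exact ⟨_, h⟩

theorem Setup.Regular.exists_emission (hP : P.Regular c M) (hφ : PhaseL2 P.Ω φ)
    (hβ : AEMeasurable β (volume.restrict P.Ω))
    (hβB : ∀ᵐ x ∂(volume.restrict P.Ω), |β x| ≤ B) :
    ∃ ψ, SolvesRTE P.Ω P.f forwardDir P.μam P.μsm (fun x _ => β x * average φ x)
      (fun _ _ => 0) ψ := by
  obtain ⟨ψ, h, -⟩ := exists_solvesRTE_source hP.domain unitField_forwardDir hP.kernel hP.c_pos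
    hP.c_le hP.emission (Setup.Regular.source_memLp hφ hβ hβB)
  exact ⟨ψ, h⟩

theorem rteSolution_spec {Ω : Set (Space d)} {f : Dir d → Dir d → ℝ} {μa μs : Space d → ℝ}
    {q b : Space d → Dir d → ℝ} (h : ∃ φ, SolvesRTE Ω f forwardDir μa μs q b φ) :
    SolvesRTE Ω f forwardDir μa μs q b (rteSolution Ω f μa μs q b) := by
  unfold rteSolution
  rw [dif_pos h]
  exact h.choose_spec

theorem Setup.Regular.isModel (hP : P.Regular c M) {μ η : Space d → ℝ}
    (hα : Coefficients P.Ω c M (fun x => P.μaxi x + μ x) P.μsx)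
    (hβ : AEMeasurable (fun x => η x * μ x) (volume.restrict P.Ω))
    (hβB : ∀ᵐ x ∂(volume.restrict P.Ω), |η x * μ x| ≤ B) :
    P.IsModel (fun x => P.μaxi x + μ x) (fun x => η x * μ x) (P.phiX μ) (P.phiM μ η) := by
  have h1 : SolvesRTE P.Ω P.f forwardDir (fun x => P.μaxi x + μ x) P.μsx (fun _ _ => 0) P.qb
      (P.phiX μ) := rteSolution_spec (hP.exists_excitation hα)
  exact ⟨h1, rteSolution_spec (hP.exists_emission h1.1 hβ hβB)⟩

theorem sq_collect_le {Ω : Set (Space d)} {φ φ' φ'' : Space d → Dir d → ℝ}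
    (hφ : PhaseL2 Ω φ) (hφ' : PhaseL2 Ω φ') (hφ'' : PhaseL2 Ω φ'')
    (h0 : ∀ᵐ p ∂(phaseMeasure Ω), 0 ≤ φ p.1 p.2) (h0' : ∀ᵐ p ∂(phaseMeasure Ω), 0 ≤ φ' p.1 p.2)
    (h0'' : ∀ᵐ p ∂(phaseMeasure Ω), 0 ≤ φ'' p.1 p.2)
    (h : ∀ᵐ p ∂(phaseMeasure Ω), φ p.1 p.2 ^ 2 ≤ φ' p.1 p.2 * φ'' p.1 p.2) :
    ∀ᵐ x ∂(volume.restrict Ω), 0 ≤ collect φ x ∧ 0 ≤ collect φ' x ∧ 0 ≤ collect φ'' x ∧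
      collect φ x ^ 2 ≤ collect φ' x * collect φ'' x := by
  filter_upwards [hφ.ae_integrable, hφ'.ae_integrable, hφ''.ae_integrable,
    Measure.ae_ae_of_ae_prod h0, Measure.ae_ae_of_ae_prod h0', Measure.ae_ae_of_ae_prod h0'',
    Measure.ae_ae_of_ae_prod h] with x i i' i'' p p' p'' hx
  have n := integral_nonneg_of_ae p
  have n' := integral_nonneg_of_ae p'
  have n'' := integral_nonneg_of_ae p''
  refine ⟨n, n', n'', ?_⟩
  have key := sq_lintegral_le i'.1.aemeasurable.ennreal_ofReal i''.1.aemeasurable.ennreal_ofReal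
    (a := fun θ => ENNReal.ofReal (φ x θ)) (by
      filter_upwards [hx, p, p', p''] with θ hθ q q' q''
      rw [← ENNReal.ofReal_pow q, ← ENNReal.ofReal_mul q']
      exact ENNReal.ofReal_le_ofReal hθ)
  rw [← ofReal_integral_eq_lintegral_ofReal i p, ← ofReal_integral_eq_lintegral_ofReal i' p',
    ← ofReal_integral_eq_lintegral_ofReal i'' p'', ← ENNReal.ofReal_pow n,
    ← ENNReal.ofReal_mul n'] at key
  exact (ENNReal.ofReal_le_ofReal_iff (mul_nonneg n' n'')).1 key

theorem collect_pos {Ω : Set (Space d)} (hS : sphereMeasure d ≠ 0) {φ : Space d → Dir d → ℝ}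
    (hφ : PhaseL2 Ω φ) (h : ∀ᵐ p ∂(phaseMeasure Ω), 0 < φ p.1 p.2) :
    ∀ᵐ x ∂(volume.restrict Ω), 0 < collect φ x := by
  filter_upwards [hφ.ae_integrable, Measure.ae_ae_of_ae_prod h] with x i p
  have n : 0 ≤ᵐ[sphereMeasure d] φ x := p.mono fun θ h => h.le
  refine lt_of_le_of_ne (integral_nonneg_of_ae n) fun h0 => hS ?_
  have h1 := (integral_eq_zero_iff_of_nonneg_ae n i).1 h0.symm
  rw [← ae_eq_bot, ← eventually_false_iff_eq_bot]
  filter_upwards [p, h1] with θ a b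
  rw [b] at a
  exact lt_irrefl _ a

/-- The cross term is controlled by the arithmetic-geometric mean inequality: `4 x' x'' y' y'' ≤ (x'
y'' + y' x'')²`. -/
theorem sq_add_le_mul {x y x' y' x'' y'' : ℝ} (hx' : 0 ≤ x') (hy' : 0 ≤ y') (hx'' : 0 ≤ x'')
    (hy'' : 0 ≤ y'') (hx : x ^ 2 ≤ x' * x'') (hy : y ^ 2 ≤ y' * y'') :
    (x + y) ^ 2 ≤ (x' + y') * (x'' + y'') := by
  have h1 : 2 * (x * y) ≤ x' * y'' + y' * x'' := by
    refine abs_le_of_sq_le_sq' ?_ (by positivity) |>.2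
    have h2 : x ^ 2 * y ^ 2 ≤ (x' * x'') * (y' * y'') :=
      mul_le_mul hx hy (sq_nonneg _) (by positivity)
    nlinarith [sq_nonneg (x' * y'' - y' * x'')]
  nlinarith

/-- Cauchy-Schwarz for the absorbed energy. -/
theorem Setup.Regular.sq_output_le (hP : P.Regular c M)
    {α' β' a' α'' β'' a'' : Space d → ℝ} {φ' ψ' φ'' ψ'' : Space d → Dir d → ℝ}
    (hα : Coefficients P.Ω c M α P.μsx) (hα' : Coefficients P.Ω c M α' P.μsx)
    (hα'' : Coefficients P.Ω c M α'' P.μsx)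
    (hm : P.IsModel α β φ ψ) (hm' : P.IsModel α' β' φ' ψ') (hm'' : P.IsModel α'' β'' φ'' ψ'')
    (hβ : AEMeasurable β (volume.restrict P.Ω)) (hβ' : AEMeasurable β' (volume.restrict P.Ω))
    (hβ'' : AEMeasurable β'' (volume.restrict P.Ω))
    (hβB : ∀ᵐ x ∂(volume.restrict P.Ω), (0 ≤ β x ∧ |β x| ≤ B) ∧ (0 ≤ β' x ∧ |β' x| ≤ B) ∧
      (0 ≤ β'' x ∧ |β'' x| ≤ B))
    (ha : ∀ᵐ x ∂(volume.restrict P.Ω), 0 ≤ a' x ∧ 0 ≤ a'' x)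
    (hk : ∀ᵐ x ∂(volume.restrict P.Ω), (M - α x - P.μsx x) ^ 2
      ≤ (M - α' x - P.μsx x) * (M - α'' x - P.μsx x))
    (hββ : ∀ᵐ x ∂(volume.restrict P.Ω), β x ^ 2 ≤ β' x * β'' x)
    (haa : ∀ᵐ x ∂(volume.restrict P.Ω), a x ^ 2 ≤ a' x * a'' x) :
    ∀ᵐ x ∂(volume.restrict P.Ω),
      P.output a φ ψ x ^ 2 ≤ P.output a' φ' ψ' x * P.output a'' φ'' ψ'' x := by
  have p := (hP.excitation_pos hα hm.excitation).mono fun _ => le_of_lt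
  have p' := (hP.excitation_pos hα' hm'.excitation).mono fun _ => le_of_lt
  have p'' := (hP.excitation_pos hα'' hm''.excitation).mono fun _ => le_of_lt
  have e := hP.emission_nonneg hα hm hβ (hβB.mono fun _ h => h.1.2) (hβB.mono fun _ h => h.1.1)
  have e' := hP.emission_nonneg hα' hm' hβ' (hβB.mono fun _ h => h.2.1.2)
    (hβB.mono fun _ h => h.2.1.1)
  have e'' := hP.emission_nonneg hα'' hm'' hβ'' (hβB.mono fun _ h => h.2.2.2)
    (hβB.mono fun _ h => h.2.2.1)
  have hx := sq_collect_le hm.excitation.1 hm'.excitation.1 hm''.excitation.1 p p' p''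
    (hm.excitation.sq_le_mul hP.domain unitField_forwardDir hP.kernel hP.c_pos hP.c_le hα hα' hα''
      hP.inflow MemLp.zero' (ae_of_all _ fun _ => le_rfl) MemLp.zero' (ae_of_all _ fun _ => le_rfl)
      MemLp.zero' (ae_of_all _ fun _ => le_rfl) hm'.excitation hm''.excitation hk
      (ae_of_all _ fun _ => by norm_num))
  have s := Setup.Regular.source_memLp hm.excitation.1 hβ (hβB.mono fun _ h => h.1.2)
  have s' := Setup.Regular.source_memLp hm'.excitation.1 hβ' (hβB.mono fun _ h => h.2.1.2)
  have s'' := Setup.Regular.source_memLp hm''.excitation.1 hβ'' (hβB.mono fun _ h => h.2.2.2)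
  have n := Setup.Regular.nonneg_source (hβB.mono fun _ h => h.1.1) p
  have n' := Setup.Regular.nonneg_source (hβB.mono fun _ h => h.2.1.1) p'
  have n'' := Setup.Regular.nonneg_source (hβB.mono fun _ h => h.2.2.1) p''
  have hem := sq_collect_le hm.emission.1 hm'.emission.1 hm''.emission.1 e e' e''
    (hm.emission.sq_le_mul hP.domain unitField_forwardDir hP.kernel hP.c_pos hP.c_le
      hP.emission hP.emission hP.emission nonnegInflow_zero s n s' n' s'' n''
      -- The excitation inequality, already passed to angular integrals, combines with the one
      -- between the weights `β` to give the inequality for the emission sources.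
      hm'.emission hm''.emission (ae_of_all _ fun _ => by rw [sq]) (by
        filter_upwards [ae_phase_of_ae hx, ae_phase_of_ae hββ, ae_phase_of_ae hβB] with z h1 h2 h3
        simp only [average_eq]
        set S := ((sphereMeasure d).real univ)⁻¹
        have h4 : β z.1 ^ 2 * collect φ z.1 ^ 2
            ≤ (β' z.1 * β'' z.1) * (collect φ' z.1 * collect φ'' z.1) :=
          mul_le_mul h2 h1.2.2.2 (sq_nonneg _) (mul_nonneg h3.2.1.1 h3.2.2.1)
        have h5 := mul_le_mul_of_nonneg_left h4 (sq_nonneg S)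
        linarith))
  filter_upwards [hx, hem, haa, ha, hP.emission.bounds] with x h1 h2 h3 h4 h5
  have hma : 0 ≤ P.μam x := hP.c_pos.le.trans h5.1
  unfold Setup.output
  refine sq_add_le_mul (mul_nonneg h4.1 h1.2.1) (mul_nonneg hma h2.2.1)
    (mul_nonneg h4.2 h1.2.2.1) (mul_nonneg hma h2.2.2.1) ?_ ?_
  · have := mul_le_mul h3 h1.2.2.2 (sq_nonneg _) (mul_nonneg h4.1 h4.2)
    linarith
  · have := mul_le_mul_of_nonneg_left h2.2.2.2 (sq_nonneg (P.μam x))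
    linarith

end FPAT
end

noncomputable section

namespace FPAT

open scoped ENNReal

variable {d : ℕ}

/-! ### Perturbed coefficients -/

/-- Pointwise bounds on the coefficients `ax = μ_{a,xi}`, `sx = μ_{s,x}`, `m = μ_{a,xf}`, `e = η`
and on the displaced coefficients `m + D`, `e + E`. -/
structure CoefficientRange (c₁ c₂ ax sx m e D E : ℝ) : Prop where
  ax_mem : c₁ ≤ ax ∧ ax ≤ c₂
  sx_mem : c₁ ≤ sx ∧ sx ≤ c₂
  m_mem : c₁ ≤ m ∧ m ≤ c₂
  e_mem : 0 ≤ e ∧ e ≤ 1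
  mD_mem : c₁ ≤ m + D ∧ m + D ≤ c₂
  eE_mem : 0 ≤ e + E ∧ e + E ≤ 1

section

variable {c₁ c₂ ax sx m e D E ε : ℝ}

theorem CoefficientRange.displaced (h : CoefficientRange c₁ c₂ ax sx m e D E) (hε : 0 ≤ ε)
    (hε1 : ε ≤ 1) : (c₁ ≤ m + ε * D ∧ m + ε * D ≤ c₂) ∧ (0 ≤ e + ε * E ∧ e + ε * E ≤ 1) := by
  obtain ⟨-, -, ⟨m1, m2⟩, ⟨e1, e2⟩, ⟨d1, d2⟩, ⟨f1, f2⟩⟩ := h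
  refine ⟨⟨?_, ?_⟩, ?_, ?_⟩ <;> nlinarith

theorem CoefficientRange.abs_sub_le (h : CoefficientRange c₁ c₂ ax sx m e D E) (hc : 0 < c₁)
    (hε : 0 ≤ ε) (hε1 : ε ≤ 1) :
    |m + ε * D - m| ≤ 2 * c₂ * ε ∧
    |(e + ε * E) * (m + ε * D) - e * m| ≤ 2 * c₂ * ε ∧
    |(1 - (e + ε * E)) * (m + ε * D) - (1 - e) * m| ≤ 2 * c₂ * ε := by
  obtain ⟨⟨m3, m4⟩, -⟩ := h.displaced hε hε1
  obtain ⟨-, -, ⟨m1, m2⟩, ⟨e1, e2⟩, ⟨d1, d2⟩, ⟨f1, f2⟩⟩ := h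
  have hD : |D| ≤ c₂ := abs_le.2 ⟨by linarith, by linarith⟩
  have hE : |E| ≤ 1 := abs_le.2 ⟨by linarith, by linarith⟩
  have hm : |m + ε * D| ≤ c₂ := abs_le.2 ⟨by linarith, m4⟩
  have he : |e| ≤ 1 := abs_le.2 ⟨by linarith, e2⟩
  have he' : |1 - e| ≤ 1 := abs_le.2 ⟨by linarith, by linarith⟩
  have hc2 : 0 ≤ c₂ := by linarith
  have p1 : |ε * E * (m + ε * D)| ≤ c₂ * ε := by
    rw [abs_mul, abs_mul, abs_of_nonneg hε, mul_assoc, mul_comm c₂]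
    refine mul_le_mul_of_nonneg_left ?_ hε
    calc |E| * |m + ε * D| ≤ 1 * c₂ := mul_le_mul hE hm (abs_nonneg _) zero_le_one
      _ = c₂ := one_mul _
  have p2 : ∀ t : ℝ, |t| ≤ 1 → |t * (ε * D)| ≤ c₂ * ε := fun t ht => by
    rw [abs_mul, abs_mul, abs_of_nonneg hε, mul_left_comm, mul_comm c₂]
    refine mul_le_mul_of_nonneg_left ?_ hε
    calc |t| * |D| ≤ 1 * c₂ := mul_le_mul ht hD (abs_nonneg _) zero_le_one
      _ = c₂ := one_mul _
  have hce : 0 ≤ c₂ * ε := mul_nonneg hc2 hε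
  refine ⟨?_, ?_, ?_⟩
  · have := p2 1 (by simp)
    rw [one_mul] at this
    rw [add_sub_cancel_left]
    linarith
  · rw [show (e + ε * E) * (m + ε * D) - e * m = ε * E * (m + ε * D) + e * (ε * D) by ring]
    linarith [abs_add_le (ε * E * (m + ε * D)) (e * (ε * D)), p2 e he]
  · rw [show (1 - (e + ε * E)) * (m + ε * D) - (1 - e) * m
      = -(ε * E * (m + ε * D)) + (1 - e) * (ε * D) by ring]
    have := abs_add_le (-(ε * E * (m + ε * D))) ((1 - e) * (ε * D))
    rw [abs_neg] at this
    linarith [p2 _ he']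

theorem inv_one_sub_bounds (hε : 0 ≤ ε) (hε1 : ε ≤ 1 / 8) :
    1 ≤ (1 - ε)⁻¹ ∧ (1 - ε)⁻¹ ≤ 1 + 2 * ε ∧ (1 - ε)⁻¹ ^ 2 ≤ 1 + 8 * ε := by
  have h0 : 0 < 1 - ε := by linarith
  have h1 : 1 ≤ (1 - ε)⁻¹ := (one_le_inv₀ h0).2 (by linarith)
  have h2 : (1 - ε)⁻¹ ≤ 1 + 2 * ε := by
    rw [inv_le_iff_one_le_mul₀ h0]
    nlinarith
  refine ⟨h1, h2, ?_⟩
  nlinarith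

/-- A displaced value is `1 - ε` times the old one plus `ε` times the nonnegative value at full
displacement, hence at least `1 - ε` times the old one. A product of two such quantities loses `(1 -
ε)²`, compensated by the squared inverse. The in-scattering coefficient is affine in the
displacement and loses a single factor. -/
theorem CoefficientRange.lower (h : CoefficientRange c₁ c₂ ax sx m e D E) (hc : 0 < c₁)
    (hε : 0 ≤ ε) (hε1 : ε ≤ 1 / 8) :
    (e * m) ^ 2 ≤ ((e + ε * E) * (m + ε * D)) * ((1 - ε)⁻¹ ^ 2 * (e * m)) ∧
    (ax + (1 - e) * m) ^ 2 ≤ (ax + (1 - (e + ε * E)) * (m + ε * D))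
      * ((1 - ε)⁻¹ ^ 2 * (ax + (1 - e) * m)) ∧
    (4 * c₂ - (ax + m) - sx) ^ 2 ≤ (4 * c₂ - (ax + (m + ε * D)) - sx)
      * ((4 * c₂ - (ax + m) - sx) * (1 - ε)⁻¹) := by
  obtain ⟨⟨a1, a2⟩, ⟨s1, s2⟩, ⟨m1, m2⟩, ⟨e1, e2⟩, ⟨d1, d2⟩, ⟨f1, f2⟩⟩ := h
  have h0 : 0 < 1 - ε := by linarith
  set w := (1 - ε)⁻¹ with hw
  have hw0 : 0 < w := inv_pos.2 h0
  have hw1 : (1 - ε) * w = 1 := mul_inv_cancel₀ h0.ne'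
  have hm : (1 - ε) * m ≤ m + ε * D := by nlinarith
  have he : (1 - ε) * e ≤ e + ε * E := by nlinarith
  have he' : (1 - ε) * (1 - e) ≤ 1 - (e + ε * E) := by nlinarith
  have hm0 : 0 ≤ (1 - ε) * m := mul_nonneg h0.le (by linarith)
  have key : ∀ x y : ℝ, 0 ≤ x → (1 - ε) ^ 2 * x ≤ y → x ^ 2 ≤ y * (w ^ 2 * x) := by
    intro x y hx hxy
    have h3 := mul_le_mul_of_nonneg_right hxy (show 0 ≤ w ^ 2 * x by positivity)
    have h4 : (1 - ε) ^ 2 * x * (w ^ 2 * x) = x ^ 2 := by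
      calc (1 - ε) ^ 2 * x * (w ^ 2 * x) = ((1 - ε) * w) ^ 2 * x ^ 2 := by ring
        _ = x ^ 2 := by rw [hw1]; ring
    linarith
  refine ⟨key _ _ (mul_nonneg e1 (by linarith)) ?_, key _ _ ?_ ?_, ?_⟩
  · have := mul_le_mul he hm hm0 (le_trans (mul_nonneg h0.le e1) he)
    linarith
  · have := mul_nonneg (sub_nonneg.2 e2) (show 0 ≤ m by linarith)
    linarith
  · have h5 := mul_le_mul he' hm hm0 (le_trans (mul_nonneg h0.le (sub_nonneg.2 e2)) he')
    have h6 : (1 - ε) ^ 2 * ax ≤ ax := by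
      have : (1 - ε) ^ 2 ≤ 1 := by nlinarith
      nlinarith
    linarith
  · set k := 4 * c₂ - (ax + m) - sx with hk
    have hk1 : c₂ ≤ k := by linarith
    have h7 : (1 - ε) * k ≤ 4 * c₂ - (ax + (m + ε * D)) - sx := by nlinarith
    have h8 := mul_le_mul_of_nonneg_right h7 (show 0 ≤ k * w by
      have : 0 ≤ k := by linarith
      positivity)
    have h9 : (1 - ε) * k * (k * w) = k ^ 2 := by
      calc (1 - ε) * k * (k * w) = ((1 - ε) * w) * k ^ 2 := by ring
        _ = k ^ 2 := by rw [hw1, one_mul]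
    linarith

/-- The comparison absorption falls short of `ax + m` by the in-scattering coefficient times `(1 -
ε)⁻¹ - 1`, at most `4 c₂ · 2 ε ≤ c₁`. As `ax + m ≥ 2 c₁`, it stays at least `c₁`, so the comparison
problem remains uniformly absorbing. -/
theorem CoefficientRange.upper (h : CoefficientRange c₁ c₂ ax sx m e D E) (hc : 0 < c₁)
    (hε : 0 ≤ ε) (hε1 : ε ≤ 1 / 8) (hεc : 8 * c₂ * ε ≤ c₁) :
    (c₁ ≤ 4 * c₂ - sx - (4 * c₂ - (ax + m) - sx) * (1 - ε)⁻¹) ∧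
    (4 * c₂ - sx - (4 * c₂ - (ax + m) - sx) * (1 - ε)⁻¹ + sx ≤ 4 * c₂) ∧
    |4 * c₂ - sx - (4 * c₂ - (ax + m) - sx) * (1 - ε)⁻¹ - (ax + m)| ≤ 16 * c₂ * ε ∧
    |(1 - ε)⁻¹ ^ 2 * (e * m) - e * m| ≤ 16 * c₂ * ε ∧
    |(1 - ε)⁻¹ ^ 2 * (ax + (1 - e) * m) - (ax + (1 - e) * m)| ≤ 16 * c₂ * ε := by
  obtain ⟨⟨a1, a2⟩, ⟨s1, s2⟩, ⟨m1, m2⟩, ⟨e1, e2⟩, -, -⟩ := h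
  obtain ⟨w1, w2, w3⟩ := inv_one_sub_bounds hε hε1
  set w := (1 - ε)⁻¹ with hw
  have w4 : 1 ≤ w ^ 2 := one_le_pow₀ w1
  set k := 4 * c₂ - (ax + m) - sx with hk
  have hc2 : 0 ≤ c₂ := by linarith
  have hk1 : 0 ≤ k := by linarith
  have hk2 : k ≤ 4 * c₂ := by linarith
  have hkw : k * (w - 1) ≤ 8 * c₂ * ε := by
    calc k * (w - 1) ≤ (4 * c₂) * (2 * ε) := mul_le_mul hk2 (by linarith) (by linarith) (by linarith)
      _ = _ := by ring
  have hkw0 : 0 ≤ k * (w - 1) := mul_nonneg hk1 (by linarith)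
  have e0 : 4 * c₂ - sx - k * w - (ax + m) = -(k * (w - 1)) := by rw [hk]; ring
  have sq : ∀ x, 0 ≤ x → x ≤ 2 * c₂ → |w ^ 2 * x - x| ≤ 16 * c₂ * ε := by
    intro x h0 h1
    rw [show w ^ 2 * x - x = x * (w ^ 2 - 1) by ring, abs_of_nonneg (mul_nonneg h0 (by linarith))]
    calc x * (w ^ 2 - 1) ≤ (2 * c₂) * (8 * ε) :=
          mul_le_mul h1 (by linarith) (by linarith) (by linarith)
      _ = _ := by ring
  have hem : e * m ≤ m := mul_le_of_le_one_left (by linarith) e2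
  have hem0 : 0 ≤ e * m := mul_nonneg e1 (by linarith)
  refine ⟨by linarith, by nlinarith, ?_, sq _ hem0 (by linarith), sq _ ?_ ?_⟩
  · rw [e0, abs_neg, abs_of_nonneg hkw0]
    have : 0 ≤ c₂ * ε := mul_nonneg hc2 hε
    linarith
  · rw [sub_mul, one_mul]; linarith
  · rw [sub_mul, one_mul]; linarith

end

/-! ### The perturbed forward model -/

/-- Absorption and scattering at the excitation state add up to at most `3 c₂`. With the attenuation
`4 c₂` the in-scattering coefficient `M - μa - μs` therefore stays nonnegative for all admissible
`μ`. -/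
theorem Setup.Admissible.regular {P : Setup d} {c₁ c₂ : ℝ} (hP : P.Admissible c₁ c₂)
    (hc₁ : 0 < c₁) (hc : c₁ ≤ c₂) : P.Regular c₁ (4 * c₂) where
  domain := ⟨hP.isOpen, hP.convex, hP.bounded⟩
  kernel := ⟨hP.f_measurable, hP.f_nonneg, hP.f_symm, hP.f_integral⟩
  c_pos := hc₁
  c_le := by linarith
  emission := ⟨hP.μam_mem.1, hP.μsm_mem.1, by
    filter_upwards [hP.μam_mem.2, hP.μsm_mem.2] with x h1 h2
    exact ⟨h1.1, by linarith, by linarith⟩⟩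
  inflow := ConvexDomain.nonnegInflow ⟨hP.isOpen, hP.convex, hP.bounded⟩ hP.qb_memLp hP.qb_pos
  inflow_pos := ConvexDomain.ae_entry_of_ae_inflow ⟨hP.isOpen, hP.convex, hP.bounded⟩ hP.qb_pos

theorem Setup.Admissible.coefficients {P : Setup d} {c₁ c₂ : ℝ} (hP : P.Admissible c₁ c₂)
    (hc₁ : 0 < c₁) {μ : Space d → ℝ} (hμ : InRange P.Ω c₁ c₂ μ) :
    Coefficients P.Ω c₁ (4 * c₂) (fun x => P.μaxi x + μ x) P.μsx :=
  ⟨hP.μaxi_mem.1.add hμ.1, hP.μsx_mem.1, by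
    filter_upwards [hP.μaxi_mem.2, hP.μsx_mem.2, hμ.2] with x h1 h2 h3
    exact ⟨by linarith, by linarith, by linarith⟩⟩

theorem InRange.mul_bounds {Ω : Set (Space d)} {c₁ c₂ : ℝ} (hc₁ : 0 < c₁) {μ η : Space d → ℝ}
    (hμ : InRange Ω c₁ c₂ μ) (hη : InRange Ω 0 1 η) :
    ∀ᵐ x ∂(volume.restrict Ω), 0 ≤ η x * μ x ∧ η x * μ x ≤ c₂ ∧
      0 ≤ (1 - η x) * μ x ∧ (1 - η x) * μ x ≤ c₂ := by
  filter_upwards [hμ.2, hη.2] with x h1 h2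
  refine ⟨mul_nonneg h2.1 (by linarith), ?_, mul_nonneg (by linarith) (by linarith), ?_⟩
  · exact (mul_le_of_le_one_left (by linarith) h2.2).trans h1.2
  · exact (mul_le_of_le_one_left (by linarith) (by linarith)).trans h1.2

theorem Setup.Admissible.isModel {P : Setup d} {c₁ c₂ : ℝ} (hP : P.Admissible c₁ c₂)
    (hc₁ : 0 < c₁) (hc : c₁ ≤ c₂) {μ η : Space d → ℝ} (hμ : InRange P.Ω c₁ c₂ μ)
    (hη : InRange P.Ω 0 1 η) :
    P.IsModel (fun x => P.μaxi x + μ x) (fun x => η x * μ x) (P.phiX μ) (P.phiM μ η) :=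
  (hP.regular hc₁ hc).isModel (hP.coefficients hc₁ hμ) (hη.1.mul hμ.1) (B := c₂)
    ((hμ.mul_bounds hc₁ hη).mono fun x h => by rw [abs_of_nonneg h.1]; exact h.2.1)

theorem Setup.Admissible.H_memLp {P : Setup d} {c₁ c₂ : ℝ} (hP : P.Admissible c₁ c₂)
    (hc₁ : 0 < c₁) (hc : c₁ ≤ c₂) {μ η : Space d → ℝ} (hμ : InRange P.Ω c₁ c₂ μ)
    (hη : InRange P.Ω 0 1 η) : MemLp (P.H μ η) 2 (volume.restrict P.Ω) :=
  (hP.regular hc₁ hc).output_memLp (hP.isModel hc₁ hc hμ hη) (B := 2 * c₂)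
    (a := fun x => P.μaxi x + (1 - η x) * μ x)
    (hP.μaxi_mem.1.add ((aemeasurable_const.sub hη.1).mul hμ.1))
    (by
      filter_upwards [hP.μaxi_mem.2, hμ.mul_bounds hc₁ hη] with x h1 h2
      rw [abs_of_nonneg (by linarith)]
      linarith)
    (hP.μam_mem.2.mono fun x h => by rw [abs_of_nonneg (by linarith)]; linarith)

theorem Setup.Admissible.H_pos {P : Setup d} {c₁ c₂ : ℝ} (hP : P.Admissible c₁ c₂)
    (hc₁ : 0 < c₁) (hc : c₁ ≤ c₂) (hS : sphereMeasure d ≠ 0) {μ η : Space d → ℝ}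
    (hμ : InRange P.Ω c₁ c₂ μ) (hη : InRange P.Ω 0 1 η) :
    ∀ᵐ x ∂(volume.restrict P.Ω), 0 < P.H μ η x := by
  have hR := hP.regular hc₁ hc
  have hm := hP.isModel hc₁ hc hμ hη
  have hα := hP.coefficients hc₁ hμ
  have hb := hμ.mul_bounds hc₁ hη
  have h1 := collect_pos hS hm.excitation.1 (hR.excitation_pos hα hm.excitation)
  have h2 := hR.emission_nonneg hα hm (hη.1.mul hμ.1) (B := c₂)
    (hb.mono fun x h => by rw [abs_of_nonneg h.1]; exact h.2.1)
    (hb.mono fun x h => h.1)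
  filter_upwards [h1, Measure.ae_ae_of_ae_prod h2, hb, hP.μaxi_mem.2, hP.μam_mem.2]
    with x p1 p2 p3 p4 p5
  have p6 : 0 ≤ collect (P.phiM μ η) x := integral_nonneg_of_ae p2
  have : 0 < (P.μaxi x + (1 - η x) * μ x) * collect (P.phiX μ) x :=
    mul_pos (by linarith) p1
  have : 0 ≤ P.μam x * collect (P.phiM μ η) x := mul_nonneg (by linarith) p6
  unfold Setup.H
  linarith

/-- The comparison of the absorbed energy at nearby coefficients, with constants that do not depend
on the step `s`. -/
theorem Setup.Admissible.exists_comparison {P : Setup d} {c₁ c₂ : ℝ} (hP : P.Admissible c₁ c₂)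
    (hc₁ : 0 < c₁) (hc : c₁ ≤ c₂) {μ η hf hη' : Space d → ℝ}
    (hμ : InRange P.Ω c₁ c₂ μ) (hη : InRange P.Ω 0 1 η) {δ : ℝ} (hδ : 0 < δ)
    (hfδ : ∀ s : ℝ, 0 < s → s ≤ δ → InRange P.Ω c₁ c₂ (fun x => μ x + s * hf x))
    (hηδ : ∀ s : ℝ, 0 < s → s ≤ δ → InRange P.Ω 0 1 (fun x => η x + s * hη' x))
    {s : ℝ} (hs : 0 < s) (hsδ : 8 * c₂ * (s / δ) ≤ c₁) :
    phaseNorm P.Ω (fun x θ => P.phiX (fun x => μ x + s * hf x) x θ - P.phiX μ x θ)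
      ≤ ENNReal.ofReal (16 * c₂ * (s / δ)) * (ENNReal.ofReal (2 / c₁) * phaseNorm P.Ω (P.phiX μ)) ∧
    ∃ G : Space d → ℝ, AEStronglyMeasurable G (volume.restrict P.Ω) ∧
      eLpNorm G 2 (volume.restrict P.Ω) ≤ ENNReal.ofReal (16 * c₂ / δ)
        * (perturbationBound d c₁ (8 * c₂) * phaseNorm P.Ω (P.phiX μ)) * 2 ∧
      ∀ᵐ x ∂(volume.restrict P.Ω),
        |P.H (fun x => μ x + s * hf x) (fun x => η x + s * hη' x) x - P.H μ η x| ≤ s * G x ∧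
        P.H μ η x ^ 2 ≤ P.H (fun x => μ x + s * hf x) (fun x => η x + s * hη' x) x
          * (P.H μ η x + s * G x) := by
  have hR := hP.regular hc₁ hc
  have hc2 : 0 < c₂ := hc₁.trans_le hc
  set ε := s / δ with hε
  have hε0 : 0 ≤ ε := by positivity
  have hε8 : ε ≤ 1 / 8 := by
    have h1 : 8 * c₂ * ε ≤ 8 * c₂ * (1 / 8) := by linarith
    exact le_of_mul_le_mul_left h1 (by positivity)
  have hsε : s = ε * δ := by rw [hε]; field_simp
  have hsδ' : s ≤ δ := by rw [hsε]; nlinarith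
  set μs : Space d → ℝ := fun x => μ x + s * hf x with hμs
  set ηs : Space d → ℝ := fun x => η x + s * hη' x with hηs
  have hμs' : InRange P.Ω c₁ c₂ μs := hfδ s hs hsδ'
  have hηs' : InRange P.Ω 0 1 ηs := hηδ s hs hsδ'
  set w := (1 - ε)⁻¹ with hw
  -- Displacements are measured by the full step `δ`, so that `s` is the fraction `ε` of a segment
  -- whose far end is still admissible.
  have hrange : ∀ᵐ x ∂(volume.restrict P.Ω), CoefficientRange c₁ c₂ (P.μaxi x) (P.μsx x) (μ x)
      (η x) (δ * hf x) (δ * hη' x) := by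
    filter_upwards [hP.μaxi_mem.2, hP.μsx_mem.2, hμ.2, hη.2, (hfδ δ hδ le_rfl).2,
      (hηδ δ hδ le_rfl).2] with x h1 h2 h3 h4 h5 h6
    exact ⟨h1, h2, h3, h4, h5, h6⟩
  have es : ∀ t : ℝ, s * t = ε * (δ * t) := fun t => by rw [hsε, mul_assoc]
  have hm := hP.isModel hc₁ hc hμ hη
  have hms := hP.isModel hc₁ hc hμs' hηs'
  have hα := hP.coefficients hc₁ hμ
  have hαs := hP.coefficients hc₁ hμs'
  -- The comparison coefficients: the in-scattering coefficient for `α₂` is the reference one times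
  -- `(1 - ε)⁻¹`, and `β₂`, `a₂` are the reference weights times its square. Each reference quantity
  -- is then bounded in square by perturbed times comparison.
  set α₂ : Space d → ℝ := fun x => 4 * c₂ - P.μsx x
    - (4 * c₂ - (P.μaxi x + μ x) - P.μsx x) * w with hα₂
  set β₂ : Space d → ℝ := fun x => w ^ 2 * (η x * μ x) with hβ₂
  set a₂ : Space d → ℝ := fun x => w ^ 2 * (P.μaxi x + (1 - η x) * μ x) with ha₂
  have hβm : AEMeasurable (fun x => η x * μ x) (volume.restrict P.Ω) := hη.1.mul hμ.1
  have hβsm : AEMeasurable (fun x => ηs x * μs x) (volume.restrict P.Ω) := hηs'.1.mul hμs'.1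
  have hβ₂m : AEMeasurable β₂ (volume.restrict P.Ω) := hβm.const_mul _
  have ham : AEMeasurable (fun x => P.μaxi x + (1 - η x) * μ x) (volume.restrict P.Ω) :=
    hP.μaxi_mem.1.add ((aemeasurable_const.sub hη.1).mul hμ.1)
  have hasm : AEMeasurable (fun x => P.μaxi x + (1 - ηs x) * μs x) (volume.restrict P.Ω) :=
    hP.μaxi_mem.1.add ((aemeasurable_const.sub hηs'.1).mul hμs'.1)
  have ha₂m : AEMeasurable a₂ (volume.restrict P.Ω) := ham.const_mul _
  have hco₂ : Coefficients P.Ω c₁ (4 * c₂) α₂ P.μsx := by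
    refine ⟨(aemeasurable_const.sub hP.μsx_mem.1).sub (((aemeasurable_const.sub
      (hP.μaxi_mem.1.add hμ.1)).sub hP.μsx_mem.1).mul_const _), hP.μsx_mem.1, ?_⟩
    filter_upwards [hrange] with x hx
    have := hx.upper hc₁ hε0 hε8 hsδ
    exact ⟨this.1, by linarith [hx.sx_mem.1], this.2.1⟩
  have hbd : ∀ᵐ x ∂(volume.restrict P.Ω), (0 ≤ η x * μ x ∧ |η x * μ x| ≤ 8 * c₂) ∧
      (0 ≤ ηs x * μs x ∧ |ηs x * μs x| ≤ 8 * c₂) ∧ (0 ≤ β₂ x ∧ |β₂ x| ≤ 8 * c₂) := by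
    filter_upwards [hμ.mul_bounds hc₁ hη, hμs'.mul_bounds hc₁ hηs'] with x h1 h2
    obtain ⟨-, -, w3⟩ := inv_one_sub_bounds hε0 hε8
    have h0 : 0 ≤ β₂ x := mul_nonneg (sq_nonneg _) h1.1
    refine ⟨⟨h1.1, ?_⟩, ⟨h2.1, ?_⟩, ⟨h0, ?_⟩⟩
    · rw [abs_of_nonneg h1.1]; linarith
    · rw [abs_of_nonneg h2.1]; linarith
    · rw [abs_of_nonneg h0]
      calc w ^ 2 * (η x * μ x) ≤ 2 * c₂ := mul_le_mul (by linarith) h1.2.1 h1.1 zero_le_two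
        _ ≤ _ := by linarith
  have habd : ∀ᵐ x ∂(volume.restrict P.Ω), (0 ≤ P.μaxi x + (1 - ηs x) * μs x ∧
      |P.μaxi x + (1 - ηs x) * μs x| ≤ 8 * c₂) ∧ (0 ≤ a₂ x ∧ |a₂ x| ≤ 8 * c₂) := by
    filter_upwards [hμ.mul_bounds hc₁ hη, hμs'.mul_bounds hc₁ hηs', hP.μaxi_mem.2] with x h1 h2 h3
    obtain ⟨-, -, w3⟩ := inv_one_sub_bounds hε0 hε8
    have h0 : 0 ≤ P.μaxi x + (1 - η x) * μ x := by linarith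
    have h0' : 0 ≤ a₂ x := mul_nonneg (sq_nonneg _) h0
    refine ⟨⟨by linarith, ?_⟩, ⟨h0', ?_⟩⟩
    · rw [abs_of_nonneg (by linarith)]; linarith
    · rw [abs_of_nonneg h0']
      calc w ^ 2 * (P.μaxi x + (1 - η x) * μ x) ≤ 2 * (2 * c₂) :=
            mul_le_mul (by linarith) (by linarith) h0 zero_le_two
        _ ≤ _ := by linarith
  have hmB : ∀ᵐ x ∂(volume.restrict P.Ω), |P.μam x| ≤ 8 * c₂ :=
    hP.μam_mem.2.mono fun x h => by rw [abs_of_nonneg (by linarith)]; linarith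
  -- the comparison solution
  obtain ⟨φ₂, hφ₂⟩ := hR.exists_excitation hco₂
  obtain ⟨ψ₂, hψ₂⟩ := hR.exists_emission hφ₂.1 hβ₂m (hbd.mono fun x h => h.2.2.2)
  have hm₂ : P.IsModel α₂ β₂ φ₂ ψ₂ := ⟨hφ₂, hψ₂⟩
  have hce : 0 ≤ c₂ * ε := by positivity
  have hsub : ∀ᵐ x ∂(volume.restrict P.Ω),
      |P.μaxi x + μs x - (P.μaxi x + μ x)| ≤ 16 * c₂ * ε ∧
      |ηs x * μs x - η x * μ x| ≤ 16 * c₂ * ε ∧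
      |P.μaxi x + (1 - ηs x) * μs x - (P.μaxi x + (1 - η x) * μ x)| ≤ 16 * c₂ * ε := by
    filter_upwards [hrange] with x hx
    have := hx.abs_sub_le hc₁ hε0 (by linarith)
    simp only [hμs, hηs, es, add_sub_add_left_eq_sub]
    exact ⟨by linarith [this.1], by linarith [this.2.1], by linarith [this.2.2]⟩
  have n₁ := hR.eLpNorm_output_sub_le (B := 8 * c₂) (κ := 16 * c₂ * ε) hαs hα hms hm hasm ham hβsm
    hβm (habd.mono fun _ h => h.1.2) (hbd.mono fun _ h => h.2.1.2) hmB
    (hsub.mono fun _ h => h.1) (hsub.mono fun _ h => h.2.2) (hsub.mono fun _ h => h.2.1)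
  have hup := hrange.mono fun x hx => hx.upper hc₁ hε0 hε8 hsδ
  have n₂ := hR.eLpNorm_output_sub_le (B := 8 * c₂) (κ := 16 * c₂ * ε) hco₂ hα hm₂ hm ha₂m ham hβ₂m
    hβm (habd.mono fun _ h => h.2.2) (hbd.mono fun _ h => h.2.2.2) hmB
    (hup.mono fun _ h => h.2.2.1) (hup.mono fun _ h => h.2.2.2.2) (hup.mono fun _ h => h.2.2.2.1)
  have hlow := hrange.mono fun x hx => hx.lower hc₁ hε0 hε8
  have cs := hR.sq_output_le (B := 8 * c₂) (a := fun x => P.μaxi x + (1 - η x) * μ x)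
    (a' := fun x => P.μaxi x + (1 - ηs x) * μs x) (a'' := a₂) hα hαs hco₂ hm hms hm₂ hβm hβsm hβ₂m
    hbd (habd.mono fun _ h => ⟨h.1.1, h.2.1⟩)
    (hlow.mono fun x h => by
      have h3 := h.2.2
      rw [← es] at h3
      have e2 : 4 * c₂ - α₂ x - P.μsx x = (4 * c₂ - (P.μaxi x + μ x) - P.μsx x) * w := by
        rw [hα₂]; ring
      rw [e2]
      exact h3)
    (hlow.mono fun x h => by
      have h3 := h.1
      rw [← es, ← es] at h3
      exact h3)
    (hlow.mono fun x h => by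
      have h3 := h.2.1
      rw [← es, ← es] at h3
      exact h3)
  refine ⟨hR.phaseNorm_sub_le hαs hα hms hm (hsub.mono fun _ h => h.1), ?_⟩
  set Ψ := P.output a₂ φ₂ ψ₂ with hΨ
  have mH : AEStronglyMeasurable (fun x => P.H μs ηs x - P.H μ η x) (volume.restrict P.Ω) :=
    ((hP.H_memLp hc₁ hc hμs' hηs').sub (hP.H_memLp hc₁ hc hμ hη)).1
  have mΨ : AEStronglyMeasurable (fun x => Ψ x - P.H μ η x) (volume.restrict P.Ω) :=
    ((hR.output_memLp hm₂ ha₂m (habd.mono fun _ h => h.2.2) hmB).sub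
      (hP.H_memLp hc₁ hc hμ hη)).1
  have scale : ∀ u : Space d → ℝ, eLpNorm u 2 (volume.restrict P.Ω)
      ≤ ENNReal.ofReal (16 * c₂ * ε)
        * (perturbationBound d c₁ (8 * c₂) * phaseNorm P.Ω (P.phiX μ)) →
      eLpNorm (fun x => s⁻¹ * |u x|) 2 (volume.restrict P.Ω) ≤ ENNReal.ofReal (16 * c₂ / δ)
        * (perturbationBound d c₁ (8 * c₂) * phaseNorm P.Ω (P.phiX μ)) := by
    intro u hu
    have h1 : eLpNorm (fun x => s⁻¹ * |u x|) 2 (volume.restrict P.Ω)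
        ≤ ENNReal.ofReal s⁻¹ * eLpNorm u 2 (volume.restrict P.Ω) := by
      refine eLpNorm_le_mul_eLpNorm_of_ae_le_mul (ae_of_all _ fun x => ?_) 2
      rw [norm_mul, Real.norm_eq_abs, Real.norm_eq_abs, abs_abs, abs_of_pos (inv_pos.2 hs)]
      exact le_rfl
    refine h1.trans ((mul_le_mul_right hu _).trans_eq ?_)
    rw [← mul_assoc, ← ENNReal.ofReal_mul (by positivity)]
    congr 2
    rw [hε]
    field_simp
  have g1 : AEStronglyMeasurable (fun x => s⁻¹ * |P.H μs ηs x - P.H μ η x|)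
    (volume.restrict P.Ω) := mH.norm.const_mul _
  have g2 : AEStronglyMeasurable (fun x => s⁻¹ * |Ψ x - P.H μ η x|)
    (volume.restrict P.Ω) := mΨ.norm.const_mul _
  -- `s G` is the sum of the two deviations from `h`: the first term alone bounds `|H_s - h|`, and
  -- the second gives `Ψ ≤ h + s G`.
  refine ⟨fun x => s⁻¹ * |P.H μs ηs x - P.H μ η x| + s⁻¹ * |Ψ x - P.H μ η x|, g1.add g2, ?_, ?_⟩
  · rw [mul_two]
    exact (eLpNorm_add_le g1 g2 one_le_two).trans (add_le_add (scale _ n₁) (scale _ n₂))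
  · have hnn : ∀ᵐ x ∂(volume.restrict P.Ω), 0 ≤ P.H μs ηs x := by
      have h2 := hR.emission_nonneg hαs hms hβsm (hbd.mono fun _ h => h.2.1.2)
        (hbd.mono fun _ h => h.2.1.1)
      have h1 := hR.excitation_pos hαs hms.excitation
      filter_upwards [Measure.ae_ae_of_ae_prod h1, Measure.ae_ae_of_ae_prod h2, habd,
        hP.μam_mem.2] with x p1 p2 p3 p4
      exact add_nonneg (mul_nonneg p3.1.1 (integral_nonneg_of_ae (p1.mono fun _ h => le_of_lt h)))
        (mul_nonneg (by linarith) (integral_nonneg_of_ae p2))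
    filter_upwards [cs, hnn] with x hx hx0
    have hss : s * (s⁻¹ * |P.H μs ηs x - P.H μ η x| + s⁻¹ * |Ψ x - P.H μ η x|)
        = |P.H μs ηs x - P.H μ η x| + |Ψ x - P.H μ η x| := by field_simp
    rw [hss]
    refine ⟨le_add_of_nonneg_right (abs_nonneg _), ?_⟩
    have hx' : P.H μ η x ^ 2 ≤ P.H μs ηs x * Ψ x := hx
    refine hx'.trans (mul_le_mul_of_nonneg_left ?_ hx0)
    linarith [le_abs_self (Ψ x - P.H μ η x), abs_nonneg (P.H μs ηs x - P.H μ η x)]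

end FPAT
end

noncomputable section

namespace FPAT

open scoped ENNReal

variable {d : ℕ} {Ω : Set (Space d)}

/-! ### The directional derivative by duality -/

theorem integrable_mul_of_memLp {a b : Space d → ℝ} (ha : MemLp a 2 (volume.restrict Ω))
    (hb : MemLp b 2 (volume.restrict Ω)) :
    Integrable (fun x => a x * b x) (volume.restrict Ω) :=
  MemLp.integrable_mul ha hb

theorem integral_lift_mul {a : Space d → ℝ} {φ : Space d → Dir d → ℝ}
    (ha : MemLp a 2 (volume.restrict Ω)) (hφ : PhaseL2 Ω φ) :
    ∫ p, φ p.1 p.2 * a p.1 ∂(phaseMeasure Ω) = ∫ x in Ω, a x * collect φ x := by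
  simp_rw [mul_comm (φ _ _)]
  exact integral_mul_collect ((phaseL2_lift ha).integrable_mul hφ)

theorem tendsto_integral_mul {ι : Type*} {l : Filter ι} {Φ : ι → Space d → Dir d → ℝ}
    {φ g : Space d → Dir d → ℝ} (hg : PhaseL2 Ω g) (hφ : PhaseL2 Ω φ)
    (hΦ : ∀ᶠ i in l, PhaseL2 Ω (Φ i))
    (hlim : Tendsto (fun i => phaseNorm Ω (fun x θ => Φ i x θ - φ x θ)) l (𝓝 0)) :
    Tendsto (fun i => ∫ p, Φ i p.1 p.2 * g p.1 p.2 ∂(phaseMeasure Ω)) l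
      (𝓝 (∫ p, φ p.1 p.2 * g p.1 p.2 ∂(phaseMeasure Ω))) := by
  rw [tendsto_iff_edist_tendsto_0]
  have h0 : Tendsto (fun i => phaseNorm Ω (fun x θ => Φ i x θ - φ x θ) * phaseNorm Ω g) l (𝓝 0) := by
    simpa using ENNReal.Tendsto.mul_const hlim (Or.inr hg.2.ne)
  refine tendsto_of_tendsto_of_tendsto_of_le_of_le' tendsto_const_nhds h0
    (Eventually.of_forall fun _ => zero_le) (hΦ.mono fun i hi => ?_)
  rw [edist_eq_enorm_sub, ← integral_sub (hi.integrable_mul hg) (hφ.integrable_mul hg)]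
  simp_rw [← sub_mul]
  exact enorm_integral_mul_le (hi.1.sub hφ.1) hg.1

variable {P : Setup d} {c M B : ℝ} {α β a α₀ β₀ a₀ ρ : Space d → ℝ}
  {φ ψ φ₀ ψ₀ φs ψs : Space d → Dir d → ℝ}

/-- The exact increment of a linear functional of the absorbed energy, in terms of the adjoint
densities `φs`, `ψs` at the reference coefficients. -/
theorem Setup.Regular.integral_mul_output_sub (hP : P.Regular c M)
    (hα₀ : Coefficients P.Ω c M α₀ P.μsx) (hα : AEMeasurable α (volume.restrict P.Ω))
    (hβ : AEMeasurable β (volume.restrict P.Ω)) (hβ₀ : AEMeasurable β₀ (volume.restrict P.Ω))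
    (ha : AEMeasurable a (volume.restrict P.Ω)) (ha₀ : AEMeasurable a₀ (volume.restrict P.Ω))
    (hB : ∀ᵐ x ∂(volume.restrict P.Ω), |α₀ x - α x| ≤ B ∧ |β x| ≤ B ∧ |β₀ x| ≤ B ∧ |a x| ≤ B ∧
      |a₀ x| ≤ B ∧ |P.μam x| ≤ B)
    (hm : P.IsModel α β φ ψ) (hm₀ : P.IsModel α₀ β₀ φ₀ ψ₀)
    (hρ : MemLp ρ 2 (volume.restrict P.Ω))
    (hψs : SolvesRTE P.Ω P.f backwardDir P.μam P.μsm (fun x _ => ρ x * P.μam x)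
      (fun _ _ => 0) ψs)
    (hφs : SolvesRTE P.Ω P.f backwardDir α₀ P.μsx
      (fun x _ => β₀ x * average ψs x + ρ x * a₀ x) (fun _ _ => 0) φs) :
    ∫ x in P.Ω, ρ x * (P.output a φ ψ x - P.output a₀ φ₀ ψ₀ x)
      = (∫ x in P.Ω, (ρ x * (a x - a₀ x) * collect φ x
          + (β x - β₀ x) * average φ x * collect ψs x))
        + ∫ p, (α₀ p.1 - α p.1) * φ p.1 p.2 * φs p.1 p.2 ∂(phaseMeasure P.Ω) := by
  have hφ : PhaseL2 P.Ω φ := hm.excitation.1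
  have hφ₀ : PhaseL2 P.Ω φ₀ := hm₀.excitation.1
  have hψ : PhaseL2 P.Ω ψ := hm.emission.1
  have hψ₀ : PhaseL2 P.Ω ψ₀ := hm₀.emission.1
  have hψsL : PhaseL2 P.Ω ψs := hψs.1
  have hδ : PhaseL2 P.Ω (fun x θ => φ x θ - φ₀ x θ) := hφ.sub hφ₀
  have hδψ : PhaseL2 P.Ω (fun x θ => ψ x θ - ψ₀ x θ) := hψ.sub hψ₀
  have hmm : AEMeasurable P.μam (volume.restrict P.Ω) := hP.emission.aemeasurable_a
  have mulR : ∀ {k : Space d → ℝ}, AEMeasurable k (volume.restrict P.Ω) →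
      (∀ᵐ x ∂(volume.restrict P.Ω), |k x| ≤ B) →
      MemLp (fun x => ρ x * k x) 2 (volume.restrict P.Ω) := fun hk hkB => by
    simpa only [mul_comm] using memLp_coeff_mul hρ hk hkB
  have hρm := mulR hmm (hB.mono fun x h => h.2.2.2.2.2)
  have hρa := mulR ha (hB.mono fun x h => h.2.2.2.1)
  have hρa₀ := mulR ha₀ (hB.mono fun x h => h.2.2.2.2.1)
  have hβφ := memLp_coeff_mul hφ.average_memLp hβ (hB.mono fun x h => h.2.1)
  have hβφ₀ := memLp_coeff_mul hφ₀.average_memLp hβ₀ (hB.mono fun x h => h.2.2.1)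
  have hβ₀φ := memLp_coeff_mul hφ.average_memLp hβ₀ (hB.mono fun x h => h.2.2.1)
  have hβψs := memLp_coeff_mul hψsL.average_memLp hβ₀ (hB.mono fun x h => h.2.2.1)
  have hq : MemLp (fun x => β x * average φ x - β₀ x * average φ₀ x) 2 (volume.restrict P.Ω) :=
    hβφ.sub hβφ₀
  have hp : MemLp (fun x => β₀ x * average ψs x + ρ x * a₀ x) 2 (volume.restrict P.Ω) :=
    hβψs.add hρa₀
  have e1 : ∫ x in P.Ω, ρ x * P.μam x * collect (fun x θ => ψ x θ - ψ₀ x θ) x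
      = ∫ x in P.Ω, (β x * average φ x - β₀ x * average φ₀ x) * collect ψs x := by
    rw [← integral_lift_mul hρm hδψ, ← integral_lift_mul hq hψsL]
    have hs : SolvesRTE P.Ω P.f forwardDir P.μam P.μsm
        (fun x _ => β x * average φ x - β₀ x * average φ₀ x) (fun _ _ => 0)
        (fun x θ => ψ x θ - ψ₀ x θ) := by
      simpa only [sub_zero] using
        hm.emission.sub hP.domain unitField_forwardDir hP.kernel hm₀.emission
    rw [hs.integral_mul hP.domain unitField_forwardDir hP.kernel hP.emission hP.c_pos
      (phaseL2_lift hq) (phaseL2_lift hρm) hψs]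
    simp_rw [mul_comm]
  have e2 : ∫ x in P.Ω, (β₀ x * average ψs x + ρ x * a₀ x)
        * collect (fun x θ => φ x θ - φ₀ x θ) x
      = ∫ p, (α₀ p.1 - α p.1) * φ p.1 p.2 * φs p.1 p.2 ∂(phaseMeasure P.Ω) := by
    rw [← integral_lift_mul hp hδ]
    -- Here the equation keeps the reference absorption and the perturbed density enters the source,
    -- so the adjoint density at the reference coefficients applies. The resulting increment is
    -- exact.
    exact (hm.excitation.sub_absorption hP.domain unitField_forwardDir hP.kernel
      hm₀.excitation).integral_mul hP.domain unitField_forwardDir hP.kernel hα₀ hP.c_pos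
      (hφ.coeff_mul (hα₀.aemeasurable_a.sub hα) (hB.mono fun x h => h.1))
      (phaseL2_lift hp) hφs
  have i1 := integrable_mul_of_memLp hρa hφ.collect_memLp
  have i1' := integrable_mul_of_memLp hρa₀ hφ.collect_memLp
  have i2 := integrable_mul_of_memLp hρm hδψ.collect_memLp
  have i3 := integrable_mul_of_memLp hρa₀ hδ.collect_memLp
  have i4 := integrable_mul_of_memLp hβφ hψsL.collect_memLp
  have i5 := integrable_mul_of_memLp hβψs hδ.collect_memLp
  have i6 := integrable_mul_of_memLp hβ₀φ hψsL.collect_memLp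
  rw [← e2]
  have l1 : ∫ x in P.Ω, ρ x * (P.output a φ ψ x - P.output a₀ φ₀ ψ₀ x)
      = ∫ x in P.Ω, (ρ x * (a x - a₀ x) * collect φ x
        + ρ x * a₀ x * collect (fun x θ => φ x θ - φ₀ x θ) x
        + ρ x * P.μam x * collect (fun x θ => ψ x θ - ψ₀ x θ) x) := by
    refine integral_congr_ae ?_
    filter_upwards [collect_sub hφ hφ₀, collect_sub hψ hψ₀] with x h1 h2
    rw [h1, h2]
    unfold Setup.output
    ring
  have l2 : ∫ x in P.Ω, (β x * average φ x - β₀ x * average φ₀ x) * collect ψs x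
      = ∫ x in P.Ω, ((β x - β₀ x) * average φ x * collect ψs x
        + β₀ x * average ψs x * collect (fun x θ => φ x θ - φ₀ x θ) x) := by
    refine integral_congr_ae ?_
    filter_upwards [collect_sub hφ hφ₀] with x h1
    rw [h1]
    simp only [average_eq]
    ring
  have j1 : Integrable (fun x => ρ x * (a x - a₀ x) * collect φ x) (volume.restrict P.Ω) :=
    (i1.sub i1').congr (ae_of_all _ fun x => by simp only [Pi.sub_apply]; ring)
  have j2 : Integrable (fun x => (β x - β₀ x) * average φ x * collect ψs x)
      (volume.restrict P.Ω) :=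
    (i4.sub i6).congr (ae_of_all _ fun x => by simp only [Pi.sub_apply]; ring)
  have j13 : Integrable (fun x => ρ x * (a x - a₀ x) * collect φ x
      + ρ x * a₀ x * collect (fun x θ => φ x θ - φ₀ x θ) x) (volume.restrict P.Ω) := j1.add i3
  rw [l1, integral_add j13 i2, integral_add j1 i3, e1, l2, integral_add j2 i5, integral_add j1 j2]
  simp_rw [add_mul]
  rw [integral_add i5 i3]
  ring

end FPAT

end

noncomputable section

namespace FPAT

open scoped ENNReal

variable {d : ℕ} {Ω : Set (Space d)}

/-! ### Feasible directions and the limit of the difference quotients -/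

/-- A direction is a scaled difference of two members of the class, hence measurable and essentially
bounded. This makes all weights below square integrable. -/
theorem InRange.direction {l b δ : ℝ} {u v : Space d → ℝ} (hu : InRange Ω l b u) (hδ : 0 < δ)
    (huv : InRange Ω l b (fun x => u x + δ * v x)) :
    AEMeasurable v (volume.restrict Ω) ∧ ∀ᵐ x ∂(volume.restrict Ω), |v x| ≤ (b - l) / δ := by
  refine ⟨((huv.1.sub hu.1).div_const δ).congr (ae_of_all _ fun x => ?_), ?_⟩
  · simp only [Pi.sub_apply, add_sub_cancel_left]
    field_simp
  · filter_upwards [hu.2, huv.2] with x h1 h2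
    rw [le_div_iff₀ hδ, ← abs_of_pos hδ, ← abs_mul, mul_comm]
    exact abs_le.2 ⟨by linarith, by linarith⟩

theorem FeasibleDir.exists_step {l b : ℝ} {u v : Space d → ℝ} (h : FeasibleDir Ω l b u v) :
    ∃ δ > 0, ∀ s : ℝ, 0 < s → s ≤ δ → InRange Ω l b (fun x => u x + s * v x) := by
  obtain ⟨δ, hδ, h⟩ := h
  exact ⟨δ / 2, by positivity, fun s h0 h1 => h s h0 (by linarith)⟩

theorem ae_abs_mul_le {u v : Space d → ℝ} {A B : ℝ}
    (hu : ∀ᵐ x ∂(volume.restrict Ω), |u x| ≤ A) (hv : ∀ᵐ x ∂(volume.restrict Ω), |v x| ≤ B) :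
    ∀ᵐ x ∂(volume.restrict Ω), |u x * v x| ≤ A * B := by
  filter_upwards [hu, hv] with x h1 h2
  rw [abs_mul]
  exact mul_le_mul h1 h2 (abs_nonneg _) ((abs_nonneg _).trans h1)

section

variable {P : Setup d} {c₁ c₂ δ : ℝ} {μ η hf hη' ρ : Space d → ℝ} {ψs φs : Space d → Dir d → ℝ}

/-- The weight of `A φ_x` in the derivative in the direction `(hf, 0)`. -/
def weightMu (η ρ hf : Space d → ℝ) (ψs : Space d → Dir d → ℝ) (x : Space d) : ℝ :=
  (1 - η x) * hf x * ρ x + η x * hf x * average ψs x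

/-- The weight of `A φ_x` in the derivative in the direction `(0, hη')`. -/
def weightEta (μ ρ hη' : Space d → ℝ) (ψs : Space d → Dir d → ℝ) (x : Space d) : ℝ :=
  μ x * hη' x * average ψs x - μ x * hη' x * ρ x

/-- The weight of `A φ_x` in the second order term. -/
def weightMixed (ρ hf hη' : Space d → ℝ) (ψs : Space d → Dir d → ℝ) (x : Space d) : ℝ :=
  hf x * hη' x * average ψs x - hf x * hη' x * ρ x

theorem weight_memLp (hμ : InRange Ω c₁ c₂ μ) (hη : InRange Ω 0 1 η) (hc₁ : 0 < c₁) (hδ : 0 < δ)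
    (hfδ : InRange Ω c₁ c₂ (fun x => μ x + δ * hf x))
    (hηδ : InRange Ω 0 1 (fun x => η x + δ * hη' x))
    (hρ : MemLp ρ 2 (volume.restrict Ω)) (hψs : PhaseL2 Ω ψs) :
    MemLp (weightMu η ρ hf ψs) 2 (volume.restrict Ω) ∧
    MemLp (weightEta μ ρ hη' ψs) 2 (volume.restrict Ω) ∧
    MemLp (weightMixed ρ hf hη' ψs) 2 (volume.restrict Ω) := by
  obtain ⟨f1, f2⟩ := hμ.direction hδ hfδ
  obtain ⟨g1, g2⟩ := hη.direction hδ hηδ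
  have m2 : ∀ᵐ x ∂(volume.restrict Ω), |μ x| ≤ c₂ :=
    hμ.2.mono fun x h => abs_le.2 ⟨by linarith, h.2⟩
  have e2 : ∀ᵐ x ∂(volume.restrict Ω), |η x| ≤ 1 :=
    hη.2.mono fun x h => abs_le.2 ⟨by linarith, h.2⟩
  have e3 : ∀ᵐ x ∂(volume.restrict Ω), |1 - η x| ≤ 1 :=
    hη.2.mono fun x h => abs_le.2 ⟨by linarith, by linarith⟩
  have hA := hψs.average_memLp
  exact ⟨(memLp_coeff_mul hρ ((aemeasurable_const.sub hη.1).mul f1) (ae_abs_mul_le e3 f2)).add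
      (memLp_coeff_mul hA (hη.1.mul f1) (ae_abs_mul_le e2 f2)),
    (memLp_coeff_mul hA (hμ.1.mul g1) (ae_abs_mul_le m2 g2)).sub
      (memLp_coeff_mul hρ (hμ.1.mul g1) (ae_abs_mul_le m2 g2)),
    (memLp_coeff_mul hA (f1.mul g1) (ae_abs_mul_le f2 g2)).sub
      (memLp_coeff_mul hρ (f1.mul g1) (ae_abs_mul_le f2 g2))⟩

/-- The difference quotient of a linear functional of the absorbed energy. -/
theorem Setup.Admissible.integral_mul_quotient (hP : P.Admissible c₁ c₂) (hc₁ : 0 < c₁)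
    (hc : c₁ ≤ c₂) (hμ : InRange P.Ω c₁ c₂ μ) (hη : InRange P.Ω 0 1 η) {s : ℝ} (hs : 0 < s)
    (hfs : InRange P.Ω c₁ c₂ (fun x => μ x + s * hf x))
    (hηs : InRange P.Ω 0 1 (fun x => η x + s * hη' x))
    (hρ : MemLp ρ 2 (volume.restrict P.Ω))
    (hψs : SolvesRTE P.Ω P.f backwardDir P.μam P.μsm (fun x _ => ρ x * P.μam x)
      (fun _ _ => 0) ψs)
    (hφs : SolvesRTE P.Ω P.f backwardDir (fun x => P.μaxi x + μ x) P.μsx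
      (fun x _ => η x * μ x * average ψs x + ρ x * (P.μaxi x + (1 - η x) * μ x))
      (fun _ _ => 0) φs) :
    ∫ x in P.Ω, ρ x * ((P.H (fun x => μ x + s * hf x) (fun x => η x + s * hη' x) x
        - P.H μ η x) / s)
      = ∫ p, P.phiX (fun x => μ x + s * hf x) p.1 p.2
          * (weightMu η ρ hf ψs p.1 + weightEta μ ρ hη' ψs p.1 - hf p.1 * φs p.1 p.2)
          ∂(phaseMeasure P.Ω)
        + s * ∫ p, P.phiX (fun x => μ x + s * hf x) p.1 p.2 * weightMixed ρ hf hη' ψs p.1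
          ∂(phaseMeasure P.Ω) := by
  have hR := hP.regular hc₁ hc
  have hm := hP.isModel hc₁ hc hμ hη
  have hms := hP.isModel hc₁ hc hfs hηs
  have hφ : PhaseL2 P.Ω (P.phiX (fun x => μ x + s * hf x)) := hms.excitation.1
  have hψsL : PhaseL2 P.Ω ψs := hψs.1
  have hφsL : PhaseL2 P.Ω φs := hφs.1
  -- This bound on `hf` deteriorates as `s` decreases; it only serves integrability at the given
  -- `s`.
  obtain ⟨f1, f2⟩ := hμ.direction hs hfs
  obtain ⟨w1, w2, w3⟩ := weight_memLp hμ hη hc₁ hs hfs hηs hρ hψsL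
  have w12 : MemLp (fun x => weightMu η ρ hf ψs x + weightEta μ ρ hη' ψs x) 2
    (volume.restrict P.Ω) := w1.add w2
  have key := hR.integral_mul_output_sub (B := 2 * c₂)
    (α := fun x => P.μaxi x + (μ x + s * hf x)) (α₀ := fun x => P.μaxi x + μ x)
    (β := fun x => (η x + s * hη' x) * (μ x + s * hf x)) (β₀ := fun x => η x * μ x)
    (a := fun x => P.μaxi x + (1 - (η x + s * hη' x)) * (μ x + s * hf x))
    (a₀ := fun x => P.μaxi x + (1 - η x) * μ x) (hP.coefficients hc₁ hμ)
    (hP.μaxi_mem.1.add hfs.1) (hηs.1.mul hfs.1) (hη.1.mul hμ.1)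
    (hP.μaxi_mem.1.add ((aemeasurable_const.sub hηs.1).mul hfs.1))
    (hP.μaxi_mem.1.add ((aemeasurable_const.sub hη.1).mul hμ.1))
    (by
      filter_upwards [hμ.mul_bounds hc₁ hη, hfs.mul_bounds hc₁ hηs, hμ.2, hfs.2, hP.μaxi_mem.2,
        hP.μam_mem.2] with x h1 h2 h3 h4 h5 h6
      refine ⟨?_, ?_, ?_, ?_, ?_, ?_⟩ <;> refine abs_le.2 ⟨?_, ?_⟩ <;> linarith)
    hms hm hρ hψs hφs
  have i1 : Integrable (fun x => (weightMu η ρ hf ψs x + weightEta μ ρ hη' ψs x)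
      * collect (P.phiX (fun x => μ x + s * hf x)) x) (volume.restrict P.Ω) :=
    integrable_mul_of_memLp w12 hφ.collect_memLp
  have i3 : Integrable (fun x => weightMixed ρ hf hη' ψs x
      * collect (P.phiX (fun x => μ x + s * hf x)) x) (volume.restrict P.Ω) :=
    integrable_mul_of_memLp w3 hφ.collect_memLp
  have hfφ := hφsL.coeff_mul f1 f2
  have e1 : ∫ p, P.phiX (fun x => μ x + s * hf x) p.1 p.2
        * (weightMu η ρ hf ψs p.1 + weightEta μ ρ hη' ψs p.1 - hf p.1 * φs p.1 p.2)
          ∂(phaseMeasure P.Ω)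
      = (∫ x in P.Ω, (weightMu η ρ hf ψs x + weightEta μ ρ hη' ψs x)
          * collect (P.phiX (fun x => μ x + s * hf x)) x)
        - ∫ p, P.phiX (fun x => μ x + s * hf x) p.1 p.2 * (hf p.1 * φs p.1 p.2)
          ∂(phaseMeasure P.Ω) := by
    rw [← integral_lift_mul w12 hφ, ← integral_sub (hφ.integrable_mul (phaseL2_lift w12))
      (hφ.integrable_mul hfφ)]
    simp_rw [mul_sub]
  have e3 : ∫ p, (P.μaxi p.1 + μ p.1 - (P.μaxi p.1 + (μ p.1 + s * hf p.1)))
        * P.phiX (fun x => μ x + s * hf x) p.1 p.2 * φs p.1 p.2 ∂(phaseMeasure P.Ω)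
      = -s * ∫ p, P.phiX (fun x => μ x + s * hf x) p.1 p.2 * (hf p.1 * φs p.1 p.2)
          ∂(phaseMeasure P.Ω) := by
    rw [← integral_const_mul]
    exact integral_congr_ae (ae_of_all _ fun p => by ring)
  have e2 : ∫ x in P.Ω, (ρ x * ((P.μaxi x + (1 - (η x + s * hη' x)) * (μ x + s * hf x))
          - (P.μaxi x + (1 - η x) * μ x)) * collect (P.phiX (fun x => μ x + s * hf x)) x
        + ((η x + s * hη' x) * (μ x + s * hf x) - η x * μ x)
          * average (P.phiX (fun x => μ x + s * hf x)) x * collect ψs x)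
      = s * ((∫ x in P.Ω, (weightMu η ρ hf ψs x + weightEta μ ρ hη' ψs x)
          * collect (P.phiX (fun x => μ x + s * hf x)) x)
        + s * ∫ x in P.Ω, weightMixed ρ hf hη' ψs x
          * collect (P.phiX (fun x => μ x + s * hf x)) x) := by
    -- Products of two displaced coefficients are quadratic in `s`: the linear parts are collected
    -- in `weightMu` and `weightEta`, the quadratic part in `weightMixed`.
    rw [← integral_const_mul s, ← integral_add i1 (i3.const_mul s), ← integral_const_mul]
    refine integral_congr_ae (ae_of_all _ fun x => ?_)
    simp only [weightMu, weightEta, weightMixed, average_eq]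
    ring
  rw [e1, integral_lift_mul w3 hφ]
  simp_rw [mul_div_assoc', integral_div]
  rw [div_eq_iff hs.ne']
  refine key.trans ?_
  rw [e2, e3]
  ring

/-- The step sizes for which the perturbed energies are compared with the reference energy. -/
theorem step_le {s : ℝ} (hc₁ : 0 < c₁) (hc : c₁ ≤ c₂) (hδ : 0 < δ)
    (hs : s < δ * c₁ / (8 * c₂)) : 8 * c₂ * (s / δ) ≤ c₁ ∧ s ≤ δ := by
  have hc2 : 0 < c₂ := hc₁.trans_le hc
  rw [lt_div_iff₀ (by positivity)] at hs
  constructor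
  · rw [mul_div_assoc', div_le_iff₀ hδ]
    linarith
  · have : s * c₂ ≤ δ * c₂ := by nlinarith
    exact le_of_mul_le_mul_right this hc2

theorem Setup.Admissible.tendsto_phiX (hP : P.Admissible c₁ c₂) (hc₁ : 0 < c₁)
    (hc : c₁ ≤ c₂) (hμ : InRange P.Ω c₁ c₂ μ) (hη : InRange P.Ω 0 1 η) (hδ : 0 < δ)
    (hfδ : ∀ s : ℝ, 0 < s → s ≤ δ → InRange P.Ω c₁ c₂ (fun x => μ x + s * hf x))
    (hηδ : ∀ s : ℝ, 0 < s → s ≤ δ → InRange P.Ω 0 1 (fun x => η x + s * hη' x)) :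
    Tendsto (fun s => phaseNorm P.Ω
      (fun x θ => P.phiX (fun x => μ x + s * hf x) x θ - P.phiX μ x θ)) (𝓝[>] (0 : ℝ)) (𝓝 0) := by
  have hc2 : 0 < c₂ := hc₁.trans_le hc
  have hφ : PhaseL2 P.Ω (P.phiX μ) := (hP.isModel hc₁ hc hμ hη).excitation.1
  have h1 : Tendsto (fun s : ℝ => ENNReal.ofReal (16 * c₂ * (s / δ))) (𝓝[>] 0) (𝓝 0) := by
    have : Tendsto (fun s : ℝ => 16 * c₂ * (s / δ)) (𝓝[>] 0) (𝓝 0) := by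
      have h : Continuous fun s : ℝ => 16 * c₂ * (s / δ) := by fun_prop
      simpa using (h.tendsto 0).mono_left nhdsWithin_le_nhds
    simpa using ENNReal.tendsto_ofReal this
  have h2 : Tendsto (fun s : ℝ => ENNReal.ofReal (16 * c₂ * (s / δ))
      * (ENNReal.ofReal (2 / c₁) * phaseNorm P.Ω (P.phiX μ))) (𝓝[>] 0) (𝓝 0) := by
    simpa using ENNReal.Tendsto.mul_const h1
      (Or.inr (ENNReal.mul_ne_top ENNReal.ofReal_ne_top hφ.2.ne))
  refine tendsto_of_tendsto_of_tendsto_of_le_of_le' tendsto_const_nhds h2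
    (Eventually.of_forall fun _ => zero_le) ?_
  filter_upwards [Ioo_mem_nhdsGT (show 0 < δ * c₁ / (8 * c₂) by positivity)] with s hs
  exact (hP.exists_comparison hc₁ hc hμ hη hδ hfδ hηδ hs.1 (step_le hc₁ hc hδ hs.2).1).1

/-- The directional derivative of a linear functional of the absorbed energy. -/
theorem Setup.Admissible.tendsto_integral_quotient (hP : P.Admissible c₁ c₂) (hc₁ : 0 < c₁)
    (hc : c₁ ≤ c₂) (hμ : InRange P.Ω c₁ c₂ μ) (hη : InRange P.Ω 0 1 η) (hδ : 0 < δ)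
    (hfδ : ∀ s : ℝ, 0 < s → s ≤ δ → InRange P.Ω c₁ c₂ (fun x => μ x + s * hf x))
    (hηδ : ∀ s : ℝ, 0 < s → s ≤ δ → InRange P.Ω 0 1 (fun x => η x + s * hη' x))
    (hρ : MemLp ρ 2 (volume.restrict P.Ω))
    (hψs : SolvesRTE P.Ω P.f backwardDir P.μam P.μsm (fun x _ => ρ x * P.μam x)
      (fun _ _ => 0) ψs)
    (hφs : SolvesRTE P.Ω P.f backwardDir (fun x => P.μaxi x + μ x) P.μsx
      (fun x _ => η x * μ x * average ψs x + ρ x * (P.μaxi x + (1 - η x) * μ x))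
      (fun _ _ => 0) φs) :
    IntegrableOn (fun x => (ρ x * (1 - η x) * collect (P.phiX μ) x
      + collect ψs x * average (P.phiX μ) x * η x
      - collect (fun y θ => φs y θ * P.phiX μ y θ) x) * hf x) P.Ω ∧
    IntegrableOn (fun x => (-(ρ x * μ x * collect (P.phiX μ) x)
      + collect ψs x * average (P.phiX μ) x * μ x) * hη' x) P.Ω ∧
    Tendsto (fun s => ∫ x in P.Ω, ρ x *
        ((P.H (fun x => μ x + s * hf x) (fun x => η x + s * hη' x) x - P.H μ η x) / s))
      (𝓝[>] 0)
      (𝓝 ((∫ x in P.Ω, (ρ x * (1 - η x) * collect (P.phiX μ) x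
          + collect ψs x * average (P.phiX μ) x * η x
          - collect (fun y θ => φs y θ * P.phiX μ y θ) x) * hf x)
        + ∫ x in P.Ω, (-(ρ x * μ x * collect (P.phiX μ) x)
          + collect ψs x * average (P.phiX μ) x * μ x) * hη' x)) := by
  have hφ : PhaseL2 P.Ω (P.phiX μ) := (hP.isModel hc₁ hc hμ hη).excitation.1
  have hψsL : PhaseL2 P.Ω ψs := hψs.1
  have hφsL : PhaseL2 P.Ω φs := hφs.1
  obtain ⟨f1, f2⟩ := hμ.direction hδ (hfδ δ hδ le_rfl)
  obtain ⟨w1, w2, w3⟩ :=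
    weight_memLp hμ hη hc₁ hδ (hfδ δ hδ le_rfl) (hηδ δ hδ le_rfl) hρ hψsL
  have hfφ := hφsL.coeff_mul f1 f2
  have i0 : Integrable (fun p : Space d × Dir d => hf p.1 * (φs p.1 p.2 * P.phiX μ p.1 p.2))
      (phaseMeasure P.Ω) :=
    (hfφ.integrable_mul hφ).congr (ae_of_all _ fun p => by ring)
  have i0' : Integrable (fun x => hf x * collect (fun y θ => φs y θ * P.phiX μ y θ) x)
      (volume.restrict P.Ω) :=
    (Integrable.integral_prod_left i0).congr (ae_of_all _ fun x =>
      integral_const_mul (hf x) (fun θ => φs x θ * P.phiX μ x θ))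
  have i1 := integrable_mul_of_memLp w1 hφ.collect_memLp
  have i2 := integrable_mul_of_memLp w2 hφ.collect_memLp
  have g1 : (fun x => weightMu η ρ hf ψs x * collect (P.phiX μ) x
        - hf x * collect (fun y θ => φs y θ * P.phiX μ y θ) x)
      = fun x => (ρ x * (1 - η x) * collect (P.phiX μ) x
        + collect ψs x * average (P.phiX μ) x * η x
        - collect (fun y θ => φs y θ * P.phiX μ y θ) x) * hf x := by
    funext x
    simp only [weightMu, average_eq]
    ring
  have g2 : (fun x => weightEta μ ρ hη' ψs x * collect (P.phiX μ) x)
      = fun x => (-(ρ x * μ x * collect (P.phiX μ) x)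
        + collect ψs x * average (P.phiX μ) x * μ x) * hη' x := by
    funext x
    simp only [weightEta, average_eq]
    ring
  rw [← g1, ← g2]
  refine ⟨i1.sub i0', i2, ?_⟩
  have w12 : MemLp (fun x => weightMu η ρ hf ψs x + weightEta μ ρ hη' ψs x) 2
    (volume.restrict P.Ω) := w1.add w2
  have hlim := hP.tendsto_phiX hc₁ hc hμ hη hδ hfδ hηδ
  have hev : ∀ᶠ s in 𝓝[>] (0 : ℝ), 0 < s ∧ s ≤ δ := by
    filter_upwards [Ioo_mem_nhdsGT hδ] with s hs using ⟨hs.1, hs.2.le⟩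
  have hΦ : ∀ᶠ s in 𝓝[>] (0 : ℝ), PhaseL2 P.Ω (P.phiX (fun x => μ x + s * hf x)) :=
    hev.mono fun s h => (hP.isModel hc₁ hc (hfδ s h.1 h.2) (hηδ s h.1 h.2)).excitation.1
  -- The test functions do not depend on `s`; apart from the explicit factor `s`, the step enters
  -- only through the excitation density, which converges in `L²(X)`.
  have t1 := tendsto_integral_mul (g := fun x θ => weightMu η ρ hf ψs x + weightEta μ ρ hη' ψs x
    - hf x * φs x θ) ((phaseL2_lift w12).sub hfφ) hφ hΦ hlim
  have t2 := tendsto_integral_mul (phaseL2_lift w3) hφ hΦ hlim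
  have t0 : Tendsto (fun s : ℝ => s) (𝓝[>] 0) (𝓝 0) := nhdsWithin_le_nhds
  have t := t1.add (t0.mul t2)
  have e : ∫ p, P.phiX μ p.1 p.2
        * (weightMu η ρ hf ψs p.1 + weightEta μ ρ hη' ψs p.1 - hf p.1 * φs p.1 p.2)
          ∂(phaseMeasure P.Ω)
      = (∫ x in P.Ω, (weightMu η ρ hf ψs x * collect (P.phiX μ) x
          - hf x * collect (fun y θ => φs y θ * P.phiX μ y θ) x))
        + ∫ x in P.Ω, weightEta μ ρ hη' ψs x * collect (P.phiX μ) x := by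
    rw [integral_sub i1 i0', ← integral_mul_collect (φ := fun y θ => φs y θ * P.phiX μ y θ) i0,
      sub_add_eq_add_sub, ← integral_add i1 i2]
    simp_rw [← add_mul]
    rw [← integral_lift_mul w12 hφ, ← integral_sub (hφ.integrable_mul (phaseL2_lift w12)) i0]
    exact integral_congr_ae (ae_of_all _ fun p => by ring)
  rw [zero_mul, add_zero] at t
  rw [← e]
  refine t.congr' (hev.mono fun s h => ?_)
  exact (hP.integral_mul_quotient hc₁ hc hμ hη h.1 (hfδ s h.1 h.2) (hηδ s h.1 h.2) hρ hψs
    hφs).symm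

/-! ### Nondegeneracy -/

/-- A nonempty open set has positive measure, so the almost everywhere bounds hold at some point. -/
theorem Setup.Admissible.bounds_le (hP : P.Admissible c₁ c₂) (hμ : InRange P.Ω c₁ c₂ μ) :
    c₁ ≤ c₂ := by
  have h0 : volume P.Ω ≠ 0 := (hP.isOpen.measure_pos volume hP.nonempty).ne'
  have : NeZero (volume.restrict P.Ω) := ⟨by rwa [Ne, Measure.restrict_eq_zero]⟩
  obtain ⟨x, hx⟩ := hμ.2.exists
  exact hx.1.trans hx.2

theorem sphereMeasure_ne_zero [Nonempty (Dir d)] {f : Dir d → Dir d → ℝ}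
    (hf : ∀ θ, ∫ θ', f θ θ' ∂(sphereMeasure d) = 1) : sphereMeasure d ≠ 0 := by
  intro h
  obtain ⟨θ⟩ := ‹Nonempty (Dir d)›
  simpa [h] using hf θ

end

end FPAT

end

/-! ### The derivative of the misfit -/

theorem theorem4 {d : ℕ} (hd : d = 2 ∨ d = 3) (P : FPAT.Setup d) (c₁ c₂ : ℝ) (hc₁ : 0 < c₁)
    (hP : P.Admissible c₁ c₂)
    (μ η : FPAT.Space d → ℝ) (hμ : FPAT.InRange P.Ω c₁ c₂ μ) (hη : FPAT.InRange P.Ω 0 1 η)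
    (hstar : FPAT.Space d → ℝ) (hstar_pos : ∀ᵐ x ∂(volume.restrict P.Ω), 0 < hstar x)
    -- the misfit is finite at `(μ, η)`
    (hres : MemLp (P.residual hstar μ η) 2 (volume.restrict P.Ω))
    -- `1 / h` and `(log h - log h^*) / h` are square integrable
    (hinv : MemLp (fun x => 1 / P.H μ η x) 2 (volume.restrict P.Ω))
    (hsrc : MemLp (fun x => 1 / P.H μ η x * P.residual hstar μ η x) 2 (volume.restrict P.Ω))
    (φms φxs : FPAT.Space d → FPAT.Dir d → ℝ)
    (hφms : P.IsAdjointM hstar μ η φms) (hφxs : P.IsAdjointX hstar μ η φms φxs)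
    (hf hη' : FPAT.Space d → ℝ)
    (hf_feas : FPAT.FeasibleDir P.Ω c₁ c₂ μ hf) (hη_feas : FPAT.FeasibleDir P.Ω 0 1 η hη') :
    (∀ᶠ s : ℝ in 𝓝[>] 0,
      MemLp (P.residual hstar (fun x => μ x + s * hf x) (fun x => η x + s * hη' x)) 2
        (volume.restrict P.Ω)) ∧
    IntegrableOn (fun x => P.gradMu hstar μ η φms φxs x * hf x) P.Ω ∧
    IntegrableOn (fun x => P.gradEta hstar μ η φms x * hη' x) P.Ω ∧
    Tendsto
      (fun s : ℝ =>
        (P.misfit hstar (fun x => μ x + s * hf x) (fun x => η x + s * hη' x)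
          - P.misfit hstar μ η) / s)
      (𝓝[>] 0)
      (𝓝 ((∫ x in P.Ω, P.gradMu hstar μ η φms φxs x * hf x) +
        ∫ x in P.Ω, P.gradEta hstar μ η φms x * hη' x)) := by
  have : NeZero d := ⟨by omega⟩
  -- A unit vector is needed so that the normalization of the kernel holds at some direction; this
  -- makes the sphere measure nonzero and the absorbed energy positive.
  have : Nonempty (FPAT.Dir d) := ⟨⟨EuclideanSpace.single 0 1, by simp⟩⟩
  have hS := FPAT.sphereMeasure_ne_zero hP.f_integral
  have hc := hP.bounds_le hμ
  have hc2 : 0 < c₂ := hc₁.trans_le hc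
  obtain ⟨δ₁, hδ₁, hf₁⟩ := hf_feas.exists_step
  obtain ⟨δ₂, hδ₂, hη₂⟩ := hη_feas.exists_step
  obtain ⟨δ, hδ, hδ1, hδ2⟩ : ∃ δ > 0, δ ≤ δ₁ ∧ δ ≤ δ₂ :=
    ⟨min δ₁ δ₂, lt_min hδ₁ hδ₂, min_le_left _ _, min_le_right _ _⟩
  have hfδ : ∀ s : ℝ, 0 < s → s ≤ δ → FPAT.InRange P.Ω c₁ c₂ (fun x => μ x + s * hf x) :=
    fun s h0 h1 => hf₁ s h0 (h1.trans hδ1)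
  have hηδ : ∀ s : ℝ, 0 < s → s ≤ δ → FPAT.InRange P.Ω 0 1 (fun x => η x + s * hη' x) :=
    fun s h0 h1 => hη₂ s h0 (h1.trans hδ2)
  obtain ⟨k1, k2, k3⟩ := hP.tendsto_integral_quotient hc₁ hc hμ hη hδ hfδ hηδ hsrc hφms hφxs
  set δ₀ := δ * c₁ / (8 * c₂) with hδ₀
  have hδ₀pos : 0 < δ₀ := by positivity
  have hcmp := fun (s : ℝ) (h0 : 0 < s) (h1 : s < δ₀) =>
    (hP.exists_comparison hc₁ hc hμ hη hδ hfδ hηδ h0 (FPAT.step_le hc₁ hc hδ h1).1).2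
  choose! G hGm hGC hGH using hcmp
  set C : ENNReal := ENNReal.ofReal (16 * c₂ / δ) * (FPAT.perturbationBound d c₁ (8 * c₂)
    * FPAT.phaseNorm P.Ω (P.phiX μ)) * 2 with hC
  have hCtop : C ≠ ⊤ := by
    have h1 := FPAT.perturbationBound_ne_top (d := d) c₁ (8 * c₂)
    have h2 : FPAT.phaseNorm P.Ω (P.phiX μ) ≠ ⊤ :=
      (hP.isModel hc₁ hc hμ hη).excitation.1.2.ne
    exact ENNReal.mul_ne_top (ENNReal.mul_ne_top ENNReal.ofReal_ne_top
      (ENNReal.mul_ne_top h1 h2)) ENNReal.ofNat_ne_top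
  have hle : ∀ s : ℝ, s < δ₀ → s ≤ δ := fun s h => (FPAT.step_le hc₁ hc hδ h).2
  obtain ⟨m1, m2⟩ := FPAT.tendsto_log_misfit (C := C.toReal)
    (H := fun s => P.H (fun x => μ x + s * hf x) (fun x => η x + s * hη' x)) (G := G)
    (hP.H_pos hc₁ hc hS hμ hη) hres hinv hsrc hδ₀pos
    (fun s h0 h1 => (hP.H_memLp hc₁ hc (hfδ s h0 (hle s h1)) (hηδ s h0 (hle s h1))).1)
    (fun s h0 h1 => hP.H_pos hc₁ hc hS (hfδ s h0 (hle s h1)) (hηδ s h0 (hle s h1)))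
    hGm (fun s h0 h1 => by rw [ENNReal.ofReal_toReal hCtop]; exact hGC s h0 h1)
    (fun s h0 h1 => (hGH s h0 h1).mono fun x h => h.1)
    (fun s h0 h1 => (hGH s h0 h1).mono fun x h => h.2)
  have hr : ∀ s : ℝ, P.residual hstar (fun x => μ x + s * hf x) (fun x => η x + s * hη' x)
      = fun x => P.residual hstar μ η x + (Real.log (P.H (fun x => μ x + s * hf x)
        (fun x => η x + s * hη' x) x) - Real.log (P.H μ η x)) := fun s => by
    funext x
    simp only [FPAT.Setup.residual]
    ring
  refine ⟨m1.mono fun s h => by rw [hr s]; exact h, k1, k2, ?_⟩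
  -- The quotient of the misfit minus the linear functional tends to zero, and the linear functional
  -- tends to the gradient pairing.
  have h := m2.add k3
  simp only [sub_add_cancel, zero_add] at h
  refine h.congr fun s => ?_
  simp only [FPAT.Setup.misfit, hr s]
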